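/- Let $K$ be a finite abstract simplicial complex with vertex set $S$; the empty set $\varnothing$ counts as a simplex of $K$. Let $\widetilde C_*(K)=\bigoplus_{k\ge -1}C_k(K)$, where $C_k(K)$ is the free abelian group on ordered sequences $(v_0,\dots,v_k)$ of elements of $S$ modulo the relations that a sequence is $0$ if it has a repeated entry or if its underlying set is not in $K$, and that exchanging two entries changes the sign ($C_{-1}(K)=\mathbb Z$ is generated by the empty sequence). Let $C_*(K)=\bigoplus_{k\ge 0}C_k(K)$. On nonzero generators put $$d(v_0,\dots,v_k)=\sum_{i=0}^k(-1)^i(v_0,\dots,\hat v_i,\dots,v_k),\qquad \delta(v_0,\dots,v_k)=\sum_{v\in S}(v,v_0,\dots,v_k),$$ where in the unreduced group $C_*(K)$ one has $d(v)=0$. On $\widetilde C_*(K)\otimes\widetilde C_*(K)$ let $\Delta(\sigma\otimes\tau)=d\sigma\otimes\tau+(-1)^{|\sigma|}\sigma\otimes\delta\tau$, with $|\sigma|$ the number of vertices of $\sigma$. Let $\widetilde N^{p,q}(K)$ be the subgroup generated by all $\sigma\otimes\tau$ with $\sigma\subset\tau$, $\dim\sigma=p$, $\dim\tau=q$. The total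 complex $\widetilde T^n=\bigoplus_{q-p=n}\widetilde N^{p,q}(K)$, with differential $\Delta$, is filtered by $\widetilde F^p=\bigoplus_{i\le p}\widetilde N^{i,*}(K)$. Let $\widetilde E_r^{p,q}(K)$, $r\ge1$, be the spectral sequence of this filtered complex, so that $\widetilde E_1^{p,q}(K)=H^{q-p}(\widetilde F^p/\widetilde F^{p-1})$ and $\Delta_r\colon\widetilde E_r^{p,q}\to\widetilde E_r^{p-r,q-r+1}$. The reduced cohomeology groups are $\widetilde{\mathcal H}^{p,q}(K)=\widetilde E_2^{p,q}(K)$. The cohomeology groups $\mathcal H^{p,q}(K)=E_2^{p,q}(K)$ are defined in the same way from $C_*(K)$ in place of $\widetilde C_*(K)$ (only nonempty simplices are used). Theorem. Let $K$ and $L$ be finite simplicial complexes. (a) For all $p,q\in\mathbb Z$, $\mathcal H^{p,q}(K\sqcup L)\cong\mathcal H^{p,q}(K)\oplus\mathcal H^{p,q}(L)$, where $K\sqcup L$ is the disjoint union. (b) Let $K*L$ be the join, whose simplices are the disjoint unions $\sigma\sqcup\tau$ with $\sigma\in K$, $\tau\in L$ (either may be empty). Suppose that at least one of the bigraded groups $\widetilde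 E_1^{*,*}(K)$, $\widetilde E_1^{*,*}(L)$ is torsion-free, and that at least one of $\widetilde{\mathcal H}^{*,*}(K)$, $\widetilde{\mathcal H}^{*,*}(L)$ is torsion-free. Then for all $p,q\in\mathbb Z$ $$\widetilde{\mathcal H}^{p+1,q+1}(K*L)\cong\bigoplus_{\substack{p_1+p_2=p\\ q_1+q_2=q}}\widetilde{\mathcal H}^{p_1,q_1}(K)\otimes_{\mathbb Z}\widetilde{\mathcal H}^{p_2,q_2}(L).$$ -/

import Mathlib

open scoped TensorProduct DirectSum

/-! ### Oriented simplicial chains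

A finite abstract simplicial complex with vertex set `V` is an `AbstractSimplicialComplex V` with
`V` a finite type. Mathlib's complexes leave out the empty simplex, so `K.faces` is the set of
nonempty simplices and `insert ∅ K.faces` is the set of all simplices, the empty one included.
Unreduced chains are built on the former and reduced chains on the latter, so the constructions
below take the set `Φ` of admitted simplices as a parameter. -/

namespace Cohomeology

section Alternating

variable {V : Type*}

/-- `f` changes sign when two entries of a sequence are exchanged. -/
def IsAlternating {T : Type*} [AddCommGroup T] (f : List V → T) : Prop :=
  ∀ (a b c : List V) (v w : V),
    f (a ++ v :: (b ++ w :: c)) = - f (a ++ w :: (b ++ v :: c))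

theorem swap_perm (a b c : List V) (v w : V) :
    (a ++ v :: (b ++ w :: c)).Perm (a ++ w :: (b ++ v :: c)) := by
  refine List.Perm.append_left a ?_
  refine (List.Perm.cons v List.perm_middle).trans ?_
  refine (List.Perm.swap w v (b ++ c)).trans ?_
  exact List.Perm.cons w List.perm_middle.symm

/-- The alternating sum `∑ᵢ (-1)ⁱ f (v₀, …, v̂ᵢ, …, vₖ)`. -/
def faceSum {T : Type*} [AddCommGroup T] (f : List V → T) (l : List V) : T :=
  ∑ i ∈ Finset.range l.length, (-1 : ℤ) ^ i • f (l.eraseIdx i)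

theorem faceSum_cons {T : Type*} [AddCommGroup T] (f : List V → T) (x : V) (l : List V) :
    faceSum f (x :: l) = f l - faceSum (fun m => f (x :: m)) l := by
  simp only [faceSum, List.length_cons]
  rw [Finset.sum_range_succ']
  simp [pow_succ, sub_eq_add_neg, add_comm]

theorem faceSum_exchange {T : Type*} [AddCommGroup T] (v w : V) (c : List V) (b : List V) :
    ∀ F G : List V → T,
      (∀ b c : List V, F (b ++ w :: c) = - G (b ++ v :: c)) →
      faceSum F (b ++ w :: c) + faceSum G (b ++ v :: c) =
        (-1 : ℤ) ^ b.length • (F (b ++ c) + G (b ++ c)) := by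
  induction b with
  | nil =>
    intro F G h
    have h1 : (fun m => F (w :: m)) = fun m => - G (v :: m) := funext fun m => h [] m
    simp only [List.nil_append, faceSum_cons, h1]
    simp only [faceSum, smul_neg, Finset.sum_neg_distrib, List.length_nil, pow_zero, one_smul]
    abel
  | cons x b ih =>
    intro F G h
    have h1 := ih (fun m => F (x :: m)) (fun m => G (x :: m)) fun b c => h (x :: b) c
    simp only [List.cons_append, faceSum_cons, h b c, List.length_cons, pow_succ, mul_neg, mul_one,
      neg_smul]
    rw [← h1]
    abel

theorem alternating_move {T : Type*} [AddCommGroup T] (v : V) (c : List V) (b : List V) :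
    ∀ f : List V → T, IsAlternating f →
      f (b ++ v :: c) = (-1 : ℤ) ^ b.length • f (v :: (b ++ c)) := by
  induction b with
  | nil => intro f _; simp
  | cons x b ih =>
    intro f hf
    have h1 := ih (fun m => f (x :: m)) fun a b c v w => hf (x :: a) b c v w
    have h2 := hf [] [] (b ++ c) x v
    simp only [List.nil_append] at h2
    simp only [List.cons_append, List.length_cons, pow_succ, mul_neg, mul_one, neg_smul]
    rw [h1, h2, smul_neg]

theorem isAlternating_faceSum {T : Type*} [AddCommGroup T] {f : List V → T}
    (hf : IsAlternating f) : IsAlternating (faceSum f) := by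
  intro a
  induction a generalizing f with
  | nil =>
    intro b c v w
    have h1 := faceSum_exchange v w c b (fun m => f (v :: m)) (fun m => f (w :: m))
      fun b c => hf [] b c v w
    have h2 := alternating_move v c b f hf
    have h3 := alternating_move w c b f hf
    rw [eq_neg_iff_add_eq_zero]
    simp only [List.nil_append, faceSum_cons]
    rw [smul_add, ← h2, ← h3] at h1
    rw [sub_add_sub_comm, h1]
    abel
  | cons x a ih =>
    intro b c v w
    have h1 := ih (f := fun m => f (x :: m)) (fun a b c v w => hf (x :: a) b c v w) b c v w
    simp only [List.cons_append, faceSum_cons, h1, hf a b c v w]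
    abel

end Alternating

section Chains

variable {V : Type*} [DecidableEq V]

/-- The sequence `l` of vertices has no repetition and its underlying set belongs to `Φ`. -/
def IsChainSimplex (Φ : Set (Finset V)) (l : List V) : Prop :=
  l.Nodup ∧ l.toFinset ∈ Φ

/-- The relations between ordered sequences of vertices: a sequence that is not a chain simplex
is zero, and exchanging two entries changes the sign. -/
noncomputable def chainRel (Φ : Set (Finset V)) : Submodule ℤ (List V →₀ ℤ) :=
  Submodule.span ℤ
    ({x | ∃ l : List V, ¬ IsChainSimplex Φ l ∧ x = Finsupp.single l 1} ∪
      {x | ∃ (a b c : List V) (v w : V),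
        x = Finsupp.single (a ++ v :: (b ++ w :: c)) 1 +
          Finsupp.single (a ++ w :: (b ++ v :: c)) 1})

/-- The chain group: the free abelian group on ordered sequences of vertices, modulo `chainRel`.
All degrees are put together; the sequence `(v₀, …, vₖ)` has dimension `k`, and the empty sequence
has dimension `-1`. -/
abbrev Chain (Φ : Set (Finset V)) : Type _ := (List V →₀ ℤ) ⧸ chainRel Φ

/-- The class of an ordered sequence of vertices in the chain group. -/
noncomputable def chain (Φ : Set (Finset V)) (l : List V) : Chain Φ :=
  (chainRel Φ).mkQ (Finsupp.single l 1)

theorem chain_eq_zero {Φ : Set (Finset V)} {l : List V} (hl : ¬ IsChainSimplex Φ l) :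
    chain Φ l = 0 := by
  rw [chain, Submodule.mkQ_apply, Submodule.Quotient.mk_eq_zero]
  exact Submodule.subset_span (Or.inl ⟨l, hl, rfl⟩)

theorem isAlternating_chain (Φ : Set (Finset V)) : IsAlternating (chain Φ) := by
  intro a b c v w
  rw [eq_neg_iff_add_eq_zero, chain, chain, ← map_add, Submodule.mkQ_apply,
    Submodule.Quotient.mk_eq_zero]
  exact Submodule.subset_span (Or.inr ⟨a, b, c, v, w, rfl⟩)

theorem isChainSimplex_congr {Φ : Set (Finset V)} {l l' : List V} (h : l.Perm l') :
    IsChainSimplex Φ l ↔ IsChainSimplex Φ l' := by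
  rw [IsChainSimplex, IsChainSimplex, h.nodup_iff, List.toFinset_eq_of_perm _ _ h]

open Classical in
/-- The homomorphism out of the chain group which sends every chain simplex `l` to `f l`. -/
noncomputable def chainLift (Φ : Set (Finset V)) {T : Type*} [AddCommGroup T] (f : List V → T)
    (hf : IsAlternating f) : Chain Φ →ₗ[ℤ] T :=
  (chainRel Φ).liftQ
    (Finsupp.linearCombination ℤ fun l => if IsChainSimplex Φ l then f l else 0)
    (by
      refine Submodule.span_le.2 ?_
      rintro x (⟨l, hl, rfl⟩ | ⟨a, b, c, v, w, rfl⟩)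
      · simp [hl]
      · by_cases h : IsChainSimplex Φ (a ++ v :: (b ++ w :: c))
        · have h2 := (isChainSimplex_congr (swap_perm a b c v w)).1 h
          simp [h, h2, hf a b c v w]
        · have h2 := mt (isChainSimplex_congr (swap_perm a b c v w)).2 h
          simp [h, h2])

theorem chainLift_chain (Φ : Set (Finset V)) {T : Type*} [AddCommGroup T] (f : List V → T)
    (hf : IsAlternating f) {l : List V} (hl : IsChainSimplex Φ l) :
    chainLift Φ f hf (chain Φ l) = f l := by
  rw [chainLift, chain, Submodule.mkQ_apply]
  refine (Submodule.liftQ_apply _ _ _).trans ?_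
  simp [hl]

/-- The boundary `d (v₀, …, vₖ) = ∑ᵢ (-1)ⁱ (v₀, …, v̂ᵢ, …, vₖ)`. -/
noncomputable def boundary (Φ : Set (Finset V)) : Chain Φ →ₗ[ℤ] Chain Φ :=
  chainLift Φ (faceSum (chain Φ)) (isAlternating_faceSum (isAlternating_chain Φ))

/-- The coboundary `δ (v₀, …, vₖ) = ∑ᵥ (v, v₀, …, vₖ)`, on the same group as the boundary. -/
noncomputable def coboundary [Fintype V] (Φ : Set (Finset V)) : Chain Φ →ₗ[ℤ] Chain Φ :=
  chainLift Φ (fun l => ∑ v : V, chain Φ (v :: l)) (by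
    intro a b c v w
    rw [← Finset.sum_neg_distrib]
    exact Finset.sum_congr rfl fun u _ => isAlternating_chain Φ (u :: a) b c v w)

/-- The sign operator `σ ↦ (-1)^|σ| σ`, where `|σ|` is the number of vertices of `σ`. -/
noncomputable def signOp (Φ : Set (Finset V)) : Chain Φ →ₗ[ℤ] Chain Φ :=
  chainLift Φ (fun l => (-1 : ℤ) ^ l.length • chain Φ l) (by
    intro a b c v w
    dsimp only
    rw [isAlternating_chain Φ a b c v w, (swap_perm a b c v w).length_eq, smul_neg])

/-! ### The bicomplex and its spectral sequence -/

/-- The differential `Δ (σ ⊗ τ) = dσ ⊗ τ + (-1)^|σ| σ ⊗ δτ`. -/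
noncomputable def Delta [Fintype V] (Φ : Set (Finset V)) :
    Chain Φ ⊗[ℤ] Chain Φ →ₗ[ℤ] Chain Φ ⊗[ℤ] Chain Φ :=
  TensorProduct.map (boundary Φ) LinearMap.id + TensorProduct.map (signOp Φ) (coboundary Φ)

/-- The group `N^{p,q}`, generated by all `σ ⊗ τ` with `σ ⊆ τ`, `dim σ = p` and `dim τ = q`. -/
noncomputable def N (Φ : Set (Finset V)) (p q : ℤ) : Submodule ℤ (Chain Φ ⊗[ℤ] Chain Φ) :=
  Submodule.span ℤ {x | ∃ σ τ : List V, IsChainSimplex Φ σ ∧ IsChainSimplex Φ τ ∧ σ ⊆ τ ∧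
    (σ.length : ℤ) - 1 = p ∧ (τ.length : ℤ) - 1 = q ∧ x = chain Φ σ ⊗ₜ[ℤ] chain Φ τ}

/-- The filtration of the total complex `Tⁿ = ⨁_{q - p = n} N^{p,q}`: the part of degree `n` of
`F^p = ⨁_{i ≤ p} N^{i,*}`. -/
noncomputable def Fil (Φ : Set (Finset V)) (p n : ℤ) : Submodule ℤ (Chain Φ ⊗[ℤ] Chain Φ) :=
  ⨆ (i : ℤ) (_ : i ≤ p), N Φ i (i + n)

/-- `Z_r^p` in degree `n`: the elements `x` of `F^p Tⁿ` with `Δ x ∈ F^{p-r} Tⁿ⁺¹`. -/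
noncomputable def Zr [Fintype V] (Φ : Set (Finset V)) (r p n : ℤ) :
    Submodule ℤ (Chain Φ ⊗[ℤ] Chain Φ) :=
  Fil Φ p n ⊓ (Fil Φ (p - r) (n + 1)).comap (Delta Φ)

/-- The subgroup `Z_{r-1}^{p-1} + Δ Z_{r-1}^{p+r-1}` of `Z_r^p` in degree `n`. -/
noncomputable def Br [Fintype V] (Φ : Set (Finset V)) (r p n : ℤ) :
    Submodule ℤ (Chain Φ ⊗[ℤ] Chain Φ) :=
  Zr Φ (r - 1) (p - 1) n ⊔ (Zr Φ (r - 1) (p + r - 1) (n - 1)).map (Delta Φ)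

/-- The term `E_r^{p,q} = Z_r^p / (Z_{r-1}^{p-1} + Δ Z_{r-1}^{p+r-1})`, in total degree `q - p`, of
the spectral sequence of the filtered complex `(T^*, Δ, F^*)`. For `r = 1` it is
`H^{q-p}(F^p / F^{p-1})`. -/
abbrev E [Fintype V] (Φ : Set (Finset V)) (r p q : ℤ) : Type _ :=
  ↥(Zr Φ r p (q - p)) ⧸ (Br Φ r p (q - p)).submoduleOf (Zr Φ r p (q - p))

end Chains

section Complexes

variable {V W : Type*}

/-- All simplices of `K`, the empty simplex included. -/
def allSimplices (K : AbstractSimplicialComplex V) : Set (Finset V) :=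
  insert ∅ K.faces

/-- The term `Ẽ_r^{p,q}(K)` of the reduced cohomeology spectral sequence. -/
abbrev redE [Fintype V] [DecidableEq V] (K : AbstractSimplicialComplex V) (r p q : ℤ) : Type _ :=
  E (allSimplices K) r p q

/-- The cohomeology group of `K` in bidegree `(p, q)`. -/
abbrev H [Fintype V] [DecidableEq V] (K : AbstractSimplicialComplex V) (p q : ℤ) : Type _ :=
  E K.faces 2 p q

/-- The reduced cohomeology group of `K` in bidegree `(p, q)`. -/
abbrev redH [Fintype V] [DecidableEq V] (K : AbstractSimplicialComplex V) (p q : ℤ) : Type _ :=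
  redE K 2 p q

/-- The disjoint union of two simplicial complexes. -/
def disjointUnion (K : AbstractSimplicialComplex V) (L : AbstractSimplicialComplex W) :
    AbstractSimplicialComplex (V ⊕ W) where
  faces := {s | (∃ σ ∈ K.faces, s = σ.map Function.Embedding.inl) ∨
    ∃ τ ∈ L.faces, s = τ.map Function.Embedding.inr}
  isRelLowerSet_faces := by
    rintro s (⟨σ, hσ, rfl⟩ | ⟨τ, hτ, rfl⟩)
    · refine ⟨(K.isRelLowerSet_faces hσ).1.map, fun t hts ht => ?_⟩
      obtain ⟨u, hu, rfl⟩ := Finset.subset_map_iff.1 hts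
      exact Or.inl ⟨u, (K.isRelLowerSet_faces hσ).2 hu (Finset.map_nonempty.1 ht), rfl⟩
    · refine ⟨(L.isRelLowerSet_faces hτ).1.map, fun t hts ht => ?_⟩
      obtain ⟨u, hu, rfl⟩ := Finset.subset_map_iff.1 hts
      exact Or.inr ⟨u, (L.isRelLowerSet_faces hτ).2 hu (Finset.map_nonempty.1 ht), rfl⟩
  singleton_mem := by
    rintro (v | w)
    · exact Or.inl ⟨{v}, K.singleton_mem v, by simp⟩
    · exact Or.inr ⟨{w}, L.singleton_mem w, by simp⟩

theorem allSimplices_of_subset (K : AbstractSimplicialComplex V) {s t : Finset V}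
    (hs : s ∈ allSimplices K) (hts : t ⊆ s) : t ∈ allSimplices K := by
  rcases t.eq_empty_or_nonempty with rfl | ht
  · exact Set.mem_insert _ _
  · rcases hs with rfl | hs
    · exact absurd (Finset.subset_empty.1 hts) ht.ne_empty
    · exact Or.inr ((K.isRelLowerSet_faces hs).2 hts ht)

/-- The join `K * L`: its simplices are the unions `σ ⊔ τ` of a simplex `σ` of `K` and a simplex
`τ` of `L`, either of which may be empty. -/
def join (K : AbstractSimplicialComplex V) (L : AbstractSimplicialComplex W) :
    AbstractSimplicialComplex (V ⊕ W) where
  faces := {s | s.Nonempty ∧ ∃ σ ∈ allSimplices K, ∃ τ ∈ allSimplices L, s = σ.disjSum τ}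
  isRelLowerSet_faces := by
    rintro s ⟨hs, σ, hσ, τ, hτ, rfl⟩
    refine ⟨hs, fun t hts ht => ⟨ht, t.toLeft, ?_, t.toRight, ?_, Finset.toLeft_disjSum_toRight.symm⟩⟩
    · exact allSimplices_of_subset K hσ (by simpa using Finset.toLeft_monotone hts)
    · exact allSimplices_of_subset L hτ (by simpa using Finset.toRight_monotone hts)
  singleton_mem := by
    rintro (v | w)
    · exact ⟨Finset.singleton_nonempty _, {v}, Or.inr (K.singleton_mem v), ∅,
        Set.mem_insert _ _, by simp⟩
    · exact ⟨Finset.singleton_nonempty _, ∅, Set.mem_insert _ _, {w}, Or.inr (L.singleton_mem w),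
        by simp⟩

end Complexes

end Cohomeology

/-! Let N be the span of all σ ⊗ τ with σ ⊆ τ. On N the maps d (acting on σ) and δ (acting on τ)
commute. The page E₁ is the homology of δ, and E₂ is the homology of the map that d induces on E₁.

(a) A nonempty simplex of a disjoint union lies in exactly one of the two pieces, together with all
its nonempty faces and all its cofaces. The condition σ ⊆ τ therefore excludes mixed pairs, N splits
compatibly with Δ and the bidegrees, and every page splits with it
(`IsComponent.exists_equiv_prod`). The empty simplex would belong to both pieces.

(b) Once the empty simplex is admitted, concatenation identifies the chains of K * L with the tensor
product of the chains of K and of L, and both d and δ satisfy a Leibniz rule with sign (-1)^|σ|.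
Taking tensor squares and interchanging the middle factors gives N(K * L) ≅ N(K) ⊗ N(L)
(`exists_Ntot_join_equiv`). There d satisfies the Leibniz rule with sign (-1)^|σ| and δ with sign
(-1)^|τ|. Because the signs differ, the argument runs page by page rather than on Δ. The Künneth
formula `kunneth` for δ has no Tor term, since N is free and one E₁ is torsion-free; hence E₁(K * L)
≅ E₁(K) ⊗ E₁(L). It is then applied to the differential of E₁: the hypothesis on E₁ is used again,
now as flatness of one factor, and the hypothesis on E₂ removes Tor
(`Bicomplex.exists_equiv_of_tensor`). Numbers of vertices add and a dimension is one less than a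
number of vertices, which produces the shift by (1, 1).

The Künneth formula is proved for ungraded differential modules, with involutions in place of the
signs; bidegrees are recovered from projections (`IsGrading.exists_equiv_directSum`). The pages of
the filtered complex are matched with iterated homology by taking leading terms
(`Bicomplex.exists_equiv_π₁`, `Bicomplex.exists_equiv_π₂`). -/

namespace Cohomeology

/-! ### Homology of a differential module. -/

section Homology

variable {R : Type*} [CommRing R] {M X Y : Type*} [AddCommGroup M] [Module R M]
  [AddCommGroup X] [Module R X] [AddCommGroup Y] [Module R Y]

/-- The homology `ker d / im d` of an endomorphism `d` with `d ∘ d = 0`. -/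
abbrev Homology (d : M →ₗ[R] M) : Type _ :=
  ↥(LinearMap.ker d) ⧸ (LinearMap.range d).submoduleOf (LinearMap.ker d)

/-- The class of a cycle. -/
abbrev Homology.mk (d : M →ₗ[R] M) : ↥(LinearMap.ker d) →ₗ[R] Homology d :=
  ((LinearMap.range d).submoduleOf (LinearMap.ker d)).mkQ

theorem Homology.mk_surjective (d : M →ₗ[R] M) : Function.Surjective (Homology.mk d) :=
  Submodule.mkQ_surjective _

theorem Homology.mk_eq_zero {d : M →ₗ[R] M} {z : ↥(LinearMap.ker d)} :
    Homology.mk d z = 0 ↔ ∃ y, d y = z := by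
  rw [Submodule.mkQ_apply, Submodule.Quotient.mk_eq_zero]
  rfl

/-- The map induced on homology by a map which preserves cycles and boundaries. -/
def Homology.map {d : M →ₗ[R] M} {e : X →ₗ[R] X} (f : M →ₗ[R] X)
    (hk : ∀ x, d x = 0 → e (f x) = 0) (hr : ∀ x, ∃ y, e y = f (d x)) :
    Homology d →ₗ[R] Homology e :=
  Submodule.mapQ _ _ (f.restrict (p := LinearMap.ker d) (q := LinearMap.ker e)
    fun x hx => LinearMap.mem_ker.2 (hk x hx)) (by
      rintro ⟨x, hx⟩ ⟨y, rfl⟩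
      obtain ⟨z, hz⟩ := hr y
      exact ⟨z, hz⟩)

/-- An isomorphism of differential modules induces an isomorphism on homology. -/
theorem Homology.exists_equiv {d : M →ₗ[R] M} {e : X →ₗ[R] X} (f : M ≃ₗ[R] X)
    (h : ∀ x, f (d x) = e (f x)) :
    ∃ F : Homology d ≃ₗ[R] Homology e, ∀ (z : M) (hz : d z = 0) (hz' : e (f z) = 0),
      F (Homology.mk d ⟨z, hz⟩) = Homology.mk e ⟨f z, hz'⟩ := by
  have h' : ∀ x, f.symm (e x) = d (f.symm x) := fun x => by
    rw [LinearEquiv.symm_apply_eq, h, LinearEquiv.apply_symm_apply]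
  refine ⟨LinearEquiv.ofLinearMap
    (Homology.map (f : M →ₗ[R] X) (fun x hx => by simp [← h, hx]) fun x => ⟨f x, (h x).symm⟩)
    (Homology.map (f.symm : X →ₗ[R] M) (fun x hx => by simp [← h', hx])
      fun x => ⟨f.symm x, (h' x).symm⟩) ?_ ?_, fun z hz hz' => rfl⟩
  · ext z
    simp [Homology.map]
    congr 1
    ext
    simp
  · ext z
    simp [Homology.map]
    congr 1
    ext
    simp

/-- Both targets are the quotient of the source by one and the same kernel. In the Künneth formula
the source is ker d ⊗ ker e, which maps onto both sides. -/
theorem exists_equiv_of_ker_eq {f : M →ₗ[R] X} {g : M →ₗ[R] Y} (hf : Function.Surjective f)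
    (hg : Function.Surjective g) (h : ∀ x, f x = 0 ↔ g x = 0) :
    ∃ F : X ≃ₗ[R] Y, ∀ x, F (f x) = g x := by
  have hk : LinearMap.ker f = LinearMap.ker g := by
    ext x
    simp [h]
  refine ⟨(f.quotKerEquivOfSurjective hf).symm ≪≫ₗ Submodule.quotEquivOfEq _ _ hk ≪≫ₗ
    g.quotKerEquivOfSurjective hg, fun x => ?_⟩
  have : (f.quotKerEquivOfSurjective hf).symm (f x) = Submodule.Quotient.mk x := by
    rw [LinearEquiv.symm_apply_eq]
    rfl
  simp only [LinearEquiv.trans_apply, this]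
  rfl

end Homology

/-! ### The Künneth formula for a split differential. -/

section Kunneth

variable {R : Type*} [CommRing R] {M X : Type*} [AddCommGroup M] [Module R M]
  [AddCommGroup X] [Module R X]

theorem tensor_map_map {A B C A' B' C' : Type*} [AddCommGroup A] [AddCommGroup B] [AddCommGroup C]
    [AddCommGroup A'] [AddCommGroup B'] [AddCommGroup C'] [Module R A] [Module R B] [Module R C]
    [Module R A'] [Module R B'] [Module R C'] (f : B →ₗ[R] C) (f' : B' →ₗ[R] C') (g : A →ₗ[R] B)
    (g' : A' →ₗ[R] B') (t : A ⊗[R] A') :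
    TensorProduct.map f f' (TensorProduct.map g g' t) =
      TensorProduct.map (f ∘ₗ g) (f' ∘ₗ g') t := by
  rw [TensorProduct.map_comp, LinearMap.comp_apply]

theorem exact_ker_subtype (f : M →ₗ[R] X) : Function.Exact (LinearMap.ker f).subtype f := by
  rw [LinearMap.exact_iff, Submodule.range_subtype]

/-- The Künneth formula for the total differential `d ⊗ ε' + ε ⊗ ∂`. -/
theorem kunneth_of_section {d ε : M →ₗ[R] M} {e ε' : X →ₗ[R] X} {a b : R}
    (hd : ∀ m, d (d m) = 0) (he : ∀ x, e (e x) = 0)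
    (hε : ∀ m, ε (ε m) = m) (hε' : ∀ x, ε' (ε' x) = x)
    (hdε : ∀ m, d (ε m) = a • ε (d m)) (heε : ∀ x, e (ε' x) = b • ε' (e x))
    (hD : ∀ t, (TensorProduct.map d ε' + TensorProduct.map ε e)
      ((TensorProduct.map d ε' + TensorProduct.map ε e) t) = 0)
    (s : ↥(LinearMap.range d) →ₗ[R] M) (hs : ∀ y, d (s y) = y)
    [Module.Flat R ↥(LinearMap.ker d)] [Module.Flat R ↥(LinearMap.range d)]
    (hinj : ∀ i : ↥(LinearMap.range d) →ₗ[R] ↥(LinearMap.ker d), (∀ y, (i y : M) = y) →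
      Function.Injective (TensorProduct.map i (LinearMap.id : Homology e →ₗ[R] Homology e))) :
    ∃ F : Homology d ⊗[R] Homology e ≃ₗ[R]
        Homology (TensorProduct.map d ε' + TensorProduct.map ε e),
      ∀ (z : M) (x : X) (hz : d z = 0) (hx : e x = 0)
        (h : (TensorProduct.map d ε' + TensorProduct.map ε e) (z ⊗ₜ x) = 0),
        F (Homology.mk d ⟨z, hz⟩ ⊗ₜ Homology.mk e ⟨x, hx⟩) = Homology.mk _ ⟨z ⊗ₜ x, h⟩ := by
  set D : M ⊗[R] X →ₗ[R] M ⊗[R] X := TensorProduct.map d ε' + TensorProduct.map ε e with hDdef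
  let iZ := (LinearMap.ker d).subtype
  let iX := (LinearMap.ker e).subtype
  let p := d.rangeRestrict
  let pX := e.rangeRestrict
  let iB : ↥(LinearMap.range d) →ₗ[R] ↥(LinearMap.ker d) :=
    Submodule.inclusion (by rintro _ ⟨y, rfl⟩; exact hd y)
  let kX : ↥(LinearMap.range e) →ₗ[R] ↥(LinearMap.ker e) :=
    Submodule.inclusion (by rintro _ ⟨y, rfl⟩; exact he y)
  let qM := Homology.mk d
  let qX := Homology.mk e
  -- Moving d past ε twice and using ε² = 1 shows that a² acts as 1 on the image of d, although a is
  -- not assumed to be a unit.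
  have haa : ∀ m, (a * a) • d m = d m := fun m => by
    conv_rhs => rw [← hε m, hdε, hdε, map_smul, hε, smul_smul]
  have hεd : ∀ m, ε (d m) = a • d (ε m) := fun m => by
    rw [hdε, smul_smul, ← map_smul, haa]
  have hbb : ∀ m, (b * b) • e m = e m := fun m => by
    conv_rhs => rw [← hε' m, heε, heε, map_smul, hε', smul_smul]
  have hεe : ∀ m, ε' (e m) = b • e (ε' m) := fun m => by
    rw [heε, smul_smul, ← map_smul, hbb]
  let εZ : ↥(LinearMap.ker d) →ₗ[R] ↥(LinearMap.ker d) :=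
    ε.restrict fun x hx => by
      rw [LinearMap.mem_ker] at hx ⊢; rw [hdε, hx]; simp
  -- The factor a is what makes `p ∘ ε = εB ∘ p` hold; by `haa` this map is still an involution.
  let εB : ↥(LinearMap.range d) →ₗ[R] ↥(LinearMap.range d) :=
    a • ε.restrict (by
      rintro _ ⟨y, rfl⟩
      exact ⟨a • ε y, by rw [map_smul, hεd]⟩)
  let εX : ↥(LinearMap.ker e) →ₗ[R] ↥(LinearMap.ker e) :=
    ε'.restrict fun x hx => by
      rw [LinearMap.mem_ker] at hx ⊢; rw [heε, hx]; simp
  let εY : ↥(LinearMap.range e) →ₗ[R] ↥(LinearMap.range e) :=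
    ε'.restrict (by
      rintro _ ⟨y, rfl⟩
      exact ⟨b • ε' y, by rw [map_smul, hεe]⟩)
  let r : M →ₗ[R] ↥(LinearMap.ker d) :=
    (LinearMap.id - s ∘ₗ p).codRestrict _ fun m => by
      rw [LinearMap.mem_ker]
      simp [p, hs]
  have cεB : εB ∘ₗ εB = LinearMap.id := by
    ext ⟨_, y, rfl⟩
    simp [εB, hε, smul_smul, haa]
  have crZ : r ∘ₗ iZ = LinearMap.id := by
    ext ⟨z, hz⟩
    have : p z = 0 := Subtype.ext hz
    simp [r, iZ, this]
  have cps : p ∘ₗ s = LinearMap.id := by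
    ext y
    simp [p, hs]
  have csplit : iZ ∘ₗ r + s ∘ₗ p = LinearMap.id := by
    ext m
    simp [r, iZ]
  have cpZ : p ∘ₗ iZ = 0 := by
    ext ⟨z, hz⟩
    exact hz
  have cpd : p ∘ₗ d = 0 := by
    ext z
    exact hd z
  have cpε : p ∘ₗ ε = εB ∘ₗ p := by
    ext m
    simp [p, εB, hdε]
  have cd : d = iZ ∘ₗ iB ∘ₗ p := by
    ext m
    rfl
  have ce : e = iX ∘ₗ kX ∘ₗ pX := by
    ext m
    rfl
  have cεZ : ε ∘ₗ iZ = iZ ∘ₗ εZ := by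
    ext m
    rfl
  have cεX : ε' ∘ₗ iX = iX ∘ₗ εX := by
    ext m
    rfl
  have cεk : εX ∘ₗ kX = kX ∘ₗ εY := by
    ext m
    rfl
  have cεX2 : εX ∘ₗ εX = LinearMap.id := by
    ext m
    exact hε' m
  have cεZ2 : εZ ∘ₗ εZ = LinearMap.id := by
    ext m
    exact hε m
  have cqk : qX ∘ₗ kX = 0 := by
    ext ⟨_, y, rfl⟩
    exact Homology.mk_eq_zero.2 ⟨y, rfl⟩
  have cqB : qM ∘ₗ iB = 0 := by
    ext ⟨_, y, rfl⟩
    exact Homology.mk_eq_zero.2 ⟨y, rfl⟩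
  have exX : Function.Exact kX qX := by
    intro z
    rw [Homology.mk_eq_zero]
    constructor
    · rintro ⟨y, hy⟩
      exact ⟨⟨e y, y, rfl⟩, Subtype.ext hy⟩
    · rintro ⟨⟨_, y, rfl⟩, rfl⟩
      exact ⟨y, rfl⟩
  have exM : Function.Exact iB qM := by
    intro z
    rw [Homology.mk_eq_zero]
    constructor
    · rintro ⟨y, hy⟩
      exact ⟨⟨d y, y, rfl⟩, Subtype.ext hy⟩
    · rintro ⟨⟨_, y, rfl⟩, rfl⟩
      exact ⟨y, rfl⟩
  have tz : ∀ t : M ⊗[R] X, D t = TensorProduct.map d ε' t + TensorProduct.map ε e t :=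
    fun t => rfl
  -- Since d² = 0, the map p ⊗ 1 sees only the term ε ⊗ e of D, so the hypothesis says that 1 ⊗ e
  -- kills (p ⊗ 1) w. Flatness of range d then puts (p ⊗ 1) w in range d ⊗ ker e. The formula for D
  -- w comes from splitting w along M = ker d ⊕ s(range d).
  have hkey : ∀ w, TensorProduct.map p (LinearMap.id : X →ₗ[R] X) (D w) = 0 →
      ∃ t : ↥(LinearMap.range d) ⊗[R] ↥(LinearMap.ker e),
        TensorProduct.map p LinearMap.id w = TensorProduct.map LinearMap.id iX t ∧
        D w = TensorProduct.map iZ iX (TensorProduct.map iB εX t +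
          TensorProduct.map (εZ ∘ₗ r) (kX ∘ₗ pX) w) := by
    intro w hw
    have h1 : TensorProduct.map LinearMap.id e (TensorProduct.map p LinearMap.id w) = 0 := by
      have h2 : TensorProduct.map εB (LinearMap.id : X →ₗ[R] X)
          (TensorProduct.map LinearMap.id e (TensorProduct.map p LinearMap.id w)) = 0 := by
        rw [← hw, tz, map_add, tensor_map_map, tensor_map_map, tensor_map_map, tensor_map_map, cpd, cpε, TensorProduct.map_zero_left]
        simp
      have h3 := congrArg (TensorProduct.map εB (LinearMap.id : X →ₗ[R] X)) h2
      rwa [tensor_map_map, LinearMap.id_comp, cεB, TensorProduct.map_id, map_zero] at h3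
    obtain ⟨t, ht⟩ := (Module.Flat.lTensor_exact _ (exact_ker_subtype e) _).1 h1
    have ht : TensorProduct.map LinearMap.id iX t = TensorProduct.map p LinearMap.id w := ht
    refine ⟨t, ht.symm, ?_⟩
    rw [tz, map_add]
    congr 1
    · rw [tensor_map_map, ← cεX, ← LinearMap.comp_id (iZ ∘ₗ iB), ← tensor_map_map, ht, tensor_map_map]
      rfl
    · rw [tensor_map_map, ← LinearMap.comp_assoc, ← cεZ, ← ce]
      conv_lhs => rw [← LinearMap.comp_id ε, ← csplit, LinearMap.comp_add,
        TensorProduct.map_add_left, LinearMap.add_apply]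
      rw [LinearMap.comp_assoc, add_eq_left, ← LinearMap.comp_assoc]
      rw [tensor_map_map, LinearMap.id_comp, LinearMap.comp_id] at h1
      rw [← LinearMap.id_comp e, ← tensor_map_map, h1, map_zero]
  -- The retraction r removes `iZ`; flatness of ker d takes care of `iX`.
  have hinjZX : Function.Injective (TensorProduct.map iZ iX) := by
    intro t u htu
    have h1 := congrArg (TensorProduct.map r (LinearMap.id : X →ₗ[R] X)) htu
    rw [tensor_map_map, tensor_map_map, crZ, LinearMap.id_comp] at h1
    exact Module.Flat.lTensor_preserves_injective_linearMap iX
      (Submodule.injective_subtype _) h1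
  have hDZ : ∀ t, D (TensorProduct.map iZ iX t) = 0 := by
    intro t
    rw [tz, tensor_map_map, tensor_map_map]
    have h1 : d ∘ₗ iZ = 0 := by
      ext z
      exact z.2
    have h2 : e ∘ₗ iX = 0 := by
      ext z
      exact z.2
    simp [h1, h2]
  let ι : ↥(LinearMap.ker d) ⊗[R] ↥(LinearMap.ker e) →ₗ[R] ↥(LinearMap.ker D) :=
    (TensorProduct.map iZ iX).codRestrict _ fun t => hDZ t
  have hf : Function.Surjective (TensorProduct.map qM qX) :=
    TensorProduct.map_surjective (Homology.mk_surjective d) (Homology.mk_surjective e)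
  have hpZ : ∀ t, TensorProduct.map p (LinearMap.id : X →ₗ[R] X)
      (TensorProduct.map iZ iX t) = 0 := by
    intro t
    rw [tensor_map_map, cpZ]
    simp
  -- Every cycle w is homologous to one in ker d ⊗ ker e: first (p ⊗ 1) w is shown to be of the form
  -- (1 ⊗ e) c, then a boundary D v with the same image under p ⊗ 1 is subtracted, which leaves a
  -- cycle in ker d ⊗ X.
  have hg : Function.Surjective (Homology.mk D ∘ₗ ι) := by
    intro h
    obtain ⟨⟨w, hw⟩, rfl⟩ := Homology.mk_surjective D h
    rw [LinearMap.mem_ker] at hw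
    obtain ⟨t, ht, htD⟩ := hkey w (by rw [hw, map_zero])
    rw [hw, eq_comm] at htD
    have h1 := hinjZX (htD.trans (map_zero _).symm)
    have h2 : TensorProduct.map iB (LinearMap.id : Homology e →ₗ[R] Homology e)
        (TensorProduct.map LinearMap.id (qX ∘ₗ εX) t) = 0 := by
      have h3 := congrArg (TensorProduct.map (LinearMap.id : ↥(LinearMap.ker d) →ₗ[R] _) qX) h1
      rw [map_add, tensor_map_map, tensor_map_map, ← LinearMap.comp_assoc pX kX qX, cqk, LinearMap.zero_comp,
        TensorProduct.map_zero_right, LinearMap.zero_apply, add_zero, map_zero] at h3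
      rw [tensor_map_map]
      exact h3
    -- The only use of the injectivity of range d ⊗ H(e) → ker d ⊗ H(e), that is, of the vanishing
    -- of Tor(H(d), H(e)).
    have h3 := hinj iB (fun _ => rfl) (h2.trans (map_zero _).symm)
    have h4 : LinearMap.lTensor ↥(LinearMap.range d) qX (TensorProduct.map LinearMap.id εX t) = 0 := by
      rw [LinearMap.lTensor, tensor_map_map]
      exact h3
    obtain ⟨c₀, hc₀⟩ := (lTensor_exact _ exX (Homology.mk_surjective e) _).1 h4
    have hc₀ : TensorProduct.map LinearMap.id kX c₀ = TensorProduct.map LinearMap.id εX t := hc₀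
    obtain ⟨c, hc⟩ := LinearMap.lTensor_surjective ↥(LinearMap.range d)
      e.surjective_rangeRestrict (TensorProduct.map LinearMap.id εY c₀)
    have hc : TensorProduct.map LinearMap.id pX c = TensorProduct.map LinearMap.id εY c₀ := hc
    have hce : TensorProduct.map LinearMap.id e c = TensorProduct.map p LinearMap.id w := by
      have h5 : TensorProduct.map LinearMap.id (LinearMap.id ∘ₗ kX)
          (TensorProduct.map LinearMap.id εY c₀) = t := by
        rw [tensor_map_map, LinearMap.id_comp kX, ← cεk, ← tensor_map_map, hc₀, tensor_map_map, cεX2]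
        simp
      rw [ht, ← h5, ← hc, tensor_map_map, tensor_map_map]
      rfl
    -- Here s lifts back to M and `εB` cancels the ε in D, so that (p ⊗ 1)(D v) = (1 ⊗ e) c = (p ⊗
    -- 1) w.
    set v := TensorProduct.map (s ∘ₗ εB) (LinearMap.id : X →ₗ[R] X) c with hv
    have hw' : TensorProduct.map p (LinearMap.id : X →ₗ[R] X) (w - D v) = 0 := by
      rw [map_sub, tz, map_add, hv, tensor_map_map, tensor_map_map, tensor_map_map, tensor_map_map, cpd, cpε,
        LinearMap.comp_assoc _ p εB, ← LinearMap.comp_assoc εB s p, cps,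
        LinearMap.id_comp εB, cεB]
      simp [← hce]
    have hDw' : D (w - D v) = 0 := by
      rw [map_sub, hw, hD, sub_zero]
    have hw2 : w - D v = TensorProduct.map iZ LinearMap.id
        (TensorProduct.map r (LinearMap.id : X →ₗ[R] X) (w - D v)) := by
      have h5 : TensorProduct.map (iZ ∘ₗ r + s ∘ₗ p) (LinearMap.id : X →ₗ[R] X) (w - D v) =
          w - D v := by
        rw [csplit]
        simp
      conv_lhs => rw [← h5, TensorProduct.map_add_left, LinearMap.add_apply]
      rw [tensor_map_map, LinearMap.comp_id, add_eq_left, ← LinearMap.comp_id LinearMap.id, ← tensor_map_map, hw',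
        map_zero]
    set u := TensorProduct.map r (LinearMap.id : X →ₗ[R] X) (w - D v) with hu
    have hu2 : LinearMap.lTensor ↥(LinearMap.ker d) e u = 0 := by
      have h5 : TensorProduct.map (ε ∘ₗ iZ) e u = 0 := by
        have h1 : d ∘ₗ iZ = 0 := by
          ext z
          exact z.2
        have h7 := hDw'
        rw [hw2, tz, tensor_map_map _ _ _ _ u, tensor_map_map _ _ _ _ u, h1] at h7
        simpa using h7
      have h6 := congrArg (TensorProduct.map (εZ ∘ₗ r) (LinearMap.id : X →ₗ[R] X)) h5
      rw [tensor_map_map, cεZ, LinearMap.comp_assoc, ← LinearMap.comp_assoc εZ, crZ, LinearMap.id_comp,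
        cεZ2, map_zero] at h6
      exact h6
    obtain ⟨y, hy⟩ := (Module.Flat.lTensor_exact _ (exact_ker_subtype e) _).1 hu2
    have hy : TensorProduct.map LinearMap.id iX y = u := hy
    refine ⟨y, ?_⟩
    rw [← sub_eq_zero, LinearMap.comp_apply, ← map_sub, Homology.mk_eq_zero]
    refine ⟨-v, ?_⟩
    have h7 : TensorProduct.map iZ iX y = w - D v := by
      rw [hw2, ← hy, tensor_map_map]
      rfl
    change D (-v) = TensorProduct.map iZ iX y - w
    rw [h7, map_neg]
    abel
  obtain ⟨F, hF⟩ := exists_equiv_of_ker_eq hf hg (by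
    intro t
    rw [LinearMap.comp_apply, Homology.mk_eq_zero]
    constructor
    · intro ht
      have h1 : t ∈ LinearMap.ker (TensorProduct.map qM qX) := ht
      rw [TensorProduct.map_ker exM (Homology.mk_surjective d) exX (Homology.mk_surjective e)] at h1
      obtain ⟨_, ⟨t₁, rfl⟩, _, ⟨t₂, rfl⟩, rfl⟩ := Submodule.mem_sup.1 h1
      obtain ⟨u₁, rfl⟩ := LinearMap.lTensor_surjective ↥(LinearMap.ker d)
        e.surjective_rangeRestrict t₁
      obtain ⟨u₂, rfl⟩ := LinearMap.rTensor_surjective ↥(LinearMap.ker e)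
        d.surjective_rangeRestrict t₂
      -- The involutions cancel those in D: for cycles z and x, D (ε z ⊗ x) = z ⊗ e x and D (m ⊗ ε'
      -- x) = d m ⊗ x.
      refine ⟨TensorProduct.map (ε ∘ₗ iZ) LinearMap.id u₁ +
        TensorProduct.map LinearMap.id (ε' ∘ₗ iX) u₂, ?_⟩
      have h1 : d ∘ₗ ε ∘ₗ iZ = 0 := by
        ext z
        have : d z = 0 := z.2
        simp [iZ, hdε, this]
      have h2 : e ∘ₗ ε' ∘ₗ iX = 0 := by
        ext z
        have : e z = 0 := z.2
        simp [iX, heε, this]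
      have h3 : ε ∘ₗ ε ∘ₗ iZ = iZ := by
        ext z
        exact hε z
      have h4 : ε' ∘ₗ ε' ∘ₗ iX = iX := by
        ext z
        exact hε' z
      change D _ = TensorProduct.map iZ iX (TensorProduct.map LinearMap.id kX
        (TensorProduct.map LinearMap.id pX u₁) + TensorProduct.map iB LinearMap.id
        (TensorProduct.map p LinearMap.id u₂))
      simp only [map_add, tz, tensor_map_map, h1, h2, h3, h4, TensorProduct.map_zero_left,
        TensorProduct.map_zero_right, LinearMap.zero_apply, add_zero, zero_add,
        LinearMap.comp_id]
      rw [← cd, ← ce, add_comm]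
    · rintro ⟨w, hw⟩
      have hw : D w = TensorProduct.map iZ iX t := hw
      obtain ⟨t', -, ht'⟩ := hkey w (by rw [hw, hpZ])
      rw [hw] at ht'
      rw [hinjZX ht', map_add, tensor_map_map, tensor_map_map, cqB, ← LinearMap.comp_assoc pX kX qX, cqk]
      simp)
  exact ⟨F, fun z x hz hx h => hF (⟨z, hz⟩ ⊗ₜ ⟨x, hx⟩)⟩

end Kunneth

/-! ### The Künneth formula over a principal ideal domain. -/

section KunnethPID

variable {R : Type*} [CommRing R] [IsDomain R] [IsPrincipalIdealRing R] {M X : Type*}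
  [AddCommGroup M] [Module R M] [AddCommGroup X] [Module R X] [Module.Finite R M]

/-- A finitely generated torsion-free M is free, and so are ker d and range d; hence d splits.
Injectivity after tensoring with H(e) has two possible causes: if H(d) is torsion-free it is
projective and the boundaries are a direct summand of ker d; if H(e) is torsion-free it is flat. -/
theorem kunneth_of_isTorsionFree_left {d ε : M →ₗ[R] M} {e ε' : X →ₗ[R] X} {a b : R}
    (hd : ∀ m, d (d m) = 0) (he : ∀ x, e (e x) = 0)
    (hε : ∀ m, ε (ε m) = m) (hε' : ∀ x, ε' (ε' x) = x)
    (hdε : ∀ m, d (ε m) = a • ε (d m)) (heε : ∀ x, e (ε' x) = b • ε' (e x))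
    (hD : ∀ t, (TensorProduct.map d ε' + TensorProduct.map ε e)
      ((TensorProduct.map d ε' + TensorProduct.map ε e) t) = 0)
    (hM : Module.IsTorsionFree R M)
    (hH : Module.IsTorsionFree R (Homology d) ∨ Module.IsTorsionFree R (Homology e)) :
    ∃ F : Homology d ⊗[R] Homology e ≃ₗ[R]
        Homology (TensorProduct.map d ε' + TensorProduct.map ε e),
      ∀ (z : M) (x : X) (hz : d z = 0) (hx : e x = 0)
        (h : (TensorProduct.map d ε' + TensorProduct.map ε e) (z ⊗ₜ x) = 0),
        F (Homology.mk d ⟨z, hz⟩ ⊗ₜ Homology.mk e ⟨x, hx⟩) = Homology.mk _ ⟨z ⊗ₜ x, h⟩ := by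
  obtain ⟨s, hs⟩ := Module.projective_lifting_property d.rangeRestrict
    (LinearMap.id : ↥(LinearMap.range d) →ₗ[R] _) d.surjective_rangeRestrict
  refine kunneth_of_section hd he hε hε' hdε heε hD s
    (fun y => congrArg Subtype.val (LinearMap.congr_fun hs y)) fun i hi => ?_
  have hii : Function.Injective i := fun x y hxy => Subtype.ext (by rw [← hi, hxy, hi])
  rcases hH with hH | hH
  · obtain ⟨t, ht⟩ := Module.projective_lifting_property (Homology.mk d)
      (LinearMap.id : Homology d →ₗ[R] _) (Homology.mk_surjective d)
    have hmem : ∀ z, (z - t (Homology.mk d z) : ↥(LinearMap.ker d)) ∈ LinearMap.range i := by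
      intro z
      have h1 : Homology.mk d (z - t (Homology.mk d z)) = 0 := by
        rw [map_sub, sub_eq_zero]
        exact (LinearMap.congr_fun ht _).symm
      obtain ⟨y, hy⟩ := Homology.mk_eq_zero.1 h1
      exact ⟨⟨d y, y, rfl⟩, Subtype.ext (by rw [hi, ← hy])⟩
    -- With t a section of ker d → H(d), the map z ↦ z - t[z] retracts ker d onto the boundaries.
    let ρ : ↥(LinearMap.ker d) →ₗ[R] ↥(LinearMap.range d) :=
      (LinearEquiv.ofInjective i hii).symm.toLinearMap ∘ₗ
        (LinearMap.id - t ∘ₗ Homology.mk d).codRestrict (LinearMap.range i) hmem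
    have hρ : ρ ∘ₗ i = LinearMap.id := by
      ext1 y
      have h1 : Homology.mk d (i y) = 0 := by
        obtain ⟨_, y, rfl⟩ := y
        exact Homology.mk_eq_zero.2 ⟨y, (hi ⟨d y, y, rfl⟩).symm⟩
      refine (LinearEquiv.symm_apply_eq (LinearEquiv.ofInjective i hii)).2 (Subtype.ext ?_)
      change i y - t (Homology.mk d (i y)) = i y
      rw [h1, map_zero, sub_zero]
    intro x y hxy
    have h1 := congrArg (TensorProduct.map ρ (LinearMap.id : Homology e →ₗ[R] _)) hxy
    rw [tensor_map_map, tensor_map_map, hρ] at h1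
    simpa using h1
  · exact Module.Flat.rTensor_preserves_injective_linearMap i hii

/-- The Künneth formula for finitely generated differential modules over a principal ideal
domain. -/
theorem kunneth [Module.Finite R X] {d ε : M →ₗ[R] M} {e ε' : X →ₗ[R] X} {a b : R}
    (hd : ∀ m, d (d m) = 0) (he : ∀ x, e (e x) = 0)
    (hε : ∀ m, ε (ε m) = m) (hε' : ∀ x, ε' (ε' x) = x)
    (hdε : ∀ m, d (ε m) = a • ε (d m)) (heε : ∀ x, e (ε' x) = b • ε' (e x))
    (hD : ∀ t, (TensorProduct.map d ε' + TensorProduct.map ε e)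
      ((TensorProduct.map d ε' + TensorProduct.map ε e) t) = 0)
    (hMX : Module.IsTorsionFree R M ∨ Module.IsTorsionFree R X)
    (hH : Module.IsTorsionFree R (Homology d) ∨ Module.IsTorsionFree R (Homology e)) :
    ∃ F : Homology d ⊗[R] Homology e ≃ₗ[R]
        Homology (TensorProduct.map d ε' + TensorProduct.map ε e),
      ∀ (z : M) (x : X) (hz : d z = 0) (hx : e x = 0)
        (h : (TensorProduct.map d ε' + TensorProduct.map ε e) (z ⊗ₜ x) = 0),
        F (Homology.mk d ⟨z, hz⟩ ⊗ₜ Homology.mk e ⟨x, hx⟩) = Homology.mk _ ⟨z ⊗ₜ x, h⟩ := by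
  rcases hMX with hM | hX
  · exact kunneth_of_isTorsionFree_left hd he hε hε' hdε heε hD hM hH
  -- Each factor carries its own involution and its own scalar precisely so that the situation is
  -- symmetric under exchanging the factors.
  · have hswap : ∀ t, TensorProduct.comm R X M
        ((TensorProduct.map e ε + TensorProduct.map ε' d) t) =
        (TensorProduct.map d ε' + TensorProduct.map ε e) (TensorProduct.comm R X M t) := by
      intro t
      induction t with
      | zero => simp
      | tmul x m => simp [add_comm]
      | add t u ht hu => rw [map_add, map_add, map_add, map_add, ht, hu]
    obtain ⟨F, hF⟩ := kunneth_of_isTorsionFree_left he hd hε' hε heε hdε (fun t => by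
      apply (TensorProduct.comm R X M).injective
      rw [hswap, hswap, hD, map_zero]) hX hH.symm
    obtain ⟨G, hG⟩ := Homology.exists_equiv (TensorProduct.comm R X M) hswap
    refine ⟨TensorProduct.comm R _ _ ≪≫ₗ F ≪≫ₗ G, fun z x hz hx h => ?_⟩
    have h0 : (TensorProduct.map e ε + TensorProduct.map ε' d) (x ⊗ₜ z) = 0 := by
      simp [hz, hx]
    simp only [LinearEquiv.trans_apply, TensorProduct.comm_tmul]
    rw [hF x z hx hz h0, hG _ h0 h]
    rfl

end KunnethPID

/-! ### Gradings given by projections. -/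

section Gradings

variable {ι R : Type*} [CommRing R] {M : Type*}
  [AddCommGroup M] [Module R M]

/-- A finite grading of a module, given by its projections. -/
structure IsGrading (π : ι → M →ₗ[R] M) : Prop where
  proj : ∀ g m, π g (π g m) = π g m
  orth : ∀ g h m, g ≠ h → π g (π h m) = 0
  sum : ∃ T : Finset ι, ∀ m, ∑ g ∈ T, π g m = m

theorem IsGrading.eq_zero {π : ι → M →ₗ[R] M} (hπ : IsGrading π) {m : M} (h : ∀ g, π g m = 0) :
    m = 0 := by
  obtain ⟨T, hT⟩ := hπ.sum
  rw [← hT m]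
  exact Finset.sum_eq_zero fun g _ => h g

/-- Equality can be tested on components. The hypotheses of the main theorem concern single
bidegrees, while the Künneth formula needs a whole page. -/
theorem IsGrading.isTorsionFree {π : ι → M →ₗ[R] M} (hπ : IsGrading π)
    (h : ∀ g, Module.IsTorsionFree R ↥(LinearMap.range (π g))) : Module.IsTorsionFree R M := by
  refine ⟨fun r hr m n hmn => ?_⟩
  rw [← sub_eq_zero]
  refine hπ.eq_zero fun g => ?_
  have h1 : (π g).rangeRestrict m = (π g).rangeRestrict n := by
    apply (h g).isSMulRegular hr
    dsimp only at hmn ⊢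
    rw [← map_smul, ← map_smul, hmn]
  rw [map_sub, sub_eq_zero]
  exact congrArg Subtype.val h1

/-- Projections which shift along `d` descend to the homology of `d`. -/
def Homology.proj [AddCommGroup ι] {π : ι → M →ₗ[R] M} {d : M →ₗ[R] M} {s : ι}
    (hd : ∀ g m, d (π g m) = π (g + s) (d m)) (g : ι) : Homology d →ₗ[R] Homology d :=
  Homology.map (π g) (fun x hx => by rw [hd, hx, map_zero])
    fun x => ⟨π (g - s) x, by rw [hd, sub_add_cancel]⟩

theorem Homology.proj_mk [AddCommGroup ι] {π : ι → M →ₗ[R] M} {d : M →ₗ[R] M} {s : ι}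
    (hd : ∀ g m, d (π g m) = π (g + s) (d m)) (g : ι) (z : ↥(LinearMap.ker d))
    (h : d (π g z) = 0) :
    Homology.proj hd g (Homology.mk d z) = Homology.mk d ⟨π g z, h⟩ :=
  rfl

theorem IsGrading.homology [AddCommGroup ι] {π : ι → M →ₗ[R] M} (hπ : IsGrading π) {d : M →ₗ[R] M} {s : ι}
    (hd : ∀ g m, d (π g m) = π (g + s) (d m)) : IsGrading (Homology.proj hd) where
  proj g m := by
    obtain ⟨z, rfl⟩ := Homology.mk_surjective d m
    exact congrArg (Homology.mk d) (Subtype.ext (hπ.proj g z))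
  orth g h m hgh := by
    obtain ⟨z, rfl⟩ := Homology.mk_surjective d m
    refine Eq.trans (congrArg (Homology.mk d) (Subtype.ext ?_)) (map_zero (Homology.mk d))
    exact hπ.orth g h z hgh
  sum := by
    obtain ⟨T, hT⟩ := hπ.sum
    refine ⟨T, fun m => ?_⟩
    obtain ⟨z, rfl⟩ := Homology.mk_surjective d m
    have h1 : ∀ g, Homology.proj hd g (Homology.mk d z) =
        Homology.mk d ⟨π g z, by rw [LinearMap.mem_ker, hd, z.2, map_zero]⟩ := fun g => rfl
    simp only [h1, ← map_sum]
    refine congrArg (Homology.mk d) (Subtype.ext ?_)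
    rw [AddSubmonoidClass.coe_finsetSum]
    exact hT z

/-- A multiplicative isomorphism `A ⊗ B ≃ C` of graded modules, of degree `s`, describes the
homogeneous components of `C`. -/
theorem IsGrading.exists_equiv_directSum [AddCommGroup ι] [DecidableEq ι] {A B C : Type*} [AddCommGroup A] [Module R A]
    [AddCommGroup B] [Module R B] [AddCommGroup C] [Module R C] {α : ι → A →ₗ[R] A}
    {β : ι → B →ₗ[R] B} {γ : ι → C →ₗ[R] C} (hα : IsGrading α) (hβ : IsGrading β)
    (hγ : IsGrading γ) (s : ι) (F : A ⊗[R] B ≃ₗ[R] C)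
    (hF : ∀ g h a b, γ (g + h + s) (F (α g a ⊗ₜ β h b)) = F (α g a ⊗ₜ β h b)) (k : ι) :
    Nonempty (↥(LinearMap.range (γ (k + s))) ≃ₗ[R]
      ⨁ x : {x : ι × ι // x.1 + x.2 = k},
        ↥(LinearMap.range (α x.1.1)) ⊗[R] ↥(LinearMap.range (β x.1.2))) := by
  have hγ' : ∀ g h l a b, γ (l + s) (F (α g a ⊗ₜ β h b)) =
      if g + h = l then F (α g a ⊗ₜ β h b) else 0 := by
    intro g h l a b
    split_ifs with hl
    · rw [← hl, hF]
    · rw [← hF, hγ.orth _ _ _ fun h => hl (add_right_cancel h).symm]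
  let f : (⨁ x : {x : ι × ι // x.1 + x.2 = k},
      ↥(LinearMap.range (α x.1.1)) ⊗[R] ↥(LinearMap.range (β x.1.2))) →ₗ[R] C :=
    DirectSum.toModule R _ _ fun x => F.toLinearMap ∘ₗ
      TensorProduct.map (LinearMap.range (α x.1.1)).subtype (LinearMap.range (β x.1.2)).subtype
  have hfl : ∀ x a b, f (DirectSum.lof R {x : ι × ι // x.1 + x.2 = k} _ x (a ⊗ₜ b)) =
      F ((a : A) ⊗ₜ (b : B)) := by
    intro x a b
    simp [f]
  have hinj : Function.Injective f := by
    rw [injective_iff_map_eq_zero]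
    intro t ht
    -- Undoing F and projecting to bidegrees x.1.1 and x.1.2 recovers the summand indexed by x,
    -- because different pairs of degrees are orthogonal in at least one factor.
    have hcomp : ∀ x : {x : ι × ι // x.1 + x.2 = k},
        TensorProduct.map (α x.1.1).rangeRestrict (β x.1.2).rangeRestrict ∘ₗ
          F.symm.toLinearMap ∘ₗ f = DirectSum.component R _ _ x := by
      intro x
      ext y : 1
      ext ⟨_, a, rfl⟩ ⟨_, b, rfl⟩
      simp only [LinearMap.comp_apply, TensorProduct.AlgebraTensorModule.curry_apply,
        LinearMap.restrictScalars_self, TensorProduct.curry_apply, hfl]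
      rw [LinearEquiv.coe_coe, LinearEquiv.symm_apply_apply, TensorProduct.map_tmul]
      by_cases hxy : y = x
      · subst hxy
        rw [DirectSum.component.lof_self]
        congr 1 <;> ext1
        · exact hα.proj _ _
        · exact hβ.proj _ _
      · rw [DirectSum.component.of, dif_neg hxy]
        by_cases h1 : y.1.1 = x.1.1
        · have h2 : y.1.2 ≠ x.1.2 := by
            intro h2
            exact hxy (Subtype.ext (Prod.ext h1 h2))
          have h3 : (β x.1.2).rangeRestrict (β y.1.2 b) = 0 :=
            Subtype.ext (hβ.orth _ _ _ h2.symm)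
          rw [h3, TensorProduct.tmul_zero]
        · have h3 : (α x.1.1).rangeRestrict (α y.1.1 a) = 0 :=
            Subtype.ext (hα.orth _ _ _ (Ne.symm h1))
          rw [h3, TensorProduct.zero_tmul]
    refine DFinsupp.ext fun x => ?_
    have h1 := LinearMap.congr_fun (hcomp x) t
    simp only [LinearMap.comp_apply, ht, map_zero] at h1
    exact h1.symm
  have hrange : LinearMap.range f = LinearMap.range (γ (k + s)) := by
    apply le_antisymm
    · rw [LinearMap.range_le_iff_comap, eq_top_iff]
      rintro t -
      induction t using DirectSum.induction_on with
      | zero => exact Submodule.zero_mem _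
      | of x t =>
        induction t with
        | zero => rw [map_zero]; exact Submodule.zero_mem _
        | tmul a b =>
          obtain ⟨_, a, rfl⟩ := a
          obtain ⟨_, b, rfl⟩ := b
          rw [Submodule.mem_comap]; change f (DirectSum.lof R _ _ _ _) ∈ _; rw [hfl]
          exact ⟨_, by rw [hγ', if_pos x.2]⟩
        | add t u ht hu => rw [map_add]; exact Submodule.add_mem _ ht hu
      | add t u ht hu => exact Submodule.add_mem _ ht hu
    -- On a pure tensor, both factors are expanded into homogeneous parts; the projection keeps
    -- exactly the terms whose degrees add up to k.
    · rintro _ ⟨c, rfl⟩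
      obtain ⟨t, rfl⟩ := F.surjective c
      induction t with
      | zero => simp
      | add t u ht hu => rw [map_add, map_add]; exact Submodule.add_mem _ ht hu
      | tmul a b =>
        obtain ⟨S, hS⟩ := hα.sum
        obtain ⟨T, hT⟩ := hβ.sum
        rw [← hS a, ← hT b, TensorProduct.sum_tmul, map_sum, map_sum]
        refine Submodule.sum_mem _ fun g _ => ?_
        rw [TensorProduct.tmul_sum, map_sum, map_sum]
        refine Submodule.sum_mem _ fun h _ => ?_
        rw [hγ']
        split_ifs with hk
        · exact ⟨_, hfl ⟨(g, h), hk⟩ ⟨_, a, rfl⟩ ⟨_, b, rfl⟩⟩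
        · exact Submodule.zero_mem _
  exact ⟨LinearEquiv.ofEq _ _ hrange.symm ≪≫ₗ (LinearEquiv.ofInjective f hinj).symm⟩

end Gradings

/-! ### Signs of sequences. -/

section Signs

variable {V : Type*}

/-- The sign of a sequence with respect to an antisymmetric function `s` with values `±1` off the
diagonal, for instance the one given by a linear order. -/
def listSign (s : V → V → ℤ) : List V → ℤ
  | [] => 1
  | v :: l => (l.map (s v)).prod * listSign s l

theorem listSign_append (s : V → V → ℤ) (b l : List V) :
    listSign s (b ++ l) =
      listSign s b * (b.map fun x => (l.map (s x)).prod).prod * listSign s l := by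
  induction b with
  | nil => simp [listSign]
  | cons v b ih =>
    simp only [List.cons_append, listSign, ih, List.map_append, List.prod_append, List.map_cons,
      List.prod_cons]
    ring

/-- Exchanging v and w reverses the pair (v, w) once. For each x standing between them it reverses
two pairs, whose signs cancel (`hb`), and the factors from entries outside are only permuted. -/
theorem isAlternating_listSign {s : V → V → ℤ} (hs : ∀ v w, s v w = - s w v) :
    IsAlternating (listSign s) := by
  intro a b c v w
  have hcross : (a.map fun x => ((v :: (b ++ w :: c)).map (s x)).prod) =
      a.map fun x => ((w :: (b ++ v :: c)).map (s x)).prod :=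
    List.map_congr_left fun x _ => ((swap_perm [] b c v w).map (s x)).prod_eq
  have hb : (b.map (s v)).prod * (b.map fun x => s x w).prod =
      (b.map (s w)).prod * (b.map fun x => s x v).prod := by
    induction b with
    | nil => simp
    | cons x b ih =>
      have ih := ih (List.map_congr_left fun x _ => ((swap_perm [] b c v w).map (s x)).prod_eq)
      simp only [List.map_cons, List.prod_cons]
      rw [hs v x, hs x w]
      linear_combination (s x v * s w x) * ih
  have hcons : ∀ w, (b.map fun x => ((w :: c).map (s x)).prod).prod =
      (b.map fun x => s x w).prod * (b.map fun x => (c.map (s x)).prod).prod := by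
    intro w
    rw [← List.prod_map_mul]
    simp
  rw [listSign_append, listSign_append s a, hcross, listSign, listSign, listSign_append s b,
    listSign_append s b, hcons, hcons]
  generalize (a.map fun x => ((w :: (b ++ v :: c)).map (s x)).prod).prod = A
  simp only [listSign, List.map_append, List.prod_append, List.map_cons, List.prod_cons]
  rw [hs v w]
  linear_combination (-(listSign s a * A * (c.map (s v)).prod * (c.map (s w)).prod * s w v *
    listSign s b * listSign s c * (b.map fun x => (c.map (s x)).prod).prod)) * hb

theorem listSign_mul_self {s : V → V → ℤ} (hs : ∀ v w, v ≠ w → s v w * s v w = 1) {l : List V}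
    (hl : l.Nodup) : listSign s l * listSign s l = 1 := by
  induction l with
  | nil => rfl
  | cons v l ih =>
    obtain ⟨hv, hl⟩ := List.nodup_cons.1 hl
    have h : (l.map (s v)).prod * (l.map (s v)).prod = 1 := by
      rw [← List.prod_map_mul]
      refine List.prod_eq_one fun x hx => ?_
      obtain ⟨y, hy, rfl⟩ := List.mem_map.1 hx
      exact hs v y fun h => hv (h ▸ hy)
    rw [listSign]
    linear_combination h * listSign s l * listSign s l + ih hl

/-- A well-ordering of the vertices supplies the signs; antisymmetry forces the value 0 on the
diagonal. -/
theorem exists_antisymm_sign (V : Type*) :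
    ∃ s : V → V → ℤ, (∀ v w, s v w = - s w v) ∧ ∀ v w, v ≠ w → s v w * s v w = 1 := by
  classical
  let _ : LinearOrder V := linearOrderOfSTO WellOrderingRel
  refine ⟨fun v w => if v < w then 1 else if w < v then -1 else 0, fun v w => ?_, fun v w h => ?_⟩
  · rcases lt_trichotomy v w with h | rfl | h
    · simp [h, h.not_gt]
    · simp
    · simp [h, h.not_gt]
  · rcases h.lt_or_gt with h | h
    · simp [h]
    · simp [h, h.not_gt]

/-- Adjacent transpositions generate all permutations. Which of the two signs occurs is never
needed. -/
theorem IsAlternating.eq_or_eq_neg_of_perm {T : Type*} [AddCommGroup T] {l m : List V}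
    (h : l.Perm m) : ∀ {f : List V → T}, IsAlternating f → f l = f m ∨ f l = - f m := by
  induction h with
  | nil => intro f _; exact Or.inl rfl
  | cons x h ih =>
    intro f hf
    exact ih (f := fun l => f (x :: l)) fun a b c v w => hf (x :: a) b c v w
  | swap x y l => intro f hf; exact Or.inr (hf [] [] l y x)
  | trans h₁ h₂ ih₁ ih₂ =>
    intro f hf
    rcases ih₁ hf with h₁ | h₁ <;> rcases ih₂ hf with h₂ | h₂ <;> simp [h₁, h₂]

end Signs

/-! ### Formal properties of the alternating face sum. -/

section FaceSum

variable {V W : Type*} {T U : Type*} [AddCommGroup T] [AddCommGroup U]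

theorem map_faceSum (φ : T →+ U) (f : List V → T) (l : List V) :
    φ (faceSum f l) = faceSum (fun m => φ (f m)) l := by
  simp [faceSum]

theorem faceSum_map (f : List W → T) (g : V → W) (l : List V) :
    faceSum f (l.map g) = faceSum (fun m => f (m.map g)) l := by
  simp [faceSum, List.eraseIdx_map]

/-- Induction on the first vertex: the faces that omit it occur twice with opposite signs, and what
remains is the double face sum over the tail. -/
theorem faceSum_faceSum (f : List V → T) (l : List V) : faceSum (faceSum f) l = 0 := by
  induction l generalizing f with
  | nil => rfl
  | cons x l ih =>
    rw [faceSum_cons]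
    have h : faceSum (fun m => faceSum f (x :: m)) l =
        faceSum f l - faceSum (faceSum fun m => f (x :: m)) l := by
      simp only [faceSum_cons]
      simp [faceSum, smul_sub]
    rw [h, ih]
    abel

/-- The source of the Leibniz rule for d on a join: deleting an entry of m costs (-1)^|l|, as its
position is shifted by |l|. -/
theorem faceSum_append (f : List V → T) (l m : List V) :
    faceSum f (l ++ m) = faceSum (fun l' => f (l' ++ m)) l +
      (-1 : ℤ) ^ l.length • faceSum (fun m' => f (l ++ m')) m := by
  induction l generalizing f with
  | nil => simp [faceSum]
  | cons x l ih =>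
    simp only [List.cons_append, faceSum_cons, ih, List.length_cons, pow_succ]
    simp only [mul_neg, mul_one, neg_smul]
    abel

end FaceSum

/-! ### Bases of chain groups; d² = 0 and δ² = 0. -/

section ChainLemmas

variable {V : Type*} [DecidableEq V] {Φ : Set (Finset V)}

theorem chain_linearMap_ext {T : Type*} [AddCommGroup T] {f g : Chain Φ →ₗ[ℤ] T}
    (h : ∀ l, IsChainSimplex Φ l → f (chain Φ l) = g (chain Φ l)) : f = g := by
  refine Submodule.linearMap_qext _ (Finsupp.lhom_ext' fun l => LinearMap.ext_ring ?_)
  by_cases hl : IsChainSimplex Φ l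
  · exact h l hl
  · have h0 := chain_eq_zero hl
    change f (chain Φ l) = g (chain Φ l)
    rw [h0, map_zero, map_zero]

theorem boundary_chain {l : List V} (hl : IsChainSimplex Φ l) :
    boundary Φ (chain Φ l) = faceSum (chain Φ) l :=
  chainLift_chain _ _ _ hl

theorem IsChainSimplex.of_sublist (hΦ : IsLowerSet Φ) {l m : List V} (h : l.Sublist m)
    (hm : IsChainSimplex Φ m) : IsChainSimplex Φ l :=
  ⟨hm.1.sublist h, hΦ (fun x hx => by
    rw [List.mem_toFinset] at hx ⊢
    exact h.subset hx) hm.2⟩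

theorem boundary_boundary (hΦ : IsLowerSet Φ) (x : Chain Φ) : boundary Φ (boundary Φ x) = 0 := by
  have h : boundary Φ ∘ₗ boundary Φ = 0 := chain_linearMap_ext fun l hl => by
    rw [LinearMap.comp_apply, boundary_chain hl, LinearMap.zero_apply,
      ← faceSum_faceSum (chain Φ) l]
    refine (map_faceSum (boundary Φ).toAddMonoidHom _ _).trans ?_
    refine Finset.sum_congr rfl fun i _ => congrArg _ ?_
    exact boundary_chain (hl.of_sublist hΦ (List.eraseIdx_sublist l i))
  exact LinearMap.congr_fun h x

/-- If l is not a simplex, neither is any v :: l, since Φ is closed under subsets. For the nonempty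
simplices this closure fails: there the empty sequence is zero while single vertices are not. For
this reason part (a) does not go through the bicomplex used for part (b). -/
theorem coboundary_chain [Fintype V] (hΦ : IsLowerSet Φ) (l : List V) :
    coboundary Φ (chain Φ l) = ∑ v : V, chain Φ (v :: l) := by
  by_cases hl : IsChainSimplex Φ l
  · exact chainLift_chain _ _ _ hl
  · rw [chain_eq_zero hl, map_zero, eq_comm]
    exact Finset.sum_eq_zero fun v _ => chain_eq_zero fun h =>
      hl (h.of_sublist hΦ (List.sublist_cons_self v l))

theorem signOp_chain (l : List V) : signOp Φ (chain Φ l) = (-1 : ℤ) ^ l.length • chain Φ l := by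
  by_cases hl : IsChainSimplex Φ l
  · exact chainLift_chain _ _ _ hl
  · rw [chain_eq_zero hl, map_zero, smul_zero]

theorem chain_cons_cons (u v : V) (l : List V) : chain Φ (u :: v :: l) = - chain Φ (v :: u :: l) :=
  isAlternating_chain Φ [] [] l u v

/-- The projection of the chain group to the part spanned by the sequences of length `k`. -/
noncomputable def lengthProj (Φ : Set (Finset V)) (k : ℤ) : Chain Φ →ₗ[ℤ] Chain Φ :=
  chainLift Φ (fun l => if (l.length : ℤ) = k then chain Φ l else 0) (by
    intro a b c v w
    dsimp only
    rw [isAlternating_chain Φ a b c v w, (swap_perm a b c v w).length_eq]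
    split_ifs <;> simp)

theorem lengthProj_chain (k : ℤ) (l : List V) :
    lengthProj Φ k (chain Φ l) = if (l.length : ℤ) = k then chain Φ l else 0 := by
  by_cases hl : IsChainSimplex Φ l
  · exact chainLift_chain _ _ _ hl
  · simp [chain_eq_zero hl]

/-- The chains of any enumerations of the simplices form a basis. -/
theorem exists_basis_chain (Φ : Set (Finset V)) (enum : ↥Φ → List V)
    (h : ∀ S, IsChainSimplex Φ (enum S)) (h' : ∀ S, (enum S).toFinset = S) :
    ∃ b : Module.Basis ↥Φ ℤ (Chain Φ), ∀ S, b S = chain Φ (enum S) := by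
  obtain ⟨s, hs, hs'⟩ := exists_antisymm_sign V
  -- Weighting a sequence by its sign makes its underlying set an alternating function, so
  -- coordinates descend to chains. Each enumeration is sent to ±1 times its own simplex, which
  -- gives linear independence.
  let coord : Chain Φ →ₗ[ℤ] Finset V →₀ ℤ :=
    chainLift Φ (fun l => Finsupp.single l.toFinset (listSign s l)) (by
      intro a b c v w
      dsimp only
      rw [isAlternating_listSign hs a b c v w,
        List.toFinset_eq_of_perm _ _ (swap_perm a b c v w), Finsupp.single_neg])
  have hli : LinearIndependent ℤ fun S => chain Φ (enum S) := by
    rw [linearIndependent_iff]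
    intro x hx
    ext S
    have h1 := congrArg (fun y => coord y S) hx
    simp only [Finsupp.linearCombination_apply, Finsupp.sum, map_sum, map_smul, map_zero,
      Finsupp.coe_finsetSum, Finset.sum_apply, Finsupp.coe_smul, Pi.smul_apply,
      Finsupp.coe_zero, Pi.zero_apply] at h1
    have h2 : ∀ S' : ↥Φ, coord (chain Φ (enum S')) S = if S' = S then listSign s (enum S) else 0 := by
      intro S'
      rw [show coord (chain Φ (enum S')) = _ from chainLift_chain _ _ _ (h S'), Finsupp.single_apply, h']
      by_cases hSS : S' = S
      · simp [hSS]
      · rw [if_neg hSS, if_neg fun h => hSS (Subtype.ext h)]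
    simp only [h2, smul_ite, smul_zero, Finset.sum_ite_eq'] at h1
    by_contra hxS
    rw [if_pos (Finsupp.mem_support_iff.2 hxS), smul_eq_mul] at h1
    apply hxS
    have h3 := listSign_mul_self hs' (h S).1
    rw [Finsupp.zero_apply]
    linear_combination (listSign s (enum S)) * h1 - x S * h3
  refine ⟨Module.Basis.mk hli ?_, fun S => Module.Basis.mk_apply _ _ S⟩
  rintro x -
  obtain ⟨x, rfl⟩ := Submodule.mkQ_surjective _ x
  induction x using Finsupp.induction_linear with
  | zero => rw [map_zero]; exact Submodule.zero_mem _
  | add x y hx hy => rw [map_add]; exact Submodule.add_mem _ hx hy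
  | single l n =>
    have h1 : (Finsupp.single l n : List V →₀ ℤ) = n • Finsupp.single l 1 := by simp
    rw [h1, map_smul]
    refine Submodule.smul_mem _ _ ?_
    change chain Φ l ∈ _
    by_cases hl : IsChainSimplex Φ l
    · have hmem := Submodule.subset_span (R := ℤ) (Set.mem_range_self (f := fun S => chain Φ (enum S))
        ⟨l.toFinset, hl.2⟩)
      have hperm : l.Perm (enum ⟨l.toFinset, hl.2⟩) :=
        List.perm_of_nodup_nodup_toFinset_eq hl.1 (h _).1
          (h' ⟨l.toFinset, hl.2⟩).symm
      rcases (isAlternating_chain Φ).eq_or_eq_neg_of_perm hperm with h2 | h2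
      · rw [h2]; exact hmem
      · rw [h2]; exact Submodule.neg_mem _ hmem
    · rw [chain_eq_zero hl]
      exact Submodule.zero_mem _

theorem exists_basis_chain' (Φ : Set (Finset V)) : Nonempty (Module.Basis ↥Φ ℤ (Chain Φ)) := by
  obtain ⟨b, -⟩ := exists_basis_chain Φ (fun S => (S : Finset V).toList)
    (fun S => ⟨Finset.nodup_toList _, by rw [Finset.toList_toFinset]; exact S.2⟩)
    fun S => Finset.toList_toFinset _
  exact ⟨b⟩

instance (Φ : Set (Finset V)) : Module.Free ℤ (Chain Φ) :=
  Module.Free.of_basis (exists_basis_chain' Φ).some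

instance [Fintype V] (Φ : Set (Finset V)) : Module.Finite ℤ (Chain Φ) :=
  have : Finite ↥Φ := Finite.of_injective (Subtype.val : ↥Φ → Finset V) Subtype.val_injective
  Module.Finite.of_basis (exists_basis_chain' Φ).some

/-- Exchanging the two new vertices shows that the double sum equals its own negative, and a free
group has no 2-torsion. -/
theorem coboundary_coboundary [Fintype V] (hΦ : IsLowerSet Φ) (x : Chain Φ) :
    coboundary Φ (coboundary Φ x) = 0 := by
  have h : coboundary Φ ∘ₗ coboundary Φ = 0 := chain_linearMap_ext fun l _ => by
    rw [LinearMap.comp_apply, coboundary_chain hΦ, map_sum, LinearMap.zero_apply]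
    simp only [coboundary_chain hΦ]
    set y := ∑ v : V, ∑ w : V, chain Φ (w :: v :: l) with hy
    have h1 : y = -y := by
      conv_rhs => rw [hy, Finset.sum_comm]
      rw [hy, ← Finset.sum_neg_distrib]
      refine Finset.sum_congr rfl fun v _ => ?_
      rw [← Finset.sum_neg_distrib]
      exact Finset.sum_congr rfl fun w _ => chain_cons_cons _ _ _
    have h2 : (2 : ℤ) • y = 0 := by
      rw [two_smul]
      nth_rewrite 1 [h1]
      abel
    exact (smul_eq_zero_iff_right (two_ne_zero)).1 h2
  exact LinearMap.congr_fun h x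

end ChainLemmas

/-! ### Maps induced on the spectral sequence. -/

section Functoriality

variable {V U : Type*} [DecidableEq V] [DecidableEq U] {Φ : Set (Finset V)} {Ψ : Set (Finset U)}

/-- The total group `N = ⨁ N^{p,q}`, generated by all `σ ⊗ τ` with `σ ⊆ τ`. -/
noncomputable def Ntot (Φ : Set (Finset V)) : Submodule ℤ (Chain Φ ⊗[ℤ] Chain Φ) :=
  Submodule.span ℤ {x | ∃ σ τ : List V, IsChainSimplex Φ σ ∧ IsChainSimplex Φ τ ∧ σ ⊆ τ ∧
    x = chain Φ σ ⊗ₜ[ℤ] chain Φ τ}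

theorem N_le_Ntot (Φ : Set (Finset V)) (p q : ℤ) : N Φ p q ≤ Ntot Φ := by
  refine Submodule.span_mono ?_
  rintro x ⟨σ, τ, hσ, hτ, h, -, -, rfl⟩
  exact ⟨σ, τ, hσ, hτ, h, rfl⟩

theorem Fil_le_Ntot (Φ : Set (Finset V)) (p n : ℤ) : Fil Φ p n ≤ Ntot Φ :=
  iSup₂_le fun _ _ => N_le_Ntot Φ _ _

theorem Fil_map {F : Chain Φ ⊗[ℤ] Chain Φ →ₗ[ℤ] Chain Ψ ⊗[ℤ] Chain Ψ}
    (hN : ∀ p q, ∀ x ∈ N Φ p q, F x ∈ N Ψ p q) (p n : ℤ) {x : Chain Φ ⊗[ℤ] Chain Φ}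
    (hx : x ∈ Fil Φ p n) : F x ∈ Fil Ψ p n := by
  have h : Fil Φ p n ≤ (Fil Ψ p n).comap F := iSup₂_le fun i hi y hy =>
    (le_iSup₂ (f := fun (i : ℤ) (_ : i ≤ p) => N Ψ i (i + n)) i hi) (hN _ _ y hy)
  exact h hx

variable [Fintype V] [Fintype U]

theorem Zr_map {F : Chain Φ ⊗[ℤ] Chain Φ →ₗ[ℤ] Chain Ψ ⊗[ℤ] Chain Ψ}
    (hN : ∀ p q, ∀ x ∈ N Φ p q, F x ∈ N Ψ p q) (hF : ∀ x, Delta Ψ (F x) = F (Delta Φ x))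
    (r p n : ℤ) {x : Chain Φ ⊗[ℤ] Chain Φ} (hx : x ∈ Zr Φ r p n) : F x ∈ Zr Ψ r p n := by
  refine ⟨Fil_map hN _ _ hx.1, ?_⟩
  rw [Submodule.comap_coe, Set.mem_preimage, hF]
  exact Fil_map hN _ _ hx.2

theorem Br_map {F : Chain Φ ⊗[ℤ] Chain Φ →ₗ[ℤ] Chain Ψ ⊗[ℤ] Chain Ψ}
    (hN : ∀ p q, ∀ x ∈ N Φ p q, F x ∈ N Ψ p q) (hF : ∀ x, Delta Ψ (F x) = F (Delta Φ x))
    (r p n : ℤ) {x : Chain Φ ⊗[ℤ] Chain Φ} (hx : x ∈ Br Φ r p n) : F x ∈ Br Ψ r p n := by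
  obtain ⟨y, hy, _, ⟨z, hz, rfl⟩, rfl⟩ := Submodule.mem_sup.1 hx
  rw [map_add, ← hF]
  exact Submodule.add_mem_sup (Zr_map hN hF _ _ _ hy) ⟨_, Zr_map hN hF _ _ _ hz, rfl⟩

/-- The map of spectral sequences induced by a map of bicomplexes. -/
noncomputable def E.map (F : Chain Φ ⊗[ℤ] Chain Φ →ₗ[ℤ] Chain Ψ ⊗[ℤ] Chain Ψ)
    (hN : ∀ p q, ∀ x ∈ N Φ p q, F x ∈ N Ψ p q) (hF : ∀ x, Delta Ψ (F x) = F (Delta Φ x))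
    (r p q : ℤ) : E Φ r p q →ₗ[ℤ] E Ψ r p q :=
  Submodule.mapQ _ _ (F.restrict fun _ hx => Zr_map hN hF _ _ _ hx) fun _ hx =>
    Br_map hN hF _ _ _ hx

theorem Delta_tmul (x y : Chain Φ) :
    Delta Φ (x ⊗ₜ y) = boundary Φ x ⊗ₜ y + signOp Φ x ⊗ₜ coboundary Φ y :=
  rfl

theorem Delta_map {f : Chain Φ →ₗ[ℤ] Chain Ψ} (hd : ∀ x, boundary Ψ (f x) = f (boundary Φ x))
    (hδ : ∀ x, coboundary Ψ (f x) = f (coboundary Φ x)) (hs : ∀ x, signOp Ψ (f x) = f (signOp Φ x))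
    (x : Chain Φ ⊗[ℤ] Chain Φ) :
    Delta Ψ (TensorProduct.map f f x) = TensorProduct.map f f (Delta Φ x) := by
  induction x with
  | zero => simp
  | tmul x y => simp [Delta_tmul, hd, hδ, hs]
  | add x y hx hy => simp only [map_add, hx, hy]

end Functoriality

/-! ### Connected components and the splitting of N. -/

section Embeddings

variable {V U : Type*} [DecidableEq V] [DecidableEq U]

/-- `g` identifies `Φ` with a union of connected components of `Ψ`, and `g'` is its partial
inverse. -/
structure IsComponent (Φ : Set (Finset V)) (Ψ : Set (Finset U)) (g : V → U) (g' : U → Option V) :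
    Prop where
  left_inv : ∀ v, g' (g v) = some v
  simplex_iff : ∀ l, IsChainSimplex Ψ (l.map g) ↔ IsChainSimplex Φ l
  ne_nil : ∀ m, IsChainSimplex Ψ m → m ≠ []
  cases : ∀ m, IsChainSimplex Ψ m → (∃ l : List V, m = l.map g) ∨ ∀ u ∈ m, g' u = none

variable {Φ : Set (Finset V)} {Ψ : Set (Finset U)} {g : V → U} {g' : U → Option V}

/-- The map of chain groups induced by a map of vertices. -/
noncomputable def chainPush (Φ : Set (Finset V)) (Ψ : Set (Finset U)) (g : V → U) :
    Chain Φ →ₗ[ℤ] Chain Ψ :=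
  chainLift Φ (fun l => chain Ψ (l.map g)) (by
    intro a b c v w
    simp only [List.map_append, List.map_cons]
    exact isAlternating_chain Ψ _ _ _ _ _)

open Classical in
/-- The map of chain groups which forgets the sequences with a vertex outside the domain of the
partial map `g'`. -/
noncomputable def chainPull (Φ : Set (Finset V)) (Ψ : Set (Finset U)) (g' : U → Option V) :
    Chain Ψ →ₗ[ℤ] Chain Φ :=
  chainLift Ψ (fun m => if ∀ u ∈ m, g' u ≠ none then chain Φ (m.filterMap g') else 0) (by
    intro a b c v w
    have h1 : (∀ u ∈ a ++ v :: (b ++ w :: c), g' u ≠ none) ↔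
        ∀ u ∈ a ++ w :: (b ++ v :: c), g' u ≠ none :=
      forall_congr' fun u => by rw [(swap_perm a b c v w).mem_iff]
    dsimp only
    split_ifs with h2 h3 h3
    · obtain ⟨v', hv'⟩ := Option.ne_none_iff_exists'.1 (h2 v (by simp))
      obtain ⟨w', hw'⟩ := Option.ne_none_iff_exists'.1 (h2 w (by simp))
      simp only [List.filterMap_append, List.filterMap_cons, hv', hw']
      exact isAlternating_chain Φ _ _ _ _ _
    · exact absurd (h1.1 h2) h3
    · exact absurd (h1.2 h3) h2
    · simp)

namespace IsComponent

theorem push_chain (h : IsComponent Φ Ψ g g') (l : List V) :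
    chainPush Φ Ψ g (chain Φ l) = chain Ψ (l.map g) := by
  by_cases hl : IsChainSimplex Φ l
  · exact chainLift_chain _ _ _ hl
  · rw [chain_eq_zero hl, map_zero, chain_eq_zero (mt (h.simplex_iff l).1 hl)]

theorem pull_chain (h : IsComponent Φ Ψ g g') (l : List V) :
    chainPull Φ Ψ g' (chain Ψ (l.map g)) = chain Φ l := by
  by_cases hl : IsChainSimplex Ψ (l.map g)
  · refine (chainLift_chain _ _ _ hl).trans ?_
    rw [if_pos, List.filterMap_map]
    · congr 1
      have : g' ∘ g = some := funext h.left_inv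
      rw [this, List.filterMap_some]
    · intro u hu
      obtain ⟨v, -, rfl⟩ := List.mem_map.1 hu
      simp [h.left_inv]
  · rw [chain_eq_zero hl, map_zero, chain_eq_zero (mt (h.simplex_iff l).2 hl)]

theorem pull_chain_eq_zero (h : IsComponent Φ Ψ g g') {m : List U} (hm : ∀ u ∈ m, g' u = none) :
    chainPull Φ Ψ g' (chain Ψ m) = 0 := by
  by_cases hl : IsChainSimplex Ψ m
  · refine (chainLift_chain _ _ _ hl).trans (if_neg fun h' => ?_)
    obtain ⟨u, hu⟩ := List.exists_mem_of_ne_nil _ (h.ne_nil m hl)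
    exact h' u hu (hm u hu)
  · rw [chain_eq_zero hl, map_zero]

theorem pull_push (h : IsComponent Φ Ψ g g') (x : Chain Φ) :
    chainPull Φ Ψ g' (chainPush Φ Ψ g x) = x :=
  LinearMap.congr_fun (f := chainPull Φ Ψ g' ∘ₗ chainPush Φ Ψ g) (g := LinearMap.id)
    (chain_linearMap_ext fun l _ => by
      rw [LinearMap.comp_apply, h.push_chain, h.pull_chain, LinearMap.id_apply]) x

/-- A vertex outside a component spans no simplex with a nonempty simplex inside it. Nonemptiness is
essential: the empty simplex could be extended by vertices of every component. -/
theorem chain_cons_eq_zero (h : IsComponent Φ Ψ g g') {l : List V} (hl : IsChainSimplex Φ l) {u : U}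
    (hu : u ∉ Set.range g) : chain Ψ (u :: l.map g) = 0 := by
  refine chain_eq_zero fun hs => ?_
  rcases h.cases _ hs with ⟨_ | ⟨v, m⟩, hm⟩ | hm
  · simp at hm
  · rw [List.map_cons, List.cons.injEq] at hm
    exact hu ⟨v, hm.1.symm⟩
  · have hne : l ≠ [] := fun h0 => h.ne_nil _ ((h.simplex_iff l).2 hl) (by simp [h0])
    obtain ⟨v, hv⟩ := List.exists_mem_of_ne_nil _ hne
    have h1 := hm (g v) (List.mem_cons_of_mem _ (List.mem_map_of_mem hv))
    rw [h.left_inv] at h1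
    exact Option.some_ne_none _ h1

theorem injective (h : IsComponent Φ Ψ g g') : Function.Injective g := fun v w hvw =>
  Option.some_injective _ (by rw [← h.left_inv, ← h.left_inv, hvw])

theorem boundary_push (h : IsComponent Φ Ψ g g') (x : Chain Φ) :
    boundary Ψ (chainPush Φ Ψ g x) = chainPush Φ Ψ g (boundary Φ x) :=
  LinearMap.congr_fun (f := boundary Ψ ∘ₗ chainPush Φ Ψ g) (g := chainPush Φ Ψ g ∘ₗ boundary Φ)
    (chain_linearMap_ext fun l hl => by
      rw [LinearMap.comp_apply, LinearMap.comp_apply, h.push_chain,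
        boundary_chain ((h.simplex_iff l).2 hl), boundary_chain hl, faceSum_map]
      refine Eq.symm ((map_faceSum (chainPush Φ Ψ g).toAddMonoidHom _ _).trans ?_)
      exact Finset.sum_congr rfl fun i _ => congrArg _ (h.push_chain _)) x

theorem coboundary_push [Fintype V] [Fintype U] (h : IsComponent Φ Ψ g g') (x : Chain Φ) :
    coboundary Ψ (chainPush Φ Ψ g x) = chainPush Φ Ψ g (coboundary Φ x) :=
  LinearMap.congr_fun (f := coboundary Ψ ∘ₗ chainPush Φ Ψ g)
    (g := chainPush Φ Ψ g ∘ₗ coboundary Φ)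
    (chain_linearMap_ext fun l hl => by
      rw [LinearMap.comp_apply, LinearMap.comp_apply, h.push_chain]
      refine (chainLift_chain _ _ _ ((h.simplex_iff l).2 hl)).trans ?_
      refine Eq.trans ?_ (congrArg _ (chainLift_chain _ _ _ hl)).symm
      rw [map_sum, eq_comm]
      refine Fintype.sum_of_injective g h.injective _ _ (fun u hu => h.chain_cons_eq_zero hl hu)
        fun v => ?_
      rw [h.push_chain, List.map_cons]) x

theorem signOp_push (h : IsComponent Φ Ψ g g') (x : Chain Φ) :
    signOp Ψ (chainPush Φ Ψ g x) = chainPush Φ Ψ g (signOp Φ x) :=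
  LinearMap.congr_fun (f := signOp Ψ ∘ₗ chainPush Φ Ψ g) (g := chainPush Φ Ψ g ∘ₗ signOp Φ)
    (chain_linearMap_ext fun l hl => by
      rw [LinearMap.comp_apply, LinearMap.comp_apply, h.push_chain, signOp_chain, signOp_chain,
        map_smul, h.push_chain, List.length_map]) x

theorem boundary_pull (h : IsComponent Φ Ψ g g') (x : Chain Ψ) :
    boundary Φ (chainPull Φ Ψ g' x) = chainPull Φ Ψ g' (boundary Ψ x) :=
  LinearMap.congr_fun (f := boundary Φ ∘ₗ chainPull Φ Ψ g')
    (g := chainPull Φ Ψ g' ∘ₗ boundary Ψ)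
    (chain_linearMap_ext fun m hm => by
      rw [LinearMap.comp_apply, LinearMap.comp_apply, boundary_chain hm]
      refine Eq.trans ?_ (map_faceSum (chainPull Φ Ψ g').toAddMonoidHom _ _).symm
      rcases h.cases m hm with ⟨l, rfl⟩ | hm'
      · rw [h.pull_chain, boundary_chain ((h.simplex_iff l).1 hm), faceSum_map]
        exact Finset.sum_congr rfl fun i _ => congrArg _ (h.pull_chain _).symm
      · rw [h.pull_chain_eq_zero hm', map_zero, eq_comm]
        refine Finset.sum_eq_zero fun i _ => ?_
        refine (congrArg _ (h.pull_chain_eq_zero fun u hu => ?_)).trans (smul_zero _)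
        exact hm' u ((List.eraseIdx_sublist m i).subset hu)) x

theorem coboundary_pull [Fintype V] [Fintype U] (h : IsComponent Φ Ψ g g') (x : Chain Ψ) :
    coboundary Φ (chainPull Φ Ψ g' x) = chainPull Φ Ψ g' (coboundary Ψ x) :=
  LinearMap.congr_fun (f := coboundary Φ ∘ₗ chainPull Φ Ψ g')
    (g := chainPull Φ Ψ g' ∘ₗ coboundary Ψ)
    (chain_linearMap_ext fun m hm => by
      rw [LinearMap.comp_apply, LinearMap.comp_apply]
      refine Eq.trans ?_ (congrArg _ (chainLift_chain _ _ _ hm)).symm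
      rw [map_sum]
      rcases h.cases m hm with ⟨l, rfl⟩ | hm'
      · have hl := (h.simplex_iff l).1 hm
        rw [h.pull_chain]
        refine (chainLift_chain _ _ _ hl).trans ?_
        refine Fintype.sum_of_injective g h.injective _ _
          (fun u hu => by rw [h.chain_cons_eq_zero hl hu, map_zero]) fun v => ?_
        rw [← List.map_cons, h.pull_chain]
      · rw [h.pull_chain_eq_zero hm', map_zero, eq_comm]
        refine Finset.sum_eq_zero fun u _ => ?_
        -- A coface of a simplex outside the component is again outside, so all terms are forgotten
        -- by the projection.
        by_cases hs : IsChainSimplex Ψ (u :: m)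
        · refine h.pull_chain_eq_zero ?_
          rcases h.cases _ hs with ⟨_ | ⟨v, l⟩, hl⟩ | h'
          · simp at hl
          · rw [List.map_cons, List.cons.injEq] at hl
            obtain ⟨w, hw⟩ := List.exists_mem_of_ne_nil _ (h.ne_nil m hm)
            have h1 := hm' w hw
            rw [hl.2] at hw
            obtain ⟨w', -, rfl⟩ := List.mem_map.1 hw
            rw [h.left_inv] at h1
            exact absurd h1 (Option.some_ne_none _)
          · exact h'
        · rw [chain_eq_zero hs, map_zero]) x

theorem signOp_pull (h : IsComponent Φ Ψ g g') (x : Chain Ψ) :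
    signOp Φ (chainPull Φ Ψ g' x) = chainPull Φ Ψ g' (signOp Ψ x) :=
  LinearMap.congr_fun (f := signOp Φ ∘ₗ chainPull Φ Ψ g') (g := chainPull Φ Ψ g' ∘ₗ signOp Ψ)
    (chain_linearMap_ext fun m hm => by
      rw [LinearMap.comp_apply, LinearMap.comp_apply, signOp_chain, map_smul]
      rcases h.cases m hm with ⟨l, rfl⟩ | hm'
      · rw [h.pull_chain, signOp_chain, List.length_map]
      · rw [h.pull_chain_eq_zero hm', map_zero, smul_zero]) x

theorem push_mem_N (h : IsComponent Φ Ψ g g') (p q : ℤ) (x : Chain Φ ⊗[ℤ] Chain Φ)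
    (hx : x ∈ N Φ p q) :
    TensorProduct.map (chainPush Φ Ψ g) (chainPush Φ Ψ g) x ∈ N Ψ p q := by
  have hle : N Φ p q ≤
      (N Ψ p q).comap (TensorProduct.map (chainPush Φ Ψ g) (chainPush Φ Ψ g)) := by
    refine Submodule.span_le.2 ?_
    rintro _ ⟨σ, τ, hσ, hτ, hστ, hp, hq, rfl⟩
    refine Submodule.subset_span ⟨σ.map g, τ.map g, (h.simplex_iff σ).2 hσ, (h.simplex_iff τ).2 hτ,
      List.map_subset g hστ, by simpa using hp, by simpa using hq, ?_⟩
    rw [TensorProduct.map_tmul, h.push_chain, h.push_chain]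
  exact hle hx

/-- σ is nonempty, so it shares a vertex with τ and hence lies in the same component. -/
theorem exists_eq_map_of_subset (h : IsComponent Φ Ψ g g') {σ τ : List U}
    (hσ : IsChainSimplex Ψ σ) (hτ : ∃ l : List V, τ = l.map g) (hστ : σ ⊆ τ) :
    ∃ l : List V, σ = l.map g := by
  rcases h.cases σ hσ with h' | h'
  · exact h'
  · obtain ⟨l, rfl⟩ := hτ
    obtain ⟨u, hu⟩ := List.exists_mem_of_ne_nil _ (h.ne_nil σ hσ)
    obtain ⟨v, -, rfl⟩ := List.mem_map.1 (hστ hu)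
    have h1 := h' _ hu
    rw [h.left_inv] at h1
    exact absurd h1 (Option.some_ne_none _)

theorem pull_mem_N (h : IsComponent Φ Ψ g g') (p q : ℤ) (x : Chain Ψ ⊗[ℤ] Chain Ψ)
    (hx : x ∈ N Ψ p q) :
    TensorProduct.map (chainPull Φ Ψ g') (chainPull Φ Ψ g') x ∈ N Φ p q := by
  have hle : N Ψ p q ≤
      (N Φ p q).comap (TensorProduct.map (chainPull Φ Ψ g') (chainPull Φ Ψ g')) := by
    refine Submodule.span_le.2 ?_
    rintro _ ⟨σ, τ, hσ, hτ, hστ, hp, hq, rfl⟩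
    change chainPull Φ Ψ g' (chain Ψ σ) ⊗ₜ[ℤ] chainPull Φ Ψ g' (chain Ψ τ) ∈ N Φ p q
    rcases h.cases τ hτ with hl | hτ'
    · obtain ⟨m, rfl⟩ := h.exists_eq_map_of_subset hσ hl hστ
      obtain ⟨l, rfl⟩ := hl
      rw [h.pull_chain, h.pull_chain]
      exact Submodule.subset_span ⟨m, l, (h.simplex_iff m).1 hσ, (h.simplex_iff l).1 hτ,
        (List.map_subset_iff g h.injective).1 hστ, by simpa using hp, by simpa using hq, rfl⟩
    · rw [h.pull_chain_eq_zero hτ', TensorProduct.tmul_zero]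
      exact Submodule.zero_mem _
  exact hle hx

end IsComponent

variable {W : Type*} [DecidableEq W] {Ω : Set (Finset W)} {f : W → U} {f' : U → Option W}

/-- The spectral sequence of a complex with two complementary components. -/
theorem IsComponent.exists_equiv_prod [Fintype V] [Fintype U] [Fintype W]
    (h : IsComponent Φ Ψ g g') (k : IsComponent Ω Ψ f f')
    (hfg : ∀ w, g' (f w) = none) (hgf : ∀ v, f' (g v) = none)
    (hcov : ∀ m, IsChainSimplex Ψ m → (∃ l : List V, m = l.map g) ∨ ∃ l : List W, m = l.map f)
    (r p q : ℤ) : Nonempty (E Ψ r p q ≃+ E Φ r p q × E Ω r p q) := by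
  let ig := TensorProduct.map (chainPush Φ Ψ g) (chainPush Φ Ψ g)
  let rg := TensorProduct.map (chainPull Φ Ψ g') (chainPull Φ Ψ g')
  let jf := TensorProduct.map (chainPush Ω Ψ f) (chainPush Ω Ψ f)
  let rf := TensorProduct.map (chainPull Ω Ψ f') (chainPull Ω Ψ f')
  let Ig := E.map ig h.push_mem_N (Delta_map h.boundary_push h.coboundary_push h.signOp_push) r p q
  let Rg := E.map rg h.pull_mem_N (Delta_map h.boundary_pull h.coboundary_pull h.signOp_pull) r p q
  let If := E.map jf k.push_mem_N (Delta_map k.boundary_push k.coboundary_push k.signOp_push) r p q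
  let Rf := E.map rf k.pull_mem_N (Delta_map k.boundary_pull k.coboundary_pull k.signOp_pull) r p q
  have hmapf : ∀ l : List W, chainPull Φ Ψ g' (chain Ψ (l.map f)) = 0 := fun l =>
    h.pull_chain_eq_zero fun u hu => by
      obtain ⟨w, -, rfl⟩ := List.mem_map.1 hu
      exact hfg w
  have hmapg : ∀ l : List V, chainPull Ω Ψ f' (chain Ψ (l.map g)) = 0 := fun l =>
    k.pull_chain_eq_zero fun u hu => by
      obtain ⟨w, -, rfl⟩ := List.mem_map.1 hu
      exact hgf w
  have h1 : rg ∘ₗ ig = LinearMap.id := by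
    ext x y
    exact congrArg₂ (fun x y => x ⊗ₜ[ℤ] y) (h.pull_push _) (h.pull_push _)
  have h2 : rf ∘ₗ jf = LinearMap.id := by
    ext x y
    exact congrArg₂ (fun x y => x ⊗ₜ[ℤ] y) (k.pull_push _) (k.pull_push _)
  have h30 : chainPull Φ Ψ g' ∘ₗ chainPush Ω Ψ f = 0 := chain_linearMap_ext fun l _ => by
    rw [LinearMap.comp_apply, k.push_chain, hmapf, LinearMap.zero_apply]
  have h40 : chainPull Ω Ψ f' ∘ₗ chainPush Φ Ψ g = 0 := chain_linearMap_ext fun l _ => by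
    rw [LinearMap.comp_apply, h.push_chain, hmapg, LinearMap.zero_apply]
  have h3 : rg ∘ₗ jf = 0 := by
    rw [← TensorProduct.map_comp, h30, TensorProduct.map_zero_left]
  have h4 : rf ∘ₗ ig = 0 := by
    rw [← TensorProduct.map_comp, h40, TensorProduct.map_zero_left]
  -- This identity holds on N but need not hold on the full tensor square: tensors σ ⊗ τ with σ and
  -- τ in different components are killed by both projections, and σ ⊆ τ excludes them.
  have h5 : ∀ x ∈ Ntot Ψ, ig (rg x) + jf (rf x) = x := by
    intro x hx
    induction hx using Submodule.span_induction with
    | zero => simp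
    | add x y _ _ hx hy =>
      rw [map_add, map_add, map_add, map_add, add_add_add_comm, hx, hy]
    | smul n x _ hx => rw [map_smul, map_smul, map_smul, map_smul, ← smul_add, hx]
    | mem x hx =>
      obtain ⟨σ, τ, hσ, hτ, hστ, rfl⟩ := hx
      simp only [ig, rg, jf, rf, TensorProduct.map_tmul]
      rcases hcov τ hτ with hl | hl
      · obtain ⟨m, rfl⟩ := h.exists_eq_map_of_subset hσ hl hστ
        obtain ⟨l, rfl⟩ := hl
        simp [h.pull_chain, h.push_chain, hmapg]
      · obtain ⟨m, rfl⟩ := k.exists_eq_map_of_subset hσ hl hστ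
        obtain ⟨l, rfl⟩ := hl
        simp [k.pull_chain, k.push_chain, hmapf]
  have H1 : ∀ x, Rg (Ig x) = x := fun x => by
    obtain ⟨x, rfl⟩ := Submodule.mkQ_surjective _ x
    exact congrArg (Submodule.mkQ _) (Subtype.ext (LinearMap.congr_fun h1 x.1))
  have H2 : ∀ x, Rf (If x) = x := fun x => by
    obtain ⟨x, rfl⟩ := Submodule.mkQ_surjective _ x
    exact congrArg (Submodule.mkQ _) (Subtype.ext (LinearMap.congr_fun h2 x.1))
  have H3 : ∀ x, Rg (If x) = 0 := fun x => by
    obtain ⟨x, rfl⟩ := Submodule.mkQ_surjective _ x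
    exact (congrArg (Submodule.mkQ _) (Subtype.ext (LinearMap.congr_fun h3 x.1))).trans (map_zero _)
  have H4 : ∀ x, Rf (Ig x) = 0 := fun x => by
    obtain ⟨x, rfl⟩ := Submodule.mkQ_surjective _ x
    exact (congrArg (Submodule.mkQ _) (Subtype.ext (LinearMap.congr_fun h4 x.1))).trans (map_zero _)
  have H5 : ∀ x, Ig (Rg x) + If (Rf x) = x := fun x => by
    obtain ⟨x, rfl⟩ := Submodule.mkQ_surjective _ x
    exact congrArg (Submodule.mkQ _) (Subtype.ext (h5 x.1 (Fil_le_Ntot _ _ _ x.2.1)))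
  exact ⟨{
    toFun x := (Rg x, Rf x)
    invFun y := Ig y.1 + If y.2
    left_inv := H5
    right_inv y := Prod.ext (by dsimp only; rw [map_add, H1, H3, add_zero])
      (by dsimp only; rw [map_add, H4, H2, zero_add])
    map_add' x y := by rw [map_add, map_add]; rfl }⟩

end Embeddings

/-! ### Part (a): the disjoint union. -/

section DisjointUnion

variable {V W : Type*} [DecidableEq V] [DecidableEq W]
  (K : AbstractSimplicialComplex V) (L : AbstractSimplicialComplex W)

theorem isChainSimplex_faces_ne_nil {m : List V} (hm : IsChainSimplex K.faces m) : m ≠ [] := by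
  rintro rfl
  exact (K.isRelLowerSet_faces hm.2).1.ne_empty rfl

theorem toFinset_map {g : V ↪ W} (l : List V) : (l.map g).toFinset = l.toFinset.map g := by
  ext x
  simp

theorem exists_eq_map_iff {X Y : Type*} {f : X → Y} {m : List Y} :
    (∃ l : List X, m = l.map f) ↔ ∀ u ∈ m, u ∈ Set.range f := by
  have h : m ∈ Set.range (List.map f) ↔ ∀ u ∈ m, u ∈ Set.range f := by rw [Set.range_list_map]; rfl
  exact (exists_congr fun l => eq_comm).trans h

theorem disjointUnion_cover {m : List (V ⊕ W)}
    (hm : IsChainSimplex (disjointUnion K L).faces m) :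
    (∃ l : List V, m = l.map Sum.inl) ∨ ∃ l : List W, m = l.map Sum.inr := by
  rw [exists_eq_map_iff, exists_eq_map_iff]
  rcases hm.2 with ⟨σ, -, hs⟩ | ⟨σ, -, hs⟩
  · refine Or.inl fun u hu => ?_
    rw [← List.mem_toFinset, hs] at hu
    obtain ⟨v, -, rfl⟩ := Finset.mem_map.1 hu
    exact ⟨v, rfl⟩
  · refine Or.inr fun u hu => ?_
    rw [← List.mem_toFinset, hs] at hu
    obtain ⟨v, -, rfl⟩ := Finset.mem_map.1 hu
    exact ⟨v, rfl⟩

theorem isComponent_inl :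
    IsComponent K.faces (disjointUnion K L).faces Sum.inl Sum.getLeft? where
  left_inv _ := rfl
  simplex_iff l := by
    rw [IsChainSimplex, IsChainSimplex, List.nodup_map_iff Sum.inl_injective]
    refine and_congr_right fun _ => ?_
    rw [show (l.map Sum.inl).toFinset = l.toFinset.map (Function.Embedding.inl (β := W)) from
      toFinset_map (g := Function.Embedding.inl) l]
    constructor
    · rintro (⟨σ, hσ, h⟩ | ⟨σ, hσ, h⟩)
      · rwa [Finset.map_injective _ h]
      · exfalso
        obtain ⟨w, hw⟩ := (L.isRelLowerSet_faces hσ).1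
        have := Finset.mem_map_of_mem (Function.Embedding.inr (α := V)) hw
        rw [← h] at this
        simp at this
    · exact fun h => Or.inl ⟨_, h, rfl⟩
  ne_nil _ hm := isChainSimplex_faces_ne_nil _ hm
  cases m hm := (disjointUnion_cover K L hm).imp_right (by
    rintro ⟨l, rfl⟩ u hu
    obtain ⟨w, -, rfl⟩ := List.mem_map.1 hu
    rfl)

theorem isComponent_inr :
    IsComponent L.faces (disjointUnion K L).faces Sum.inr Sum.getRight? where
  left_inv _ := rfl
  simplex_iff l := by
    rw [IsChainSimplex, IsChainSimplex, List.nodup_map_iff Sum.inr_injective]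
    refine and_congr_right fun _ => ?_
    rw [show (l.map Sum.inr).toFinset = l.toFinset.map (Function.Embedding.inr (α := V)) from
      toFinset_map (g := Function.Embedding.inr) l]
    constructor
    · rintro (⟨σ, hσ, h⟩ | ⟨σ, hσ, h⟩)
      · exfalso
        obtain ⟨w, hw⟩ := (K.isRelLowerSet_faces hσ).1
        have := Finset.mem_map_of_mem (Function.Embedding.inl (β := W)) hw
        rw [← h] at this
        simp at this
      · rwa [Finset.map_injective _ h]
    · exact fun h => Or.inr ⟨_, h, rfl⟩
  ne_nil _ hm := isChainSimplex_faces_ne_nil _ hm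
  cases m hm := (disjointUnion_cover K L hm).symm.imp_right (by
    rintro ⟨l, rfl⟩ u hu
    obtain ⟨w, -, rfl⟩ := List.mem_map.1 hu
    rfl)

theorem disjointUnion_equiv [Fintype V] [Fintype W] (p q : ℤ) :
    Nonempty (H (disjointUnion K L) p q ≃+ H K p q × H L p q) :=
  (isComponent_inl K L).exists_equiv_prod (isComponent_inr K L) (fun _ => rfl) (fun _ => rfl)
    (fun _ hm => disjointUnion_cover K L hm) 2 p q

end DisjointUnion

/-! ### Abstract bicomplexes and their first two pages. -/

/-- A bigraded module with commuting differentials `d` of bidegree `(-1, 0)` and `δ` of bidegree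
`(0, 1)`, and with involutions giving the signs for `d` and for `δ`. -/
structure Bicomplex (R M : Type*) [CommRing R] [AddCommGroup M] [Module R M] where
  d : M →ₗ[R] M
  δ : M →ₗ[R] M
  ε₁ : M →ₗ[R] M
  ε₂ : M →ₗ[R] M
  π : ℤ × ℤ → M →ₗ[R] M
  d_d : ∀ m, d (d m) = 0
  δ_δ : ∀ m, δ (δ m) = 0
  d_δ : ∀ m, d (δ m) = δ (d m)
  ε₁_ε₁ : ∀ m, ε₁ (ε₁ m) = m
  ε₂_ε₂ : ∀ m, ε₂ (ε₂ m) = m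
  d_ε₁ : ∀ m, d (ε₁ m) = - ε₁ (d m)
  δ_ε₁ : ∀ m, δ (ε₁ m) = ε₁ (δ m)
  δ_ε₂ : ∀ m, δ (ε₂ m) = - ε₂ (δ m)
  grading : IsGrading π
  d_π : ∀ g m, d (π g m) = π (g + (-1, 0)) (d m)
  δ_π : ∀ g m, δ (π g m) = π (g + (0, 1)) (δ m)
  ε₁_π : ∀ g m, ε₁ (π g m) = π g (ε₁ m)

namespace Bicomplex

section Pages

variable {R M : Type*} [CommRing R] [AddCommGroup M] [Module R M] (A : Bicomplex R M)

/-- The first page, the homology of `δ`. -/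
abbrev E₁ : Type _ := Homology A.δ

/-- The differential of the first page, induced by `d`. -/
def d₁ : A.E₁ →ₗ[R] A.E₁ :=
  Homology.map A.d (fun x hx => by rw [← A.d_δ, hx, map_zero]) fun x => ⟨A.d x, (A.d_δ x).symm⟩

/-- The sign involution of the first page. -/
def sign₁ : A.E₁ →ₗ[R] A.E₁ :=
  Homology.map A.ε₁ (fun x hx => by rw [A.δ_ε₁, hx, map_zero]) fun x => ⟨A.ε₁ x, A.δ_ε₁ x⟩

/-- The projections of the first page to its homogeneous parts. -/
def π₁ : ℤ × ℤ → A.E₁ →ₗ[R] A.E₁ :=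
  Homology.proj A.δ_π

/-- The second page, the homology of `d₁`. -/
abbrev E₂ : Type _ := Homology A.d₁

theorem d₁_mk (z : ↥(LinearMap.ker A.δ)) (h : A.δ (A.d z) = 0) :
    A.d₁ (Homology.mk A.δ z) = Homology.mk A.δ ⟨A.d z, h⟩ :=
  rfl

theorem π₁_mk (g : ℤ × ℤ) (z : ↥(LinearMap.ker A.δ)) (h : A.δ (A.π g z) = 0) :
    A.π₁ g (Homology.mk A.δ z) = Homology.mk A.δ ⟨A.π g z, h⟩ :=
  rfl

theorem d₁_d₁ (x : A.E₁) : A.d₁ (A.d₁ x) = 0 := by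
  obtain ⟨z, rfl⟩ := Homology.mk_surjective _ x
  exact (congrArg (Homology.mk A.δ) (Subtype.ext (A.d_d z))).trans (map_zero _)

theorem sign₁_sign₁ (x : A.E₁) : A.sign₁ (A.sign₁ x) = x := by
  obtain ⟨z, rfl⟩ := Homology.mk_surjective _ x
  exact congrArg (Homology.mk A.δ) (Subtype.ext (A.ε₁_ε₁ z))

theorem d₁_sign₁ (x : A.E₁) : A.d₁ (A.sign₁ x) = - A.sign₁ (A.d₁ x) := by
  obtain ⟨z, rfl⟩ := Homology.mk_surjective _ x
  exact (congrArg (Homology.mk A.δ) (Subtype.ext (A.d_ε₁ z))).trans (map_neg _ _)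

theorem d₁_π₁ (g : ℤ × ℤ) (x : A.E₁) : A.d₁ (A.π₁ g x) = A.π₁ (g + (-1, 0)) (A.d₁ x) := by
  obtain ⟨z, rfl⟩ := Homology.mk_surjective _ x
  exact congrArg (Homology.mk A.δ) (Subtype.ext (A.d_π g z))

theorem grading₁ : IsGrading A.π₁ :=
  A.grading.homology A.δ_π

/-- The projections of the second page to its homogeneous parts. -/
def π₂ : ℤ × ℤ → A.E₂ →ₗ[R] A.E₂ :=
  Homology.proj A.d₁_π₁

theorem grading₂ : IsGrading A.π₂ :=
  A.grading₁.homology A.d₁_π₁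

end Pages

/-! ### Künneth formulas for the pages of a tensor product of bicomplexes. -/

section Tensor

variable {R : Type*} [CommRing R] [IsDomain R] [IsPrincipalIdealRing R] {M X Y : Type*}
  [AddCommGroup M] [Module R M] [AddCommGroup X] [Module R X] [AddCommGroup Y] [Module R Y]
  [Module.Finite R M] [Module.Finite R X]

/-- The Künneth formula for the first page of a tensor product of bicomplexes. -/
theorem exists_equiv_E₁ (A : Bicomplex R M) (B : Bicomplex R X) (C : Bicomplex R Y)
    (J : M ⊗[R] X ≃ₗ[R] Y)
    (hδ : ∀ m x, C.δ (J (m ⊗ₜ x)) = J (A.δ m ⊗ₜ x) + J (A.ε₂ m ⊗ₜ B.δ x))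
    (hM : Module.IsTorsionFree R M)
    (h₁ : Module.IsTorsionFree R A.E₁ ∨ Module.IsTorsionFree R B.E₁) :
    ∃ K : A.E₁ ⊗[R] B.E₁ ≃ₗ[R] C.E₁, ∀ (z : M) (x : X) (hz : A.δ z = 0) (hx : B.δ x = 0)
      (h : C.δ (J (z ⊗ₜ x)) = 0),
      K (Homology.mk A.δ ⟨z, hz⟩ ⊗ₜ Homology.mk B.δ ⟨x, hx⟩) =
        Homology.mk C.δ ⟨J (z ⊗ₜ x), h⟩ := by
  have hJ : ∀ t, J ((TensorProduct.map A.δ (LinearMap.id : X →ₗ[R] X) + TensorProduct.map A.ε₂ B.δ) t) =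
      C.δ (J t) := by
    intro t
    induction t with
    | zero => simp
    | tmul m x => simp [hδ]
    | add t u ht hu => rw [map_add, map_add, map_add, map_add, ht, hu]
  -- The whole sign of the Leibniz rule sits on the left factor, so the right involution is the
  -- identity. `A.ε₂` anticommutes with δ, whence a = -1 and b = 1.
  obtain ⟨F, hF⟩ := kunneth (d := A.δ) (ε := A.ε₂) (e := B.δ) (ε' := LinearMap.id) (a := -1)
    (b := 1) A.δ_δ B.δ_δ A.ε₂_ε₂ (fun _ => rfl) (fun m => by rw [A.δ_ε₂, neg_one_smul])
    (fun x => by simp) (fun t => J.injective (by rw [hJ, hJ, C.δ_δ, map_zero])) (Or.inl hM) h₁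
  obtain ⟨G, hG⟩ := Homology.exists_equiv J hJ
  refine ⟨F ≪≫ₗ G, fun z x hz hx h => ?_⟩
  have h0 : (TensorProduct.map A.δ (LinearMap.id : X →ₗ[R] X) + TensorProduct.map A.ε₂ B.δ)
      (z ⊗ₜ x) = 0 := by
    simp [hz, hx]
  change G (F _) = _
  rw [hF z x hz hx h0]
  exact hG _ h0 _

set_option maxHeartbeats 800000 in
/-- The Künneth formula for the second page of a tensor product of bicomplexes. -/
theorem exists_equiv_of_tensor (A : Bicomplex R M) (B : Bicomplex R X) (C : Bicomplex R Y)
    (J : M ⊗[R] X ≃ₗ[R] Y)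
    (hδ : ∀ m x, C.δ (J (m ⊗ₜ x)) = J (A.δ m ⊗ₜ x) + J (A.ε₂ m ⊗ₜ B.δ x))
    (hd : ∀ m x, C.d (J (m ⊗ₜ x)) = J (A.d m ⊗ₜ x) + J (A.ε₁ m ⊗ₜ B.d x))
    (s : ℤ × ℤ) (hπ : ∀ g h m x, C.π (g + h + s) (J (A.π g m ⊗ₜ B.π h x)) =
      J (A.π g m ⊗ₜ B.π h x))
    (hM : Module.IsTorsionFree R M)
    (h₁ : Module.IsTorsionFree R A.E₁ ∨ Module.IsTorsionFree R B.E₁)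
    (h₂ : Module.IsTorsionFree R A.E₂ ∨ Module.IsTorsionFree R B.E₂) (k : ℤ × ℤ) :
    Nonempty (↥(LinearMap.range (C.π₂ (k + s))) ≃ₗ[R]
      ⨁ x : {x : (ℤ × ℤ) × (ℤ × ℤ) // x.1 + x.2 = k},
        ↥(LinearMap.range (A.π₂ x.1.1)) ⊗[R] ↥(LinearMap.range (B.π₂ x.1.2))) := by
  obtain ⟨K, hK'⟩ := exists_equiv_E₁ A B C J hδ hM h₁
  have hcyc : ∀ (z : M) (x : X), A.δ z = 0 → B.δ x = 0 → C.δ (J (z ⊗ₜ x)) = 0 := by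
    intro z x hz hx
    rw [hδ, hz, hx]
    simp
  have hK : ∀ (z : M) (x : X) (hz : A.δ z = 0) (hx : B.δ x = 0),
      K (Homology.mk A.δ ⟨z, hz⟩ ⊗ₜ Homology.mk B.δ ⟨x, hx⟩) =
        Homology.mk C.δ ⟨J (z ⊗ₜ x), hcyc z x hz hx⟩ := by
    exact fun z x hz hx => hK' z x hz hx _
  have hKd : ∀ t, K ((TensorProduct.map A.d₁ (LinearMap.id : B.E₁ →ₗ[R] B.E₁) + TensorProduct.map A.sign₁ B.d₁) t) =
      C.d₁ (K t) := by
    intro t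
    induction t with
    | zero => simp
    | add t u ht hu => rw [map_add, map_add, map_add, map_add, ht, hu]
    | tmul a b =>
      obtain ⟨⟨z, hz⟩, rfl⟩ := Homology.mk_surjective _ a
      obtain ⟨⟨x, hx⟩, rfl⟩ := Homology.mk_surjective _ b
      rw [LinearMap.mem_ker] at hz hx
      have hz1 : A.δ (A.d z) = 0 := by rw [← A.d_δ, hz, map_zero]
      have hz2 : A.δ (A.ε₁ z) = 0 := by rw [A.δ_ε₁, hz, map_zero]
      have hx1 : B.δ (B.d x) = 0 := by rw [← B.d_δ, hx, map_zero]
      have hy1 : C.δ (C.d (J (z ⊗ₜ x))) = 0 := by rw [← C.d_δ, hcyc z x hz hx, map_zero]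
      change K (Homology.mk A.δ ⟨A.d z, hz1⟩ ⊗ₜ Homology.mk B.δ ⟨x, hx⟩ +
        Homology.mk A.δ ⟨A.ε₁ z, hz2⟩ ⊗ₜ Homology.mk B.δ ⟨B.d x, hx1⟩) =
          C.d₁ (K (Homology.mk A.δ ⟨z, hz⟩ ⊗ₜ Homology.mk B.δ ⟨x, hx⟩))
      rw [map_add, hK, hK, hK, C.d₁_mk _ hy1, ← map_add]
      exact congrArg (Homology.mk C.δ) (Subtype.ext (hd z x).symm)
  -- The differential modules are now the first pages themselves: `h₁`, which excluded Tor before,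
  -- serves as torsion-freeness of a factor, and `h₂` excludes Tor.
  obtain ⟨F', hF'⟩ := kunneth (d := A.d₁) (ε := A.sign₁) (e := B.d₁) (ε' := LinearMap.id)
    (a := -1) (b := 1) A.d₁_d₁ B.d₁_d₁ A.sign₁_sign₁ (fun _ => rfl)
    (fun m => by rw [A.d₁_sign₁, neg_one_smul]) (fun x => by simp)
    (fun t => K.injective (by rw [hKd, hKd, C.d₁_d₁, map_zero])) h₁ h₂
  obtain ⟨G', hG'⟩ := Homology.exists_equiv K hKd
  refine A.grading₂.exists_equiv_directSum B.grading₂ C.grading₂ s (F' ≪≫ₗ G') ?_ k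
  intro g h a b
  obtain ⟨⟨a, ha⟩, rfl⟩ := Homology.mk_surjective _ a
  obtain ⟨⟨b, hb⟩, rfl⟩ := Homology.mk_surjective _ b
  rw [LinearMap.mem_ker] at ha hb
  have ha' : A.d₁ (A.π₁ g a) = 0 := by rw [A.d₁_π₁, ha, map_zero]
  have hb' : B.d₁ (B.π₁ h b) = 0 := by rw [B.d₁_π₁, hb, map_zero]
  have h0 : (TensorProduct.map A.d₁ (LinearMap.id : B.E₁ →ₗ[R] B.E₁) + TensorProduct.map A.sign₁ B.d₁)
      (A.π₁ g a ⊗ₜ B.π₁ h b) = 0 := by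
    rw [LinearMap.add_apply, TensorProduct.map_tmul, TensorProduct.map_tmul, ha', hb']
    simp
  have hy : C.d₁ (K (A.π₁ g a ⊗ₜ B.π₁ h b)) = 0 := by
    rw [← hKd, h0, map_zero]
  have hy' : C.d₁ (C.π₁ (g + h + s) (K (A.π₁ g a ⊗ₜ B.π₁ h b))) = 0 := by
    rw [C.d₁_π₁, hy, map_zero]
  rw [show A.π₂ g (Homology.mk A.d₁ ⟨a, ha⟩) = Homology.mk A.d₁ ⟨A.π₁ g a, ha'⟩ from rfl,
    show B.π₂ h (Homology.mk B.d₁ ⟨b, hb⟩) = Homology.mk B.d₁ ⟨B.π₁ h b, hb'⟩ from rfl,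
    LinearEquiv.trans_apply, hF' _ _ ha' hb' h0, hG' _ h0 hy]
  refine (Homology.proj_mk C.d₁_π₁ _ _ hy').trans (congrArg (Homology.mk C.d₁) (Subtype.ext ?_))
  obtain ⟨⟨z, hz⟩, rfl⟩ := Homology.mk_surjective _ a
  obtain ⟨⟨x, hx⟩, rfl⟩ := Homology.mk_surjective _ b
  rw [LinearMap.mem_ker] at hz hx
  have hz1 : A.δ (A.π g z) = 0 := by rw [A.δ_π, hz, map_zero]
  have hx1 : B.δ (B.π h x) = 0 := by rw [B.δ_π, hx, map_zero]
  have hy1 : C.δ (C.π (g + h + s) (J (A.π g z ⊗ₜ B.π h x))) = 0 := by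
    rw [C.δ_π, hcyc _ _ hz1 hx1, map_zero]
  change C.π₁ _ (K (A.π₁ g _ ⊗ₜ B.π₁ h _)) = K (A.π₁ g _ ⊗ₜ B.π₁ h _)
  rw [A.π₁_mk _ _ hz1, B.π₁_mk _ _ hx1]
  change C.π₁ _ (K (Homology.mk A.δ ⟨A.π g z, hz1⟩ ⊗ₜ Homology.mk B.δ ⟨B.π h x, hx1⟩)) =
    K (Homology.mk A.δ ⟨A.π g z, hz1⟩ ⊗ₜ Homology.mk B.δ ⟨B.π h x, hx1⟩)
  rw [hK, C.π₁_mk _ _ hy1]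
  exact congrArg (Homology.mk C.δ) (Subtype.ext (hπ g h z x))

end Tensor

end Bicomplex
namespace Bicomplex

/-! ### The filtered complex of a bicomplex and its first two pages. -/

section SpectralSequence

variable {R M : Type*} [CommRing R] [AddCommGroup M] [Module R M] (A : Bicomplex R M)

/-- The total differential. -/
def Δ : M →ₗ[R] M :=
  A.d + A.ε₁ ∘ₗ A.δ

/-- The filtration of the total complex by the first degree. -/
def F (p n : ℤ) : Submodule R M :=
  ⨅ (g : ℤ × ℤ) (_ : ¬ (g.1 ≤ p ∧ g.2 = g.1 + n)), LinearMap.ker (A.π g)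

/-- The cycles of the spectral sequence. -/
def Z (r p n : ℤ) : Submodule R M :=
  A.F p n ⊓ (A.F (p - r) (n + 1)).comap A.Δ

/-- The boundaries of the spectral sequence. -/
def B (r p n : ℤ) : Submodule R M :=
  A.Z (r - 1) (p - 1) n ⊔ (A.Z (r - 1) (p + r - 1) (n - 1)).map A.Δ

/-- The terms of the spectral sequence. -/
abbrev E (r p n : ℤ) : Type _ :=
  ↥(A.Z r p n) ⧸ (A.B r p n).submoduleOf (A.Z r p n)

variable {A}

theorem mem_F {p n : ℤ} {m : M} :
    m ∈ A.F p n ↔ ∀ a b, ¬ (a ≤ p ∧ b = a + n) → A.π (a, b) m = 0 := by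
  simp only [F, Submodule.mem_iInf, LinearMap.mem_ker, Prod.forall]

theorem mem_Z {r p n : ℤ} {m : M} : m ∈ A.Z r p n ↔ m ∈ A.F p n ∧ A.Δ m ∈ A.F (p - r) (n + 1) :=
  Iff.rfl

theorem Δ_apply (m : M) : A.Δ m = A.d m + A.ε₁ (A.δ m) := rfl

theorem Δ_Δ (m : M) : A.Δ (A.Δ m) = 0 := by
  simp only [Δ_apply, map_add, A.d_d, A.δ_ε₁, A.d_ε₁, A.δ_δ, A.d_δ, map_zero, add_zero, zero_add]
  exact add_neg_cancel _

theorem π_d (a b : ℤ) (m : M) : A.π (a, b) (A.d m) = A.d (A.π (a + 1, b) m) := by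
  rw [A.d_π]
  congr 2
  simp

theorem π_δ (a b : ℤ) (m : M) : A.π (a, b) (A.δ m) = A.δ (A.π (a, b - 1) m) := by
  rw [A.δ_π]
  congr 2
  simp

theorem π_Δ (a b : ℤ) (m : M) :
    A.π (a, b) (A.Δ m) = A.d (A.π (a + 1, b) m) + A.ε₁ (A.δ (A.π (a, b - 1) m)) := by
  rw [Δ_apply, map_add, π_d, ← A.ε₁_π, π_δ]

theorem ε₁_eq_zero {m : M} : A.ε₁ m = 0 ↔ m = 0 :=
  ⟨fun h => by rw [← A.ε₁_ε₁ m, h, map_zero], fun h => by rw [h, map_zero]⟩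

theorem π_mem_F {p n a b : ℤ} (ha : a ≤ p) (hb : b = a + n) (m : M) : A.π (a, b) m ∈ A.F p n :=
  mem_F.2 fun c e h => A.grading.orth _ _ _ fun h' => h (by
    rw [Prod.mk.injEq] at h'
    omega)

theorem d_mem_F {p n : ℤ} {m : M} (hm : m ∈ A.F p n) : A.d m ∈ A.F (p - 1) (n + 1) :=
  mem_F.2 fun a b h => by rw [π_d, mem_F.1 hm _ _ (by omega), map_zero]

theorem δ_mem_F {p n : ℤ} {m : M} (hm : m ∈ A.F p n) : A.δ m ∈ A.F p (n + 1) :=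
  mem_F.2 fun a b h => by rw [π_δ, mem_F.1 hm _ _ (by omega), map_zero]

theorem ε₁_mem_F {p n : ℤ} {m : M} (hm : m ∈ A.F p n) : A.ε₁ m ∈ A.F p n :=
  mem_F.2 fun a b h => by rw [← A.ε₁_π, mem_F.1 hm _ _ h, map_zero]

theorem F_mono {p p' n : ℤ} (h : p ≤ p') : A.F p n ≤ A.F p' n := fun _ hm =>
  mem_F.2 fun a b hab => mem_F.1 hm a b (by omega)

theorem Δ_mem_F {p n : ℤ} {m : M} (hm : m ∈ A.F p n) : A.Δ m ∈ A.F p (n + 1) :=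
  Submodule.add_mem _ (F_mono (by omega) (d_mem_F hm)) (ε₁_mem_F (δ_mem_F hm))

theorem mem_F_sub_one {p n : ℤ} {m : M} (hm : m ∈ A.F p n) (h : A.π (p, p + n) m = 0) :
    m ∈ A.F (p - 1) n :=
  mem_F.2 fun a b hab => by
    by_cases hp : a = p ∧ b = p + n
    · rw [hp.1, hp.2, h]
    · exact mem_F.1 hm a b (by omega)

/-- For r ≥ 1 the part of Δ m in filtration degree p must vanish. No component of m in degree p + 1
contributes through d, so this part is ε₁ δ of the leading term. -/
theorem δ_π_eq_zero_of_mem_Z {r p n : ℤ} (hr : 1 ≤ r) {m : M} (hm : m ∈ A.Z r p n) :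
    A.δ (A.π (p, p + n) m) = 0 := by
  have h1 := mem_F.1 hm.2 p (p + n + 1) (by omega)
  rw [π_Δ, mem_F.1 hm.1 (p + 1) _ (by omega), map_zero, zero_add, ε₁_eq_zero,
    add_sub_cancel_right] at h1
  exact h1

variable (A)

/-- The leading term of a cycle, as a class of the first page. -/
def leading₁ (r p n : ℤ) (hr : 1 ≤ r) : ↥(A.Z r p n) →ₗ[R] A.E₁ :=
  Homology.mk A.δ ∘ₗ (A.π (p, p + n) ∘ₗ (A.Z r p n).subtype).codRestrict _ fun m =>
    LinearMap.mem_ker.2 (δ_π_eq_zero_of_mem_Z hr m.2)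

variable {A}

theorem leading₁_eq_zero {r p n : ℤ} (hr : 1 ≤ r) (x : ↥(A.Z r p n)) :
    A.leading₁ r p n hr x = 0 ↔ ∃ y, A.δ y = A.π (p, p + n) x :=
  Homology.mk_eq_zero

/-- For r = 2 the part of Δ x in filtration degree p - 1 vanishes as well, which reads d x_p = -ε₁ δ
x_{p-1}. So d x_p is a δ-boundary, with the primitive used below. -/
theorem d₁_leading₁ {p n : ℤ} (x : ↥(A.Z 2 p n)) : A.d₁ (A.leading₁ 2 p n one_le_two x) = 0 := by
  refine Homology.mk_eq_zero.2 ⟨- A.ε₁ (A.π (p - 1, p + n - 1) x), ?_⟩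
  have h1 := mem_F.1 x.2.2 (p - 1) (p + n) (by omega)
  rw [π_Δ, sub_add_cancel] at h1
  change _ = A.d (A.π (p, p + n) x)
  rw [map_neg, A.δ_ε₁]
  exact (eq_neg_of_add_eq_zero_left h1).symm

/-- The first page of the spectral sequence is the homology of `δ`. -/
theorem exists_equiv_π₁ (p n : ℤ) :
    Nonempty (A.E 1 p n ≃ₗ[R]
      ↥(LinearMap.range (A.π₁ (p, p + n)))) := by
  have hker : LinearMap.ker (A.leading₁ 1 p n le_rfl) = (A.B 1 p n).submoduleOf (A.Z 1 p n) := by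
    ext x
    rw [LinearMap.mem_ker, leading₁_eq_zero]
    constructor
    · rintro ⟨v, hv⟩
      have hv' : A.δ (A.π (p, p + n - 1) v) = A.π (p, p + n) x := by
        rw [← π_δ, hv, A.grading.proj]
      -- Inserting ε₁ cancels the sign in Δ = d + ε₁ δ: the part of Δ (ε₁ v) in degree p is δ v.
      -- Subtracting this boundary from x removes its leading term.
      have hz : A.ε₁ (A.π (p, p + n - 1) v) ∈ A.F p (n - 1) :=
        ε₁_mem_F (π_mem_F le_rfl (by omega) _)
      have hΔ := Δ_mem_F hz
      have hΔπ : A.π (p, p + n) (A.Δ (A.ε₁ (A.π (p, p + n - 1) v))) = A.π (p, p + n) x := by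
        rw [π_Δ, mem_F.1 hz _ _ (by omega), map_zero, zero_add, ← A.ε₁_π, A.δ_ε₁, A.ε₁_ε₁,
          A.grading.proj, hv']
      rw [sub_add_cancel] at hΔ
      refine Submodule.mem_sup.2 ⟨x - A.Δ (A.ε₁ (A.π (p, p + n - 1) v)), ?_, _,
        ⟨A.ε₁ (A.π (p, p + n - 1) v), ?_, rfl⟩, sub_add_cancel _ _⟩
      · refine mem_Z.2 ⟨mem_F_sub_one (Submodule.sub_mem _ x.2.1 hΔ) ?_, ?_⟩
        · rw [map_sub, hΔπ, sub_self]
        · rw [map_sub, Δ_Δ, sub_zero, sub_self, sub_zero]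
          exact x.2.2
      · refine mem_Z.2 ⟨by rwa [add_sub_cancel_right], ?_⟩
        rw [add_sub_cancel_right, sub_self, sub_zero, sub_add_cancel]
        exact hΔ
    · intro hx
      obtain ⟨y, hy, _, ⟨z, hz, rfl⟩, hyz⟩ := Submodule.mem_sup.1 hx
      rw [add_sub_cancel_right] at hz
      refine ⟨A.ε₁ (A.π (p, p + n - 1) z), ?_⟩
      change y + A.Δ z = x at hyz
      rw [← hyz, map_add, mem_F.1 hy.1 p (p + n) (by omega), π_Δ,
        mem_F.1 hz.1 (p + 1) (p + n) (by omega), map_zero, zero_add, zero_add, A.δ_ε₁]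
  have hrange : LinearMap.range (A.leading₁ 1 p n le_rfl) = LinearMap.range (A.π₁ (p, p + n)) := by
    apply le_antisymm
    · rintro _ ⟨x, rfl⟩
      refine ⟨A.leading₁ 1 p n le_rfl x, ?_⟩
      exact congrArg (Homology.mk A.δ) (Subtype.ext (A.grading.proj _ _))
    · rintro _ ⟨e, rfl⟩
      obtain ⟨⟨z, hz⟩, rfl⟩ := Homology.mk_surjective _ e
      rw [LinearMap.mem_ker] at hz
      have h1 : A.π (p, p + n) z ∈ A.F p n := π_mem_F le_rfl rfl z
      refine ⟨⟨A.π (p, p + n) z, mem_Z.2 ⟨h1, ?_⟩⟩, ?_⟩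
      · rw [Δ_apply, A.δ_π, hz, map_zero, map_zero, add_zero]
        exact d_mem_F h1
      · exact congrArg (Homology.mk A.δ) (Subtype.ext (A.grading.proj _ _))
  exact ⟨Submodule.quotEquivOfEq _ _ hker.symm ≪≫ₗ (A.leading₁ 1 p n le_rfl).quotKerEquivRange ≪≫ₗ
    LinearEquiv.ofEq _ _ hrange⟩

variable (A)

/-- The leading term of a cycle, as a class of the second page. -/
def leading₂ (p n : ℤ) : ↥(A.Z 2 p n) →ₗ[R] A.E₂ :=
  Homology.mk A.d₁ ∘ₗ (A.leading₁ 2 p n one_le_two).codRestrict _ fun m =>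
    LinearMap.mem_ker.2 (d₁_leading₁ m)

variable {A}

/-- The second page of the spectral sequence is the homology of `d₁`. -/
theorem exists_equiv_π₂ (p n : ℤ) :
    Nonempty (A.E 2 p n ≃ₗ[R]
      ↥(LinearMap.range (A.π₂ (p, p + n)))) := by
  have hker : LinearMap.ker (A.leading₂ p n) = (A.B 2 p n).submoduleOf (A.Z 2 p n) := by
    ext x
    rw [LinearMap.mem_ker]
    refine Homology.mk_eq_zero.trans ?_
    constructor
    · rintro ⟨e, he⟩
      obtain ⟨⟨u, hu⟩, rfl⟩ := Homology.mk_surjective _ e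
      rw [LinearMap.mem_ker] at hu
      have hdu : A.δ (A.d u) = 0 := by rw [← A.d_δ, hu, map_zero]
      have he : A.d₁ (Homology.mk A.δ ⟨u, hu⟩) = A.leading₁ 2 p n one_le_two x := he
      rw [A.d₁_mk _ hdu, eq_comm, ← sub_eq_zero] at he
      obtain ⟨v, hv⟩ := Homology.mk_eq_zero.1 ((map_sub (Homology.mk A.δ) _ _).trans he)
      have hv : A.δ v = A.π (p, p + n) x - A.d u := hv
      have hv' : A.d (A.π (p + 1, p + n) u) + A.δ (A.π (p, p + n - 1) v) = A.π (p, p + n) x := by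
        rw [← π_δ, ← π_d, hv, map_sub, A.grading.proj, add_sub_cancel]
      have hu' : A.δ (A.π (p + 1, p + n) u) = 0 := by rw [A.δ_π, hu, map_zero]
      -- The leading term of x is d u + δ v on homogeneous parts. Δ z equals it up to d (ε₁ v),
      -- which lies one filtration step lower, so x - Δ z has no leading term.
      set z := A.π (p + 1, p + n) u + A.ε₁ (A.π (p, p + n - 1) v) with hz
      have hzF : z ∈ A.F (p + 1) (n - 1) :=
        Submodule.add_mem _ (π_mem_F le_rfl (by omega) _)
          (ε₁_mem_F (π_mem_F (by omega) (by omega) _))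
      have hΔz : A.Δ z = A.π (p, p + n) x + A.d (A.ε₁ (A.π (p, p + n - 1) v)) := by
        rw [Δ_apply, hz, map_add, map_add, hu', zero_add, A.δ_ε₁, A.ε₁_ε₁, ← hv']
        abel
      have hw : A.d (A.ε₁ (A.π (p, p + n - 1) v)) ∈ A.F (p - 1) n := by
        have h1 : A.ε₁ (A.π (p, p + n - 1) v) ∈ A.F p (n - 1) :=
          ε₁_mem_F (π_mem_F le_rfl (by omega) _)
        have h2 := d_mem_F h1
        rwa [sub_add_cancel] at h2
      have hΔ : A.Δ z ∈ A.F p n := by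
        rw [hΔz]
        exact Submodule.add_mem _ (π_mem_F le_rfl rfl _) (F_mono (by omega) hw)
      refine Submodule.mem_sup.2 ⟨x - A.Δ z, mem_Z.2 ⟨?_, ?_⟩, _, ⟨z, mem_Z.2 ⟨?_, ?_⟩, rfl⟩,
        sub_add_cancel _ _⟩
      · refine mem_F_sub_one (Submodule.sub_mem _ x.2.1 hΔ) ?_
        rw [hΔz, map_sub, map_add, A.grading.proj, mem_F.1 hw _ _ (by omega), add_zero, sub_self]
      · rw [map_sub, Δ_Δ, sub_zero]
        have h1 : p - 1 - (2 - 1) = p - 2 := by ring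
        rw [h1]
        exact x.2.2
      · have h1 : p + 2 - 1 = p + 1 := by ring
        rwa [h1]
      · have h1 : p + 2 - 1 - (2 - 1) = p := by ring
        rwa [h1, sub_add_cancel]
    · intro hx
      obtain ⟨y, hy, _, ⟨z, hz, rfl⟩, hyz⟩ := Submodule.mem_sup.1 hx
      have h1 : p + 2 - 1 = p + 1 := by ring
      rw [h1] at hz
      change y + A.Δ z = x at hyz
      have hδ : A.δ (A.π (p + 1, p + n) z) = 0 := by
        have h2 := δ_π_eq_zero_of_mem_Z (by norm_num) hz
        rwa [show p + 1 + (n - 1) = p + n by ring] at h2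
      have hdδ : A.δ (A.d (A.π (p + 1, p + n) z)) = 0 := by rw [← A.d_δ, hδ, map_zero]
      refine ⟨Homology.mk A.δ ⟨_, hδ⟩, ?_⟩
      rw [A.d₁_mk _ hdδ]
      refine Eq.symm (sub_eq_zero.1 ((map_sub (Homology.mk A.δ) _ _).symm.trans ?_))
      -- In filtration degree p the equation x = y + Δ z reads x_p = d z_{p+1} + ε₁ δ z_p, as y lies
      -- in filtration p - 1.
      refine Homology.mk_eq_zero.2 ⟨A.ε₁ (A.π (p, p + n - 1) z), ?_⟩
      change _ = A.π (p, p + n) x - A.d (A.π (p + 1, p + n) z)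
      rw [← hyz, map_add, mem_F.1 hy.1 p _ (by omega), π_Δ, zero_add, add_sub_cancel_left, A.δ_ε₁]
  have hrange : LinearMap.range (A.leading₂ p n) = LinearMap.range (A.π₂ (p, p + n)) := by
    apply le_antisymm
    · rintro _ ⟨x, rfl⟩
      refine ⟨A.leading₂ p n x, ?_⟩
      exact congrArg (Homology.mk A.d₁) (Subtype.ext
        (congrArg (Homology.mk A.δ) (Subtype.ext (A.grading.proj _ _))))
    · rintro _ ⟨e, rfl⟩
      obtain ⟨⟨e, he⟩, rfl⟩ := Homology.mk_surjective _ e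
      obtain ⟨⟨z, hz⟩, rfl⟩ := Homology.mk_surjective _ e
      rw [LinearMap.mem_ker] at hz he
      have hdz : A.δ (A.d z) = 0 := by rw [← A.d_δ, hz, map_zero]
      obtain ⟨y, hy⟩ := Homology.mk_eq_zero.1 ((A.d₁_mk _ hdz).symm.trans he)
      have hy : A.δ y = A.d z := hy
      -- A class killed by `d₁` satisfies d z = δ y. The correction c, in filtration p - 1, makes ε₁
      -- δ c cancel d z_p, so that only d c in filtration p - 2 remains of Δ.
      set c := - A.ε₁ (A.π (p - 1, p + n - 1) y) with hc
      have hcF : c ∈ A.F (p - 1) n := Submodule.neg_mem _ (ε₁_mem_F (π_mem_F le_rfl (by omega) _))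
      have haF : A.π (p, p + n) z ∈ A.F p n := π_mem_F le_rfl rfl z
      have hΔ : A.Δ (A.π (p, p + n) z + c) = A.d c := by
        have h1 : A.δ (A.π (p, p + n) z) = 0 := by rw [A.δ_π, hz, map_zero]
        have h2 : A.d (A.π (p, p + n) z) = A.δ (A.π (p - 1, p + n - 1) y) := by
          rw [← π_δ, hy, π_d, sub_add_cancel]
        have h3 : A.ε₁ (A.δ c) = - A.δ (A.π (p - 1, p + n - 1) y) := by
          rw [hc, map_neg, map_neg, A.δ_ε₁, A.ε₁_ε₁]
        rw [Δ_apply, map_add, map_add, map_add, h1, h2, h3, map_zero]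
        abel
      refine ⟨⟨A.π (p, p + n) z + c, mem_Z.2
        ⟨Submodule.add_mem _ haF (F_mono (by omega) hcF), ?_⟩⟩, ?_⟩
      · rw [hΔ]
        have h1 := d_mem_F hcF
        rwa [sub_sub, one_add_one_eq_two] at h1
      · refine congrArg (Homology.mk A.d₁) (Subtype.ext
          (congrArg (Homology.mk A.δ) (Subtype.ext ?_)))
        change A.π (p, p + n) (A.π (p, p + n) z + c) = A.π (p, p + n) z
        rw [map_add, A.grading.proj, mem_F.1 hcF _ _ (by omega), add_zero]
  exact ⟨Submodule.quotEquivOfEq _ _ hker.symm ≪≫ₗ (A.leading₂ p n).quotKerEquivRange ≪≫ₗ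
    LinearEquiv.ofEq _ _ hrange⟩

end SpectralSequence

end Bicomplex

/-! ### Relations between boundary, coboundary, sign and length projections. -/

section ChainOperators

theorem length_eraseIdx_of_mem_range {X : Type*} {l : List X} {i : ℕ} (hi : i ∈ Finset.range l.length) :
    ((l.eraseIdx i).length : ℤ) = l.length - 1 := by
  have h := Finset.mem_range.1 hi
  rw [List.length_eraseIdx, if_pos h]
  omega

variable {V : Type*} [DecidableEq V] {Φ : Set (Finset V)}

theorem signOp_signOp (x : Chain Φ) : signOp Φ (signOp Φ x) = x :=
  LinearMap.congr_fun (f := signOp Φ ∘ₗ signOp Φ) (g := LinearMap.id)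
    (chain_linearMap_ext fun l _ => by
      rw [LinearMap.comp_apply, signOp_chain, map_smul, signOp_chain, smul_smul, ← mul_pow]
      simp) x

theorem map_boundary_chain {T : Type*} [AddCommGroup T] (f : Chain Φ →ₗ[ℤ] T) {l : List V}
    (hl : IsChainSimplex Φ l) :
    f (boundary Φ (chain Φ l)) = faceSum (fun m => f (chain Φ m)) l := by
  rw [boundary_chain hl]
  exact map_faceSum f.toAddMonoidHom _ _

theorem boundary_signOp (x : Chain Φ) : boundary Φ (signOp Φ x) = - signOp Φ (boundary Φ x) :=
  LinearMap.congr_fun (f := boundary Φ ∘ₗ signOp Φ) (g := - (signOp Φ ∘ₗ boundary Φ))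
    (chain_linearMap_ext fun l hl => by
      rw [LinearMap.neg_apply, LinearMap.comp_apply, LinearMap.comp_apply, signOp_chain, map_smul,
        map_boundary_chain _ hl, boundary_chain hl, faceSum, faceSum, Finset.smul_sum,
        ← Finset.sum_neg_distrib]
      refine Finset.sum_congr rfl fun i hi => ?_
      have h := Finset.mem_range.1 hi
      have h1 : (-1 : ℤ) ^ l.length = - (-1) ^ (l.eraseIdx i).length := by
        rw [List.length_eraseIdx, if_pos h, ← Nat.sub_add_cancel (Nat.one_le_of_lt h), pow_succ]
        simp
      rw [signOp_chain, h1, smul_comm, neg_smul, smul_neg]) x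

theorem coboundary_signOp [Fintype V] (hΦ : IsLowerSet Φ) (x : Chain Φ) :
    coboundary Φ (signOp Φ x) = - signOp Φ (coboundary Φ x) :=
  LinearMap.congr_fun (f := coboundary Φ ∘ₗ signOp Φ) (g := - (signOp Φ ∘ₗ coboundary Φ))
    (chain_linearMap_ext fun l hl => by
      rw [LinearMap.neg_apply, LinearMap.comp_apply, LinearMap.comp_apply, signOp_chain, map_smul,
        coboundary_chain hΦ, map_sum, Finset.smul_sum, ← Finset.sum_neg_distrib]
      refine Finset.sum_congr rfl fun v _ => ?_
      rw [signOp_chain, List.length_cons, pow_succ, mul_neg, mul_one, neg_smul, neg_neg]) x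

theorem boundary_lengthProj (k : ℤ) (x : Chain Φ) :
    boundary Φ (lengthProj Φ k x) = lengthProj Φ (k - 1) (boundary Φ x) :=
  LinearMap.congr_fun (f := boundary Φ ∘ₗ lengthProj Φ k)
    (g := lengthProj Φ (k - 1) ∘ₗ boundary Φ)
    (chain_linearMap_ext fun l hl => by
      rw [LinearMap.comp_apply, LinearMap.comp_apply, lengthProj_chain, map_boundary_chain _ hl]
      split_ifs with hk
      · rw [boundary_chain hl]
        refine Finset.sum_congr rfl fun i hi => ?_
        dsimp only
        rw [lengthProj_chain, length_eraseIdx_of_mem_range hi, hk, if_pos rfl]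
      · rw [map_zero, eq_comm]
        refine Finset.sum_eq_zero fun i hi => ?_
        dsimp only
        rw [lengthProj_chain, length_eraseIdx_of_mem_range hi, if_neg (by omega), smul_zero]) x

theorem coboundary_lengthProj [Fintype V] (hΦ : IsLowerSet Φ) (k : ℤ) (x : Chain Φ) :
    coboundary Φ (lengthProj Φ k x) = lengthProj Φ (k + 1) (coboundary Φ x) :=
  LinearMap.congr_fun (f := coboundary Φ ∘ₗ lengthProj Φ k)
    (g := lengthProj Φ (k + 1) ∘ₗ coboundary Φ)
    (chain_linearMap_ext fun l hl => by
      rw [LinearMap.comp_apply, LinearMap.comp_apply, lengthProj_chain, coboundary_chain hΦ,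
        map_sum]
      simp only [lengthProj_chain, List.length_cons, Nat.cast_succ, add_left_inj]
      split_ifs with hk
      · rw [coboundary_chain hΦ]
      · rw [map_zero, Finset.sum_const_zero]) x

theorem signOp_lengthProj (k : ℤ) (x : Chain Φ) :
    signOp Φ (lengthProj Φ k x) = lengthProj Φ k (signOp Φ x) :=
  LinearMap.congr_fun (f := signOp Φ ∘ₗ lengthProj Φ k) (g := lengthProj Φ k ∘ₗ signOp Φ)
    (chain_linearMap_ext fun l hl => by
      rw [LinearMap.comp_apply, LinearMap.comp_apply, lengthProj_chain, signOp_chain, map_smul,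
        lengthProj_chain]
      split_ifs
      · rw [signOp_chain]
      · rw [map_zero, smul_zero]) x

/-- A sequence without repetition has at most |V| entries, so finitely many lengths suffice. -/
theorem sum_lengthProj [Fintype V] (x : Chain Φ) :
    ∑ k ∈ Finset.range (Fintype.card V + 1), lengthProj Φ k x = x := by
  have h : ∑ k ∈ Finset.range (Fintype.card V + 1), lengthProj Φ k = LinearMap.id :=
    chain_linearMap_ext fun l hl => by
      rw [LinearMap.sum_apply]
      simp only [lengthProj_chain, Nat.cast_inj, LinearMap.id_apply]
      rw [Finset.sum_ite_eq, if_pos]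
      exact Finset.mem_range.2 (Nat.lt_succ_of_le hl.1.length_le_card)
  have h1 := LinearMap.congr_fun h x
  rwa [LinearMap.sum_apply] at h1

end ChainOperators

/-! ### The bicomplex N of a set of simplices. -/

section ConcreteBicomplex

variable {V : Type*} [DecidableEq V] {Φ : Set (Finset V)}

theorem map_mem_Ntot {f g : Chain Φ →ₗ[ℤ] Chain Φ}
    (h : ∀ σ τ, IsChainSimplex Φ σ → IsChainSimplex Φ τ → σ ⊆ τ →
      f (chain Φ σ) ⊗ₜ[ℤ] g (chain Φ τ) ∈ Ntot Φ) :
    ∀ x ∈ Ntot Φ, TensorProduct.map f g x ∈ Ntot Φ := by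
  intro x hx
  have hle : Ntot Φ ≤ (Ntot Φ).comap (TensorProduct.map f g) := by
    refine Submodule.span_le.2 ?_
    rintro _ ⟨σ, τ, hσ, hτ, hστ, rfl⟩
    exact h σ τ hσ hτ hστ
  exact hle hx

theorem tmul_mem_Ntot {σ τ : List V} (hτ : IsChainSimplex Φ τ) (h : σ ⊆ τ) :
    chain Φ σ ⊗ₜ[ℤ] chain Φ τ ∈ Ntot Φ := by
  by_cases hσ : IsChainSimplex Φ σ
  · exact Submodule.subset_span ⟨σ, τ, hσ, hτ, h, rfl⟩
  · rw [chain_eq_zero hσ, TensorProduct.zero_tmul]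
    exact Submodule.zero_mem _

theorem boundary_mem_Ntot : ∀ x ∈ Ntot Φ,
    TensorProduct.map (boundary Φ) LinearMap.id x ∈ Ntot Φ :=
  map_mem_Ntot fun σ τ hσ hτ h => by
    rw [boundary_chain hσ, faceSum, TensorProduct.sum_tmul]
    refine Submodule.sum_mem _ fun i _ => ?_
    rw [← TensorProduct.smul_tmul']
    exact Submodule.smul_mem _ _ (tmul_mem_Ntot hτ fun x hx =>
      h ((List.eraseIdx_sublist σ i).subset hx))

theorem coboundary_mem_Ntot [Fintype V] : ∀ x ∈ Ntot Φ,
    TensorProduct.map LinearMap.id (coboundary Φ) x ∈ Ntot Φ :=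
  map_mem_Ntot fun σ τ hσ hτ h => by
    have h1 : coboundary Φ (chain Φ τ) = ∑ v : V, chain Φ (v :: τ) := chainLift_chain _ _ _ hτ
    rw [h1, TensorProduct.tmul_sum]
    refine Submodule.sum_mem _ fun v _ => ?_
    by_cases hv : IsChainSimplex Φ (v :: τ)
    · exact tmul_mem_Ntot hv (List.subset_cons_of_subset v h)
    · rw [chain_eq_zero hv, TensorProduct.tmul_zero]
      exact Submodule.zero_mem _

theorem signOp_left_mem_Ntot : ∀ x ∈ Ntot Φ,
    TensorProduct.map (signOp Φ) LinearMap.id x ∈ Ntot Φ :=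
  map_mem_Ntot fun σ τ hσ hτ h => by
    rw [signOp_chain, ← TensorProduct.smul_tmul']
    exact Submodule.smul_mem _ _ (tmul_mem_Ntot hτ h)

theorem signOp_right_mem_Ntot : ∀ x ∈ Ntot Φ,
    TensorProduct.map LinearMap.id (signOp Φ) x ∈ Ntot Φ :=
  map_mem_Ntot fun σ τ hσ hτ h => by
    rw [signOp_chain, TensorProduct.tmul_smul]
    exact Submodule.smul_mem _ _ (tmul_mem_Ntot hτ h)

theorem lengthProj_mem_N (p q : ℤ) : ∀ x ∈ Ntot Φ,
    TensorProduct.map (lengthProj Φ (p + 1)) (lengthProj Φ (q + 1)) x ∈ N Φ p q := by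
  intro x hx
  have hle : Ntot Φ ≤ (N Φ p q).comap
      (TensorProduct.map (lengthProj Φ (p + 1)) (lengthProj Φ (q + 1))) := by
    refine Submodule.span_le.2 ?_
    rintro _ ⟨σ, τ, hσ, hτ, hστ, rfl⟩
    change lengthProj Φ (p + 1) (chain Φ σ) ⊗ₜ[ℤ] lengthProj Φ (q + 1) (chain Φ τ) ∈ N Φ p q
    rw [lengthProj_chain, lengthProj_chain]
    split_ifs with h1 h2
    · exact Submodule.subset_span ⟨σ, τ, hσ, hτ, hστ, by omega, by omega, rfl⟩
    · rw [TensorProduct.tmul_zero]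
      exact Submodule.zero_mem _
    · rw [TensorProduct.zero_tmul]
      exact Submodule.zero_mem _
    · rw [TensorProduct.zero_tmul]
      exact Submodule.zero_mem _
  exact hle hx

theorem lengthProj_of_mem_N {p q : ℤ} (a b : ℤ) {x : Chain Φ ⊗[ℤ] Chain Φ} (hx : x ∈ N Φ p q) :
    TensorProduct.map (lengthProj Φ (a + 1)) (lengthProj Φ (b + 1)) x =
      if a = p ∧ b = q then x else 0 := by
  induction hx using Submodule.span_induction with
  | mem x hx =>
    obtain ⟨σ, τ, hσ, hτ, hστ, hp, hq, rfl⟩ := hx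
    rw [TensorProduct.map_tmul, lengthProj_chain, lengthProj_chain]
    split_ifs <;> first | omega | simp
  | zero => rw [map_zero, ite_self]
  | add x y _ _ hx hy =>
    rw [map_add, hx, hy]
    split_ifs <;> simp
  | smul n x _ hx =>
    rw [map_smul, hx]
    split_ifs <;> simp

theorem tensor_operator_ext {f f' g g' : Chain Φ →ₗ[ℤ] Chain Φ} (hf : ∀ x, f x = f' x)
    (hg : ∀ x, g x = g' x) (x : Chain Φ ⊗[ℤ] Chain Φ) :
    TensorProduct.map f g x = TensorProduct.map f' g' x := by
  rw [LinearMap.ext hf, LinearMap.ext hg]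

/-- The bicomplex `N` of a set of simplices. -/
noncomputable def bicomplex [Fintype V] (hΦ : IsLowerSet Φ) : Bicomplex ℤ ↥(Ntot Φ) where
  d := (TensorProduct.map (boundary Φ) LinearMap.id).restrict boundary_mem_Ntot
  δ := (TensorProduct.map LinearMap.id (coboundary Φ)).restrict coboundary_mem_Ntot
  ε₁ := (TensorProduct.map (signOp Φ) LinearMap.id).restrict signOp_left_mem_Ntot
  ε₂ := (TensorProduct.map LinearMap.id (signOp Φ)).restrict signOp_right_mem_Ntot
  -- A simplex of dimension p has p + 1 vertices.
  π g := (TensorProduct.map (lengthProj Φ (g.1 + 1)) (lengthProj Φ (g.2 + 1))).restrict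
    fun x hx => N_le_Ntot Φ _ _ (lengthProj_mem_N g.1 g.2 x hx)
  d_d := by
    rintro ⟨x, hx⟩
    refine Subtype.ext ((tensor_map_map _ _ _ _ x).trans ?_)
    rw [LinearMap.ext (f := boundary Φ ∘ₗ boundary Φ) (g := 0) (boundary_boundary hΦ)]
    exact LinearMap.congr_fun (TensorProduct.map_zero_left _) x
  δ_δ := by
    rintro ⟨x, hx⟩
    refine Subtype.ext ((tensor_map_map _ _ _ _ x).trans ?_)
    rw [LinearMap.ext (f := coboundary Φ ∘ₗ coboundary Φ) (g := 0) (coboundary_coboundary hΦ)]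
    exact LinearMap.congr_fun (TensorProduct.map_zero_right _) x
  d_δ := by
    rintro ⟨x, hx⟩
    refine Subtype.ext ((tensor_map_map _ _ _ _ x).trans
      (Eq.trans ?_ (tensor_map_map _ _ _ _ x).symm))
    rfl
  ε₁_ε₁ := by
    rintro ⟨x, hx⟩
    refine Subtype.ext ((tensor_map_map _ _ _ _ x).trans ?_)
    rw [LinearMap.ext (f := signOp Φ ∘ₗ signOp Φ) (g := LinearMap.id) signOp_signOp]
    exact LinearMap.congr_fun TensorProduct.map_id x
  ε₂_ε₂ := by
    rintro ⟨x, hx⟩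
    refine Subtype.ext ((tensor_map_map _ _ _ _ x).trans ?_)
    rw [LinearMap.ext (f := signOp Φ ∘ₗ signOp Φ) (g := LinearMap.id) signOp_signOp]
    exact LinearMap.congr_fun TensorProduct.map_id x
  d_ε₁ := by
    rintro ⟨x, hx⟩
    refine Subtype.ext ((tensor_map_map _ _ _ _ x).trans ?_)
    rw [LinearMap.ext (f := boundary Φ ∘ₗ signOp Φ) (g := (-1 : ℤ) • (signOp Φ ∘ₗ boundary Φ))
      fun x => by rw [LinearMap.smul_apply, neg_one_smul]; exact boundary_signOp x,
      TensorProduct.map_smul_left, LinearMap.smul_apply, neg_one_smul]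
    exact congrArg Neg.neg (tensor_map_map _ _ _ _ x).symm
  δ_ε₁ := by
    rintro ⟨x, hx⟩
    refine Subtype.ext ((tensor_map_map _ _ _ _ x).trans
      (Eq.trans ?_ (tensor_map_map _ _ _ _ x).symm))
    rfl
  δ_ε₂ := by
    rintro ⟨x, hx⟩
    refine Subtype.ext ((tensor_map_map _ _ _ _ x).trans ?_)
    rw [LinearMap.ext (f := coboundary Φ ∘ₗ signOp Φ) (g := (-1 : ℤ) • (signOp Φ ∘ₗ coboundary Φ))
      fun x => by rw [LinearMap.smul_apply, neg_one_smul]; exact coboundary_signOp hΦ x,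
      TensorProduct.map_smul_right, LinearMap.smul_apply, neg_one_smul]
    exact congrArg Neg.neg (tensor_map_map _ _ _ _ x).symm
  grading := {
    proj := by
      rintro g ⟨x, hx⟩
      refine Subtype.ext ((lengthProj_of_mem_N _ _ (lengthProj_mem_N g.1 g.2 x hx)).trans ?_)
      exact if_pos ⟨rfl, rfl⟩
    orth := by
      rintro g h ⟨x, hx⟩ hgh
      refine Subtype.ext ((lengthProj_of_mem_N _ _ (lengthProj_mem_N h.1 h.2 x hx)).trans ?_)
      exact if_neg fun h => hgh (Prod.ext h.1 h.2)
    sum := by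
      -- Lengths 0, …, |V| correspond to dimensions -1, …, |V| - 1; the first one is the empty
      -- simplex.
      let T : Finset ℤ := (Finset.range (Fintype.card V + 1)).map
        ⟨fun k : ℕ => (k : ℤ) - 1, fun a b h => by simpa using h⟩
      have hT : ∀ x : Chain Φ, ∑ k ∈ T, lengthProj Φ (k + 1) x = x := fun x => by
        rw [Finset.sum_map]
        exact (Finset.sum_congr rfl fun k _ =>
          congrArg (fun k => lengthProj Φ k x) (sub_add_cancel _ _)).trans (sum_lengthProj x)
      refine ⟨T ×ˢ T, ?_⟩
      rintro ⟨x, hx⟩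
      refine Subtype.ext ?_
      rw [AddSubmonoidClass.coe_finsetSum]
      change ∑ g ∈ T ×ˢ T, TensorProduct.map (lengthProj Φ (g.1 + 1)) (lengthProj Φ (g.2 + 1)) x = x
      clear hx
      induction x with
      | zero => simp
      | add x y hx hy => simp only [map_add, Finset.sum_add_distrib, hx, hy]
      | tmul x y =>
        simp only [TensorProduct.map_tmul]
        rw [Finset.sum_product]
        simp only [← TensorProduct.tmul_sum, hT, ← TensorProduct.sum_tmul] }
  d_π := by
    rintro g ⟨x, hx⟩
    refine Subtype.ext ((tensor_map_map _ _ _ _ x).trans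
      (Eq.trans ?_ (tensor_map_map _ _ _ _ x).symm))
    refine tensor_operator_ext (fun x => ?_) (fun x => ?_) x
    · rw [LinearMap.comp_apply, boundary_lengthProj, LinearMap.comp_apply]
      congr 2
      simp
    · simp
  δ_π := by
    rintro g ⟨x, hx⟩
    refine Subtype.ext ((tensor_map_map _ _ _ _ x).trans
      (Eq.trans ?_ (tensor_map_map _ _ _ _ x).symm))
    refine tensor_operator_ext (fun x => ?_) (fun x => ?_) x
    · simp
    · rw [LinearMap.comp_apply, coboundary_lengthProj hΦ, LinearMap.comp_apply]
      congr 2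
  ε₁_π := by
    rintro g ⟨x, hx⟩
    refine Subtype.ext ((tensor_map_map _ _ _ _ x).trans
      (Eq.trans ?_ (tensor_map_map _ _ _ _ x).symm))
    refine tensor_operator_ext (fun x => ?_) (fun x => ?_) x
    · exact signOp_lengthProj _ x
    · simp

end ConcreteBicomplex

/-! ### Homogeneous parts of the pages; transfer of torsion-freeness. -/

namespace Bicomplex

variable {R M : Type*} [CommRing R] [AddCommGroup M] [Module R M]

/-- The homogeneous part of bidegree `g` of the first page. -/
def Part₁ (A : Bicomplex R M) (g : ℤ × ℤ) : Type _ := ↥(LinearMap.range (A.π₁ g))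

instance (A : Bicomplex R M) (g : ℤ × ℤ) : AddCommGroup (A.Part₁ g) :=
  inferInstanceAs (AddCommGroup ↥(LinearMap.range (A.π₁ g)))

instance (A : Bicomplex R M) (g : ℤ × ℤ) : Module R (A.Part₁ g) :=
  inferInstanceAs (Module R ↥(LinearMap.range (A.π₁ g)))

/-- The homogeneous part of bidegree `g` of the second page. -/
def Part₂ (A : Bicomplex R M) (g : ℤ × ℤ) : Type _ := ↥(LinearMap.range (A.π₂ g))

instance (A : Bicomplex R M) (g : ℤ × ℤ) : AddCommGroup (A.Part₂ g) :=
  inferInstanceAs (AddCommGroup ↥(LinearMap.range (A.π₂ g)))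

instance (A : Bicomplex R M) (g : ℤ × ℤ) : Module R (A.Part₂ g) :=
  inferInstanceAs (Module R ↥(LinearMap.range (A.π₂ g)))

theorem exists_equiv_part₁ (A : Bicomplex R M) (p q : ℤ) :
    Nonempty (A.E 1 p (q - p) ≃+ A.Part₁ (p, q)) := by
  obtain ⟨G⟩ := A.exists_equiv_π₁ p (q - p)
  rw [add_sub_cancel] at G
  exact ⟨G.toAddEquiv⟩

theorem exists_equiv_part₂ (A : Bicomplex R M) (p q : ℤ) :
    Nonempty (A.E 2 p (q - p) ≃+ A.Part₂ (p, q)) := by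
  obtain ⟨G⟩ := A.exists_equiv_π₂ p (q - p)
  rw [add_sub_cancel] at G
  exact ⟨G.toAddEquiv⟩

theorem isTorsionFree_of_part₁ (A : Bicomplex R M)
    (h : ∀ g, Module.IsTorsionFree R (A.Part₁ g)) : Module.IsTorsionFree R A.E₁ :=
  A.grading₁.isTorsionFree h

theorem isTorsionFree_of_part₂ (A : Bicomplex R M)
    (h : ∀ g, Module.IsTorsionFree R (A.Part₂ g)) : Module.IsTorsionFree R A.E₂ :=
  A.grading₂.isTorsionFree h

end Bicomplex

theorem isTorsionFree_of_addEquiv {X Y : Type*} [AddCommGroup X] [AddCommGroup Y] [Module ℤ Y]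
    (F : X ≃+ Y) (h : IsAddTorsionFree X) : Module.IsTorsionFree ℤ Y :=
  have : Module.IsTorsionFree ℤ X := inferInstance
  F.symm.injective.moduleIsTorsionFree F.symm fun n y => map_intCast_smul F.symm ℤ ℤ n y

theorem finite_submodule {R X : Type*} [CommRing R] [IsNoetherianRing R] [AddCommGroup X]
    [Module R X] [Module.Finite R X] (S : Submodule R X) : Module.Finite R ↥S :=
  inferInstance

theorem isTorsionFree_submodule {R X : Type*} [CommRing R] [AddCommGroup X] [Module R X]
    [Module.IsTorsionFree R X] (S : Submodule R X) : Module.IsTorsionFree R ↥S :=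
  inferInstance

theorem isTorsionFree_tensor {R X Y : Type*} [CommRing R] [IsDomain R] [AddCommGroup X]
    [AddCommGroup Y] [Module R X] [Module R Y] [Module.Free R X] [Module.Free R Y] :
    Module.IsTorsionFree R (X ⊗[R] Y) :=
  inferInstance

/-! ### The pages of the statement as pages of the abstract bicomplex. -/

section Identification

variable {V : Type*} [DecidableEq V] {Φ : Set (Finset V)} [Fintype V]

/-- The sum of the N^{i,i+n} with i ≤ p consists of those elements of N whose components in all
other bidegrees vanish, because the length projections grade N. -/
theorem mem_Fil_iff (hΦ : IsLowerSet Φ) (p n : ℤ) (x : ↥(Ntot Φ)) :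
    (x : Chain Φ ⊗[ℤ] Chain Φ) ∈ Fil Φ p n ↔ x ∈ (bicomplex hΦ).F p n := by
  constructor
  · intro hx
    refine Bicomplex.mem_F.2 fun a b hab => Subtype.ext ?_
    have hle : Fil Φ p n ≤ LinearMap.ker
        (TensorProduct.map (lengthProj Φ (a + 1)) (lengthProj Φ (b + 1))) :=
      iSup₂_le fun i hi y hy => by
        refine LinearMap.mem_ker.2 ((lengthProj_of_mem_N a b hy).trans (if_neg ?_))
        omega
    exact LinearMap.mem_ker.1 (hle hx)
  · intro hx
    obtain ⟨T, hT⟩ := (bicomplex hΦ).grading.sum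
    have h1 := congrArg Subtype.val (hT x)
    rw [AddSubmonoidClass.coe_finsetSum] at h1
    rw [← h1]
    refine Submodule.sum_mem _ fun g _ => ?_
    by_cases hg : g.1 ≤ p ∧ g.2 = g.1 + n
    · have h2 : N Φ g.1 g.2 ≤ Fil Φ p n := by
        rw [hg.2]
        exact le_iSup₂ (f := fun (i : ℤ) (_ : i ≤ p) => N Φ i (i + n)) g.1 hg.1
      have h3 := lengthProj_mem_N (Φ := Φ) g.1 g.2 x.1 x.2
      exact h2 h3
    · rw [Bicomplex.mem_F.1 hx g.1 g.2 hg]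
      exact Submodule.zero_mem _

theorem bicomplex_Δ (hΦ : IsLowerSet Φ) (x : ↥(Ntot Φ)) :
    ((bicomplex hΦ).Δ x : Chain Φ ⊗[ℤ] Chain Φ) = Delta Φ x :=
  congrArg (TensorProduct.map (boundary Φ) LinearMap.id (x : Chain Φ ⊗[ℤ] Chain Φ) + ·)
    (tensor_map_map _ _ _ _ (x : Chain Φ ⊗[ℤ] Chain Φ))

theorem mem_Zr_iff (hΦ : IsLowerSet Φ) (r p n : ℤ) (x : ↥(Ntot Φ)) :
    (x : Chain Φ ⊗[ℤ] Chain Φ) ∈ Zr Φ r p n ↔ x ∈ (bicomplex hΦ).Z r p n := by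
  refine Iff.trans ?_ (and_congr (mem_Fil_iff hΦ p n x)
    (mem_Fil_iff hΦ (p - r) (n + 1) ((bicomplex hΦ).Δ x)))
  rw [bicomplex_Δ]
  rfl

theorem Zr_le_Ntot (r p n : ℤ) : Zr Φ r p n ≤ Ntot Φ :=
  inf_le_left.trans (Fil_le_Ntot Φ p n)

theorem mem_Br_iff (hΦ : IsLowerSet Φ) (r p n : ℤ) (x : ↥(Ntot Φ)) :
    (x : Chain Φ ⊗[ℤ] Chain Φ) ∈ Br Φ r p n ↔ x ∈ (bicomplex hΦ).B r p n := by
  constructor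
  · intro hx
    obtain ⟨y, hy, _, ⟨z, hz, rfl⟩, hyz⟩ := Submodule.mem_sup.1 hx
    refine Submodule.mem_sup.2 ⟨⟨y, Zr_le_Ntot _ _ _ hy⟩, (mem_Zr_iff hΦ _ _ _ _).1 hy, _,
      ⟨⟨z, Zr_le_Ntot _ _ _ hz⟩, (mem_Zr_iff hΦ _ _ _ _).1 hz, rfl⟩, Subtype.ext ?_⟩
    refine Eq.trans ?_ hyz
    exact congrArg (y + ·) (bicomplex_Δ hΦ ⟨z, _⟩)
  · intro hx
    obtain ⟨y, hy, _, ⟨z, hz, rfl⟩, rfl⟩ := Submodule.mem_sup.1 hx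
    refine Submodule.add_mem_sup ((mem_Zr_iff hΦ _ _ _ _).2 hy)
      ⟨z, (mem_Zr_iff hΦ _ _ _ _).2 hz, (bicomplex_Δ hΦ z).symm⟩

/-- All cycles and boundaries of the spectral sequence lie in N, so it does not matter whether they
are formed in N or in the full tensor square. -/
theorem exists_equiv_bicomplex_E (hΦ : IsLowerSet Φ) (r p q : ℤ) :
    Nonempty (E Φ r p q ≃ₗ[ℤ] (bicomplex hΦ).E r p (q - p)) := by
  let ι : ↥((bicomplex hΦ).Z r p (q - p)) →ₗ[ℤ] ↥(Zr Φ r p (q - p)) :=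
    { toFun := fun x => ⟨x.1.1, (mem_Zr_iff hΦ _ _ _ x.1).2 x.2⟩
      map_add' := fun _ _ => rfl
      map_smul' := fun _ _ => rfl }
  let f := ((Br Φ r p (q - p)).submoduleOf (Zr Φ r p (q - p))).mkQ ∘ₗ ι
  have hf : Function.Surjective f := by
    intro y
    obtain ⟨⟨x, hx⟩, rfl⟩ := Submodule.mkQ_surjective _ y
    exact ⟨⟨⟨x, Zr_le_Ntot _ _ _ hx⟩, (mem_Zr_iff hΦ _ _ _ _).1 hx⟩, rfl⟩
  obtain ⟨F, -⟩ := exists_equiv_of_ker_eq hf (Submodule.mkQ_surjective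
    (((bicomplex hΦ).B r p (q - p)).submoduleOf ((bicomplex hΦ).Z r p (q - p)))) fun x => by
      refine (Submodule.Quotient.mk_eq_zero _).trans
        (Iff.trans ?_ (Submodule.Quotient.mk_eq_zero _).symm)
      exact mem_Br_iff hΦ r p (q - p) x.1
  exact ⟨F⟩

theorem exists_addEquiv_part₁ (hΦ : IsLowerSet Φ) (p q : ℤ) :
    Nonempty (E Φ 1 p q ≃+ (bicomplex hΦ).Part₁ (p, q)) := by
  obtain ⟨F⟩ := exists_equiv_bicomplex_E hΦ 1 p q
  obtain ⟨G⟩ := (bicomplex hΦ).exists_equiv_part₁ p q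
  exact ⟨F.toAddEquiv.trans G⟩

theorem exists_addEquiv_part₂ (hΦ : IsLowerSet Φ) (p q : ℤ) :
    Nonempty (E Φ 2 p q ≃+ (bicomplex hΦ).Part₂ (p, q)) := by
  obtain ⟨F⟩ := exists_equiv_bicomplex_E hΦ 2 p q
  obtain ⟨G⟩ := (bicomplex hΦ).exists_equiv_part₂ p q
  exact ⟨F.toAddEquiv.trans G⟩

theorem isTorsionFree_E₁ (hΦ : IsLowerSet Φ) (h : ∀ p q : ℤ, IsAddTorsionFree (E Φ 1 p q)) :
    Module.IsTorsionFree ℤ (bicomplex hΦ).E₁ :=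
  (bicomplex hΦ).isTorsionFree_of_part₁ fun g => by
    obtain ⟨F⟩ := exists_addEquiv_part₁ hΦ g.1 g.2
    exact isTorsionFree_of_addEquiv F (h g.1 g.2)

theorem isTorsionFree_E₂ (hΦ : IsLowerSet Φ) (h : ∀ p q : ℤ, IsAddTorsionFree (E Φ 2 p q)) :
    Module.IsTorsionFree ℤ (bicomplex hΦ).E₂ :=
  (bicomplex hΦ).isTorsionFree_of_part₂ fun g => by
    obtain ⟨F⟩ := exists_addEquiv_part₂ hΦ g.1 g.2
    exact isTorsionFree_of_addEquiv F (h g.1 g.2)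

theorem finite_Ntot (Φ : Set (Finset V)) : Module.Finite ℤ ↥(Ntot Φ) := by
  have : Module.Finite ℤ (Chain Φ ⊗[ℤ] Chain Φ) := Module.Finite.tensorProduct ℤ _ _
  exact finite_submodule (Ntot Φ)

end Identification

theorem isTorsionFree_Ntot {V : Type*} [DecidableEq V] (Φ : Set (Finset V)) : Module.IsTorsionFree ℤ ↥(Ntot Φ) := by
  have : Module.IsTorsionFree ℤ (Chain Φ ⊗[ℤ] Chain Φ) := isTorsionFree_tensor
  exact isTorsionFree_submodule (Ntot Φ)

/-! ### Tensor squares of a tensor product decomposition. -/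

section TensorSquare

/-- Isomorphisms from a tensor product. -/
abbrev TensorEquiv (R X Y Z : Type*) [CommRing R] [AddCommGroup X] [Module R X] [AddCommGroup Y]
    [Module R Y] [AddCommGroup Z] [Module R Z] : Type _ :=
  X ⊗[R] Y ≃ₗ[R] Z

variable {R X Y Z : Type*} [CommRing R] [AddCommGroup X] [Module R X] [AddCommGroup Y]
  [Module R Y] [AddCommGroup Z] [Module R Z] (J : X ⊗[R] Y ≃ₗ[R] Z)

/-- The isomorphism of tensor squares `(a ⊗ b) ⊗ (c ⊗ d) ↦ J (a ⊗ c) ⊗ J (b ⊗ d)`. -/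
noncomputable def tensorSquare : (X ⊗[R] X) ⊗[R] (Y ⊗[R] Y) ≃ₗ[R] Z ⊗[R] Z :=
  TensorProduct.tensorTensorTensorComm R X X Y Y ≪≫ₗ TensorProduct.congr J J

theorem tensorSquare_tmul (a b : X) (c d : Y) :
    tensorSquare J ((a ⊗ₜ b) ⊗ₜ (c ⊗ₜ d)) = J (a ⊗ₜ c) ⊗ₜ[R] J (b ⊗ₜ d) :=
  rfl

variable {J}

/-- A twisted Leibniz rule for F passes to F ⊗ 1, with the twist acting on the same tensor slot. The
middle factors are interchanged without a sign, so no further sign appears. -/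
theorem map_left_tensorSquare {F : Z →ₗ[R] Z} {f ε : X →ₗ[R] X} {g : Y →ₗ[R] Y}
    (h : ∀ a c, F (J (a ⊗ₜ c)) = J (f a ⊗ₜ c) + J (ε a ⊗ₜ g c)) (x : X ⊗[R] X) (y : Y ⊗[R] Y) :
    TensorProduct.map F LinearMap.id (tensorSquare J (x ⊗ₜ y)) =
      tensorSquare J (TensorProduct.map f LinearMap.id x ⊗ₜ y) +
        tensorSquare J (TensorProduct.map ε LinearMap.id x ⊗ₜ TensorProduct.map g LinearMap.id y) := by
  induction x with
  | zero => simp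
  | add x x' hx hx' =>
    simp only [TensorProduct.add_tmul, map_add, hx, hx']
    abel
  | tmul a b =>
    induction y with
    | zero => simp
    | add y y' hy hy' =>
      simp only [TensorProduct.tmul_add, map_add, hy, hy']
      abel
    | tmul c d =>
      simp only [TensorProduct.map_tmul, tensorSquare_tmul, h, LinearMap.id_apply,
        TensorProduct.add_tmul]

theorem map_right_tensorSquare {F : Z →ₗ[R] Z} {f ε : X →ₗ[R] X} {g : Y →ₗ[R] Y}
    (h : ∀ a c, F (J (a ⊗ₜ c)) = J (f a ⊗ₜ c) + J (ε a ⊗ₜ g c)) (x : X ⊗[R] X) (y : Y ⊗[R] Y) :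
    TensorProduct.map LinearMap.id F (tensorSquare J (x ⊗ₜ y)) =
      tensorSquare J (TensorProduct.map LinearMap.id f x ⊗ₜ y) +
        tensorSquare J (TensorProduct.map LinearMap.id ε x ⊗ₜ TensorProduct.map LinearMap.id g y) := by
  induction x with
  | zero => simp
  | add x x' hx hx' =>
    simp only [TensorProduct.add_tmul, map_add, hx, hx']
    abel
  | tmul a b =>
    induction y with
    | zero => simp
    | add y y' hy hy' =>
      simp only [TensorProduct.tmul_add, map_add, hy, hy']
      abel
    | tmul c d =>
      simp only [TensorProduct.map_tmul, tensorSquare_tmul, h, LinearMap.id_apply,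
        TensorProduct.tmul_add]

theorem map_tensorSquare_map {F G : Z →ₗ[R] Z} {f f' : X →ₗ[R] X} {g g' : Y →ₗ[R] Y}
    (hF : ∀ a c, F (J (f a ⊗ₜ g c)) = J (f a ⊗ₜ g c))
    (hG : ∀ a c, G (J (f' a ⊗ₜ g' c)) = J (f' a ⊗ₜ g' c)) (x : X ⊗[R] X) (y : Y ⊗[R] Y) :
    TensorProduct.map F G (tensorSquare J (TensorProduct.map f f' x ⊗ₜ TensorProduct.map g g' y)) =
      tensorSquare J (TensorProduct.map f f' x ⊗ₜ TensorProduct.map g g' y) := by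
  induction x with
  | zero => simp
  | add x x' hx hx' => simp only [TensorProduct.add_tmul, map_add, hx, hx']
  | tmul a b =>
    induction y with
    | zero => simp
    | add y y' hy hy' => simp only [TensorProduct.tmul_add, map_add, hy, hy']
    | tmul c d => simp only [TensorProduct.map_tmul, tensorSquare_tmul, hF, hG]

/-- An isomorphism out of a tensor product over a principal ideal domain restricts to the tensor
product of submodules. -/
theorem exists_restrict_tensor_equiv [IsDomain R] [IsPrincipalIdealRing R]
    [Module.IsTorsionFree R X] [Module.IsTorsionFree R Y] (S : X ⊗[R] Y ≃ₗ[R] Z)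
    {s : Set X} {t : Set Y} {P : Submodule R X} {Q : Submodule R Y} {T : Submodule R Z}
    (hP : P = Submodule.span R s) (hQ : Q = Submodule.span R t)
    (h : ∀ x ∈ s, ∀ y ∈ t, S (x ⊗ₜ y) ∈ T)
    (h' : T ≤ Submodule.span R {z | ∃ x ∈ P, ∃ y ∈ Q, z = S (x ⊗ₜ y)}) :
    ∃ F : ↥P ⊗[R] ↥Q ≃ₗ[R] ↥T, ∀ x y, (F (x ⊗ₜ y) : Z) = S ((x : X) ⊗ₜ (y : Y)) := by
  let f : ↥P ⊗[R] ↥Q →ₗ[R] Z := S.toLinearMap ∘ₗ TensorProduct.map P.subtype Q.subtype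
  -- Torsion-free modules over a principal ideal domain are flat, so P ⊗ Q embeds in X ⊗ Y.
  have hf : Function.Injective f :=
    S.injective.comp (TensorProduct.map_injective_of_flat_flat _ _ P.subtype_injective
      Q.subtype_injective)
  have h1 : ∀ x ∈ s, Q ≤ T.comap (S.toLinearMap ∘ₗ TensorProduct.mk R X Y x) := fun x hx => by
    rw [hQ]
    exact Submodule.span_le.2 fun y hy => h x hx y hy
  have h2 : ∀ y ∈ Q, P ≤ T.comap (S.toLinearMap ∘ₗ (TensorProduct.mk R X Y).flip y) :=
    fun y hy => by
      rw [hP]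
      exact Submodule.span_le.2 fun x hx => h1 x hx hy
  have hT : LinearMap.range f = T := by
    refine le_antisymm ?_ (h'.trans (Submodule.span_le.2 ?_))
    · rintro _ ⟨u, rfl⟩
      induction u with
      | zero => rw [map_zero]; exact Submodule.zero_mem _
      | add u v hu hv => rw [map_add]; exact Submodule.add_mem _ hu hv
      | tmul x y => exact h2 y y.2 x.2
    · rintro _ ⟨x, hx, y, hy, rfl⟩
      exact ⟨⟨x, hx⟩ ⊗ₜ ⟨y, hy⟩, rfl⟩
  exact ⟨LinearEquiv.ofInjective f hf ≪≫ₗ LinearEquiv.ofEq _ _ hT, fun _ _ => rfl⟩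

end TensorSquare

/-! ### Chains of a join as a tensor product. -/

section JoinChains

variable {V W : Type*} {Φ : Set (Finset V)} {Ψ : Set (Finset W)}

/-- The simplices of a join. -/
def joinSet (Φ : Set (Finset V)) (Ψ : Set (Finset W)) : Set (Finset (V ⊕ W)) :=
  {s | s.toLeft ∈ Φ ∧ s.toRight ∈ Ψ}

theorem isLowerSet_joinSet (hΦ : IsLowerSet Φ) (hΨ : IsLowerSet Ψ) : IsLowerSet (joinSet Φ Ψ) :=
  fun _ _ h hs => ⟨hΦ (Finset.toLeft_monotone h) hs.1, hΨ (Finset.toRight_monotone h) hs.2⟩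

theorem isLowerSet_allSimplices (K : AbstractSimplicialComplex V) :
    IsLowerSet (allSimplices K) :=
  fun _ _ h hs => allSimplices_of_subset K hs h

/-- Once the empty simplex is counted, the two sides of a simplex of the join can be prescribed
independently; this product structure is what the tensor decomposition needs. -/
theorem allSimplices_join (K : AbstractSimplicialComplex V) (L : AbstractSimplicialComplex W) :
    allSimplices (join K L) = joinSet (allSimplices K) (allSimplices L) := by
  ext s
  constructor
  · rintro (rfl | ⟨-, σ, hσ, τ, hτ, rfl⟩)
    · exact ⟨Or.inl (by ext; simp), Or.inl (by ext; simp)⟩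
    · refine ⟨?_, ?_⟩ <;> simpa
  · rintro ⟨h1, h2⟩
    rcases s.eq_empty_or_nonempty with rfl | hs
    · exact Or.inl rfl
    · exact Or.inr ⟨hs, _, h1, _, h2, Finset.toLeft_disjSum_toRight.symm⟩

/-- The concatenation of a sequence in `V` and a sequence in `W`. -/
def joinList (l : List V) (m : List W) : List (V ⊕ W) :=
  l.map Sum.inl ++ m.map Sum.inr

theorem inl_mem_joinList {l : List V} {m : List W} {v : V} : Sum.inl v ∈ joinList l m ↔ v ∈ l := by
  simp [joinList]

theorem inr_mem_joinList {l : List V} {m : List W} {w : W} : Sum.inr w ∈ joinList l m ↔ w ∈ m := by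
  simp [joinList]

theorem length_joinList (l : List V) (m : List W) :
    (joinList l m).length = l.length + m.length := by
  simp [joinList]

theorem nodup_joinList {l : List V} {m : List W} :
    (joinList l m).Nodup ↔ l.Nodup ∧ m.Nodup := by
  rw [joinList, List.nodup_append', List.nodup_map_iff Sum.inl_injective,
    List.nodup_map_iff Sum.inr_injective]
  refine ⟨fun h => ⟨h.1, h.2.1⟩, fun h => ⟨h.1, h.2, ?_⟩⟩
  simp [List.disjoint_left]

/-- For vanishing, the undetermined sign is harmless. Applied to a difference of alternating
functions, this carries an equality from one ordering of a simplex to all orderings. -/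
theorem IsAlternating.eq_zero_of_perm {T : Type*} [AddCommGroup T] {f : List V → T}
    (hf : IsAlternating f) {l m : List V} (h : l.Perm m) (hm : f m = 0) : f l = 0 := by
  rcases hf.eq_or_eq_neg_of_perm h with h | h
  · rw [h, hm]
  · rw [h, hm, neg_zero]

theorem IsAlternating.sub {T : Type*} [AddCommGroup T] {f g : List V → T} (hf : IsAlternating f)
    (hg : IsAlternating g) : IsAlternating fun l => f l - g l := by
  intro a b c v w
  dsimp only
  rw [hf, hg]
  abel

variable [DecidableEq V] [DecidableEq W]

theorem toLeft_toFinset_joinList (l : List V) (m : List W) :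
    (joinList l m).toFinset.toLeft = l.toFinset := by
  ext v
  simp [inl_mem_joinList]

theorem toRight_toFinset_joinList (l : List V) (m : List W) :
    (joinList l m).toFinset.toRight = m.toFinset := by
  ext v
  simp [inr_mem_joinList]

theorem isChainSimplex_joinList {l : List V} {m : List W} :
    IsChainSimplex (joinSet Φ Ψ) (joinList l m) ↔ IsChainSimplex Φ l ∧ IsChainSimplex Ψ m := by
  rw [IsChainSimplex, nodup_joinList, joinSet, Set.mem_ofPred_eq, toLeft_toFinset_joinList,
    toRight_toFinset_joinList]
  exact and_and_and_comm

theorem exists_perm_joinList {n : List (V ⊕ W)} (hn : n.Nodup) :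
    ∃ l m, n.Perm (joinList l m) := by
  refine ⟨n.toFinset.toLeft.toList, n.toFinset.toRight.toList, ?_⟩
  refine (List.perm_ext_iff_of_nodup hn (nodup_joinList.2 ⟨Finset.nodup_toList _,
    Finset.nodup_toList _⟩)).2 ?_
  rintro (v | w)
  · simp [inl_mem_joinList]
  · simp [inr_mem_joinList]

theorem isAlternating_joinList_left (m : List W) :
    IsAlternating fun l : List V => chain (joinSet Φ Ψ) (joinList l m) := by
  intro a b c v w
  have h := isAlternating_chain (joinSet Φ Ψ) (a.map Sum.inl) (b.map Sum.inl)
    (c.map Sum.inl ++ m.map Sum.inr) (Sum.inl v) (Sum.inl w)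
  simpa [joinList] using h

theorem isAlternating_joinList_right (l : List V) :
    IsAlternating fun m : List W => chain (joinSet Φ Ψ) (joinList l m) := by
  intro a b c v w
  have h := isAlternating_chain (joinSet Φ Ψ) (l.map Sum.inl ++ a.map Sum.inr) (b.map Sum.inr)
    (c.map Sum.inr) (Sum.inr v) (Sum.inr w)
  simpa [joinList] using h

theorem isAlternating_comp_chain {T : Type*} [AddCommGroup T] (f : Chain Φ →+ T) :
    IsAlternating fun l => f (chain Φ l) := by
  intro a b c v w
  dsimp only
  rw [isAlternating_chain, map_neg]

theorem toFinset_perm_toList {l : List V} (hl : l.Nodup) : l.Perm l.toFinset.toList :=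
  (List.perm_ext_iff_of_nodup hl (Finset.nodup_toList _)).2 fun v => by simp

/-- The pairs of a simplex of `Φ` and a simplex of `Ψ` correspond to the simplices of the join. -/
def joinSetEquiv (Φ : Set (Finset V)) (Ψ : Set (Finset W)) : ↥Φ × ↥Ψ ≃ ↥(joinSet Φ Ψ) where
  toFun s := ⟨s.1.1.disjSum s.2.1, by simp [joinSet]⟩
  invFun s := (⟨s.1.toLeft, s.2.1⟩, ⟨s.1.toRight, s.2.2⟩)
  left_inv s := by simp
  right_inv s := Subtype.ext Finset.toLeft_disjSum_toRight

/-- The chain group of a join is the tensor product of the chain groups. -/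
theorem exists_chain_join_equiv (Φ : Set (Finset V)) (Ψ : Set (Finset W)) :
    ∃ J : TensorEquiv ℤ (Chain Φ) (Chain Ψ) (Chain (joinSet Φ Ψ)), ∀ l m,
      J (chain Φ l ⊗ₜ chain Ψ m) = chain (joinSet Φ Ψ) (joinList l m) := by
  obtain ⟨b, hb⟩ := exists_basis_chain Φ (fun S => (S : Finset V).toList)
    (fun S => ⟨Finset.nodup_toList _, by rw [Finset.toList_toFinset]; exact S.2⟩)
    fun S => Finset.toList_toFinset _
  obtain ⟨b', hb'⟩ := exists_basis_chain Ψ (fun S => (S : Finset W).toList)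
    (fun S => ⟨Finset.nodup_toList _, by rw [Finset.toList_toFinset]; exact S.2⟩)
    fun S => Finset.toList_toFinset _
  obtain ⟨b'', hb''⟩ := exists_basis_chain (joinSet Φ Ψ)
    (fun S => joinList (S : Finset (V ⊕ W)).toLeft.toList (S : Finset (V ⊕ W)).toRight.toList)
    (fun S => isChainSimplex_joinList.2
      ⟨⟨Finset.nodup_toList _, by rw [Finset.toList_toFinset]; exact S.2.1⟩,
        ⟨Finset.nodup_toList _, by rw [Finset.toList_toFinset]; exact S.2.2⟩⟩)
    fun S => by
      ext (v | w)
      · simp [inl_mem_joinList]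
      · simp [inr_mem_joinList]
  let J : TensorEquiv ℤ (Chain Φ) (Chain Ψ) (Chain (joinSet Φ Ψ)) :=
    (b.tensorProduct b').equiv b'' (joinSetEquiv Φ Ψ)
  have h0 : ∀ (S : ↥Φ) (T : ↥Ψ), J (chain Φ (Finset.toList S.1) ⊗ₜ chain Ψ (Finset.toList T.1)) =
      chain (joinSet Φ Ψ) (joinList S.1.toList T.1.toList) := fun S T => by
    rw [← hb S, ← hb' T, ← Module.Basis.tensorProduct_apply, Module.Basis.equiv_apply, hb'']
    simp [joinSetEquiv]
  -- The formula is known only for the chosen enumerations. Both sides alternate in each argument,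
  -- so it extends to arbitrary orderings, one factor at a time.
  have h1 : ∀ (l : List V) (T : ↥Ψ), IsChainSimplex Φ l →
      J (chain Φ l ⊗ₜ chain Ψ (Finset.toList T.1)) =
        chain (joinSet Φ Ψ) (joinList l T.1.toList) := fun l T hl => sub_eq_zero.1 <|
    ((isAlternating_comp_chain (J.toLinearMap ∘ₗ (TensorProduct.mk ℤ _ _).flip
      (chain Ψ (Finset.toList T.1))).toAddMonoidHom).sub
        (isAlternating_joinList_left _)).eq_zero_of_perm (toFinset_perm_toList hl.1)
          (sub_eq_zero.2 (h0 ⟨_, hl.2⟩ T))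
  have h2 : ∀ (l : List V) (m : List W), IsChainSimplex Φ l → IsChainSimplex Ψ m →
      J (chain Φ l ⊗ₜ chain Ψ m) = chain (joinSet Φ Ψ) (joinList l m) :=
    fun l m hl hm => sub_eq_zero.1 <|
      ((isAlternating_comp_chain (J.toLinearMap ∘ₗ TensorProduct.mk ℤ _ _
        (chain Φ l)).toAddMonoidHom).sub
          (isAlternating_joinList_right _)).eq_zero_of_perm (toFinset_perm_toList hm.1)
            (sub_eq_zero.2 (h1 l ⟨_, hm.2⟩ hl))
  refine ⟨J, fun l m => ?_⟩
  by_cases hl : IsChainSimplex Φ l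
  · by_cases hm : IsChainSimplex Ψ m
    · exact h2 l m hl hm
    · rw [chain_eq_zero hm, TensorProduct.tmul_zero, map_zero,
        chain_eq_zero fun h => hm (isChainSimplex_joinList.1 h).2]
  · rw [chain_eq_zero hl, TensorProduct.zero_tmul, map_zero,
      chain_eq_zero fun h => hl (isChainSimplex_joinList.1 h).1]

theorem tensor_chain_ext {T : Type*} [AddCommGroup T] {f g : Chain Φ →+ Chain Ψ →+ T}
    (h : ∀ l m, IsChainSimplex Φ l → IsChainSimplex Ψ m →
      f (chain Φ l) (chain Ψ m) = g (chain Φ l) (chain Ψ m)) (x : Chain Φ) (y : Chain Ψ) :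
    f x y = g x y := by
  refine LinearMap.congr_fun (f := (f.flip y).toIntLinearMap) (g := (g.flip y).toIntLinearMap)
    (chain_linearMap_ext fun l hl => ?_) x
  exact LinearMap.congr_fun (f := (f (chain Φ l)).toIntLinearMap)
    (g := (g (chain Φ l)).toIntLinearMap) (chain_linearMap_ext fun m hm => h l m hl hm) y

end JoinChains

/-! ### Leibniz rules on a join; N(K * L) as a tensor product. -/

section JoinOperators

/-- A tensor product isomorphism as a biadditive map. -/
def biadditive {R X Y Z : Type*} [CommRing R] [AddCommGroup X] [Module R X] [AddCommGroup Y]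
    [Module R Y] [AddCommGroup Z] [Module R Z] (J : TensorEquiv R X Y Z) : X →+ Y →+ Z :=
  AddMonoidHom.mk' (fun x => AddMonoidHom.mk' (fun y => J (x ⊗ₜ y)) fun y y' => by
    rw [TensorProduct.tmul_add, map_add]) fun x x' => by
      ext y
      exact (congrArg J (TensorProduct.add_tmul x x' y)).trans (map_add J _ _)

variable {V W : Type*} {Φ : Set (Finset V)} {Ψ : Set (Finset W)} [DecidableEq V] [DecidableEq W]
  {J : TensorEquiv ℤ (Chain Φ) (Chain Ψ) (Chain (joinSet Φ Ψ))}

theorem boundary_join (hJ : ∀ l m, J (chain Φ l ⊗ₜ chain Ψ m) = chain (joinSet Φ Ψ) (joinList l m))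
    (x : Chain Φ) (y : Chain Ψ) : boundary (joinSet Φ Ψ) (J (x ⊗ₜ y)) =
      J (boundary Φ x ⊗ₜ y) + J (signOp Φ x ⊗ₜ boundary Ψ y) :=
  tensor_chain_ext (f := (biadditive J).compr₂ (boundary (joinSet Φ Ψ)).toAddMonoidHom)
    (g := (biadditive J).comp (boundary Φ).toAddMonoidHom +
      ((biadditive J).comp (signOp Φ).toAddMonoidHom).compl₂ (boundary Ψ).toAddMonoidHom)
    (fun l m hl hm => by
      change boundary (joinSet Φ Ψ) (J (chain Φ l ⊗ₜ chain Ψ m)) =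
        biadditive J (boundary Φ (chain Φ l)) (chain Ψ m) +
          biadditive J (signOp Φ (chain Φ l)) (boundary Ψ (chain Ψ m))
      rw [hJ, boundary_chain (isChainSimplex_joinList.2 ⟨hl, hm⟩), boundary_chain hl,
        boundary_chain hm, signOp_chain, map_zsmul, AddMonoidHom.smul_apply]
      have h1 := map_faceSum ((biadditive J).flip (chain Ψ m)) (chain Φ) l
      rw [AddMonoidHom.flip_apply] at h1
      rw [h1, map_faceSum, joinList, faceSum_append, faceSum_map, faceSum_map, List.length_map]
      congr 1
      · exact congrArg (faceSum · l) (funext fun l' => (hJ l' m).symm)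
      · exact congrArg (fun f => (-1 : ℤ) ^ l.length • faceSum f m) (funext fun m' => (hJ l m').symm))
    x y

theorem coboundary_join [Fintype V] [Fintype W]
    (hJ : ∀ l m, J (chain Φ l ⊗ₜ chain Ψ m) = chain (joinSet Φ Ψ) (joinList l m))
    (hΦ : IsLowerSet Φ) (hΨ : IsLowerSet Ψ)
    (x : Chain Φ) (y : Chain Ψ) : coboundary (joinSet Φ Ψ) (J (x ⊗ₜ y)) =
      J (coboundary Φ x ⊗ₜ y) + J (signOp Φ x ⊗ₜ coboundary Ψ y) :=
  tensor_chain_ext (f := (biadditive J).compr₂ (coboundary (joinSet Φ Ψ)).toAddMonoidHom)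
    (g := (biadditive J).comp (coboundary Φ).toAddMonoidHom +
      ((biadditive J).comp (signOp Φ).toAddMonoidHom).compl₂ (coboundary Ψ).toAddMonoidHom)
    (fun l m hl hm => by
      change coboundary (joinSet Φ Ψ) (J (chain Φ l ⊗ₜ chain Ψ m)) =
        biadditive J (coboundary Φ (chain Φ l)) (chain Ψ m) +
          biadditive J (signOp Φ (chain Φ l)) (coboundary Ψ (chain Ψ m))
      rw [hJ, coboundary_chain (isLowerSet_joinSet hΦ hΨ), coboundary_chain hΦ,
        coboundary_chain hΨ, signOp_chain, map_zsmul, AddMonoidHom.smul_apply, map_sum, map_sum,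
        AddMonoidHom.finsetSum_apply, Fintype.sum_sum_type, Finset.smul_sum]
      congr 1
      · exact Finset.sum_congr rfl fun v _ => (hJ (v :: l) m).symm
      · refine Finset.sum_congr rfl fun w _ => ?_
        refine Eq.trans ?_ (congrArg ((-1 : ℤ) ^ l.length • ·) (hJ l (w :: m)).symm)
        -- The coboundary puts the new vertex w in front; moving it past l into the second block
        -- costs (-1)^|l|.
        have h := alternating_move (Sum.inr w) (m.map Sum.inr) (l.map Sum.inl) _
          (isAlternating_chain (joinSet Φ Ψ))
        rw [List.length_map] at h
        rw [joinList, joinList, List.map_cons, h, smul_smul, ← mul_pow]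
        simp)
    x y

theorem lengthProj_join
    (hJ : ∀ l m, J (chain Φ l ⊗ₜ chain Ψ m) = chain (joinSet Φ Ψ) (joinList l m)) (j k n : ℤ)
    (hn : n = j + k) (x : Chain Φ) (y : Chain Ψ) :
    lengthProj (joinSet Φ Ψ) n (J (lengthProj Φ j x ⊗ₜ lengthProj Ψ k y)) =
      J (lengthProj Φ j x ⊗ₜ lengthProj Ψ k y) :=
  tensor_chain_ext
    (f := (((biadditive J).comp (lengthProj Φ j).toAddMonoidHom).compl₂
      (lengthProj Ψ k).toAddMonoidHom).compr₂ (lengthProj (joinSet Φ Ψ) n).toAddMonoidHom)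
    (g := ((biadditive J).comp (lengthProj Φ j).toAddMonoidHom).compl₂
      (lengthProj Ψ k).toAddMonoidHom)
    (fun l m hl hm => by
      change lengthProj (joinSet Φ Ψ) n
        (biadditive J (lengthProj Φ j (chain Φ l)) (lengthProj Ψ k (chain Ψ m))) =
          biadditive J (lengthProj Φ j (chain Φ l)) (lengthProj Ψ k (chain Ψ m))
      rw [lengthProj_chain, lengthProj_chain]
      split_ifs with h1 h2
      · have h : biadditive J (chain Φ l) (chain Ψ m) = _ := hJ l m
        rw [h, lengthProj_chain, length_joinList, if_pos]
        rw [hn, ← h1, ← h2, Nat.cast_add]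
      all_goals simp only [map_zero, AddMonoidHom.zero_apply])
    x y

/-- The bicomplex of a join is the tensor product of the bicomplexes. -/
theorem exists_Ntot_join_equiv
    (hJ : ∀ l m, J (chain Φ l ⊗ₜ chain Ψ m) = chain (joinSet Φ Ψ) (joinList l m)) :
    ∃ F : TensorEquiv ℤ ↥(Ntot Φ) ↥(Ntot Ψ) ↥(Ntot (joinSet Φ Ψ)), ∀ x y,
      (F (x ⊗ₜ y) : Chain (joinSet Φ Ψ) ⊗[ℤ] Chain (joinSet Φ Ψ)) =
        tensorSquare J ((x : Chain Φ ⊗[ℤ] Chain Φ) ⊗ₜ (y : Chain Ψ ⊗[ℤ] Chain Ψ)) := by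
  have hX : Module.IsTorsionFree ℤ (Chain Φ ⊗[ℤ] Chain Φ) := isTorsionFree_tensor
  have hY : Module.IsTorsionFree ℤ (Chain Ψ ⊗[ℤ] Chain Ψ) := isTorsionFree_tensor
  refine exists_restrict_tensor_equiv (tensorSquare J) (P := Ntot Φ) (Q := Ntot Ψ)
    (T := Ntot (joinSet Φ Ψ)) rfl rfl ?_ ?_
  · rintro _ ⟨σ, τ, hσ, hτ, hστ, rfl⟩ _ ⟨σ', τ', hσ', hτ', hστ', rfl⟩
    rw [tensorSquare_tmul, hJ, hJ]
    refine tmul_mem_Ntot (isChainSimplex_joinList.2 ⟨hτ, hτ'⟩) ?_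
    rintro (v | w) h
    · exact inl_mem_joinList.2 (hστ (inl_mem_joinList.1 h))
    · exact inr_mem_joinList.2 (hστ' (inr_mem_joinList.1 h))
  · refine Submodule.span_le.2 ?_
    rintro _ ⟨σ, τ, hσ, hτ, hστ, rfl⟩
    -- After sorting the vertices by side, σ ⊆ τ becomes a pair of inclusions, one in each factor;
    -- reordering changes the tensor at most by a sign.
    obtain ⟨l, m, h1⟩ := exists_perm_joinList hσ.1
    obtain ⟨l', m', h2⟩ := exists_perm_joinList hτ.1
    rw [isChainSimplex_congr h1, isChainSimplex_joinList] at hσ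
    rw [isChainSimplex_congr h2, isChainSimplex_joinList] at hτ
    have h3 : l ⊆ l' := fun v hv =>
      inl_mem_joinList.1 (h2.subset (hστ (h1.symm.subset (inl_mem_joinList.2 hv))))
    have h4 : m ⊆ m' := fun v hv =>
      inr_mem_joinList.1 (h2.subset (hστ (h1.symm.subset (inr_mem_joinList.2 hv))))
    set T := Submodule.span ℤ {z | ∃ x ∈ Ntot Φ, ∃ y ∈ Ntot Ψ, z = tensorSquare J (x ⊗ₜ y)}
    have h5 : chain (joinSet Φ Ψ) (joinList l m) ⊗ₜ[ℤ] chain (joinSet Φ Ψ) (joinList l' m') ∈ T := by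
      refine Submodule.subset_span ⟨_, tmul_mem_Ntot hτ.1 h3, _, tmul_mem_Ntot hτ.2 h4, ?_⟩
      rw [tensorSquare_tmul, hJ, hJ]
    change _ ∈ T
    rcases (isAlternating_chain (joinSet Φ Ψ)).eq_or_eq_neg_of_perm h1 with h1 | h1 <;>
    rcases (isAlternating_chain (joinSet Φ Ψ)).eq_or_eq_neg_of_perm h2 with h2 | h2 <;>
    rw [h1, h2] <;> simpa only [TensorProduct.neg_tmul, TensorProduct.tmul_neg, neg_neg,
      Submodule.neg_mem_iff] using h5

end JoinOperators

/-! ### Transport of direct sums of tensor products. -/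

section DirectSums

theorem exists_tensor_addEquiv {R X X' Y Y' : Type*} [CommRing R] [AddCommGroup X]
    [AddCommGroup X'] [AddCommGroup Y] [AddCommGroup Y'] [Module R X] [Module R X'] [Module R Y]
    [Module R Y'] (F : X ≃+ X') (G : Y ≃+ Y') (hF : ∀ (r : R) x, F (r • x) = r • F x)
    (hG : ∀ (r : R) y, G (r • y) = r • G y) : Nonempty (X ⊗[R] Y ≃+ X' ⊗[R] Y') :=
  let F' : X ≃ₗ[R] X' := { F with map_smul' := hF }
  let G' : Y ≃ₗ[R] Y' := { G with map_smul' := hG }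
  ⟨(TensorProduct.congr F' G').toAddEquiv⟩

theorem exists_directSum_tensor_addEquiv {ι : Type*} {X X' Y Y' : ι → Type*}
    [∀ i, AddCommGroup (X i)] [∀ i, AddCommGroup (X' i)] [∀ i, AddCommGroup (Y i)]
    [∀ i, AddCommGroup (Y' i)] [∀ i, Module ℤ (X i)] [∀ i, Module ℤ (X' i)]
    [∀ i, Module ℤ (Y i)] [∀ i, Module ℤ (Y' i)]
    (F : ∀ i, Nonempty (X i ≃+ X' i)) (G : ∀ i, Nonempty (Y i ≃+ Y' i)) :
    Nonempty ((⨁ i, X i ⊗[ℤ] Y i) ≃+ ⨁ i, X' i ⊗[ℤ] Y' i) := by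
  exact ⟨DFinsupp.mapRange.addEquiv fun i => (exists_tensor_addEquiv (F i).some (G i).some
    (map_intCast_smul (F i).some ℤ ℤ) (map_intCast_smul (G i).some ℤ ℤ)).some⟩

/-- The bidegree `(p, q)` part of the tensor product of the second pages. -/
abbrev Bicomplex.TensorPart {R M X : Type*} [CommRing R] [AddCommGroup M] [Module R M]
    [AddCommGroup X] [Module R X] (A : Bicomplex R M) (B : Bicomplex R X) (p q : ℤ) : Type _ :=
  ⨁ x : {x : (ℤ × ℤ) × (ℤ × ℤ) // x.1 + x.2 = (p, q)}, A.Part₂ x.1.1 ⊗[R] B.Part₂ x.1.2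

theorem Bicomplex.exists_part₂_addEquiv {R M X Y : Type*} [CommRing R] [IsDomain R]
    [IsPrincipalIdealRing R] [AddCommGroup M] [Module R M] [AddCommGroup X] [Module R X]
    [AddCommGroup Y] [Module R Y] (hM : Module.Finite R M) (hX : Module.Finite R X)
    (A : Bicomplex R M) (B : Bicomplex R X) (C : Bicomplex R Y) (J : TensorEquiv R M X Y)
    (hδ : ∀ m x, C.δ (J (m ⊗ₜ x)) = J (A.δ m ⊗ₜ x) + J (A.ε₂ m ⊗ₜ B.δ x))
    (hd : ∀ m x, C.d (J (m ⊗ₜ x)) = J (A.d m ⊗ₜ x) + J (A.ε₁ m ⊗ₜ B.d x))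
    (hπ : ∀ g h m x, C.π (g + h + (1, 1)) (J (A.π g m ⊗ₜ B.π h x)) =
      J (A.π g m ⊗ₜ B.π h x))
    (hM' : Module.IsTorsionFree R M)
    (h₁ : Module.IsTorsionFree R A.E₁ ∨ Module.IsTorsionFree R B.E₁)
    (h₂ : Module.IsTorsionFree R A.E₂ ∨ Module.IsTorsionFree R B.E₂) (p q : ℤ) :
    Nonempty (C.Part₂ (p + 1, q + 1) ≃+ A.TensorPart B p q) := by
  obtain ⟨F⟩ := exists_equiv_of_tensor A B C J hδ hd (1, 1) hπ hM' h₁ h₂ (p, q)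
  exact ⟨F.toAddEquiv⟩

end DirectSums

/-! ### Part (b): the join. -/

section Join

variable {V W : Type*} [Fintype V] [DecidableEq V] [Fintype W] [DecidableEq W]
  {Φ : Set (Finset V)} {Ψ : Set (Finset W)}

/-- The Künneth formula for the bicomplex of a join. -/
theorem exists_part₂_joinSet_addEquiv (hΦ : IsLowerSet Φ) (hΨ : IsLowerSet Ψ)
    (h₁ : Module.IsTorsionFree ℤ (bicomplex hΦ).E₁ ∨ Module.IsTorsionFree ℤ (bicomplex hΨ).E₁)
    (h₂ : Module.IsTorsionFree ℤ (bicomplex hΦ).E₂ ∨ Module.IsTorsionFree ℤ (bicomplex hΨ).E₂)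
    (p q : ℤ) :
    Nonempty ((bicomplex (isLowerSet_joinSet hΦ hΨ)).Part₂ (p + 1, q + 1) ≃+
      (bicomplex hΦ).TensorPart (bicomplex hΨ) p q) := by
  obtain ⟨J, hJ⟩ := exists_chain_join_equiv Φ Ψ
  obtain ⟨F, hF⟩ := exists_Ntot_join_equiv hJ
  have key := Bicomplex.exists_part₂_addEquiv (finite_Ntot Φ) (finite_Ntot Ψ) (bicomplex hΦ)
    (bicomplex hΨ) (bicomplex (isLowerSet_joinSet hΦ hΨ)) F
  refine key ?_ ?_ ?_ (isTorsionFree_Ntot Φ) h₁ h₂ p q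
  · intro x y
    refine Subtype.ext ?_
    have e₁ := congrArg (TensorProduct.map LinearMap.id (coboundary (joinSet Φ Ψ))) (hF x y)
    have e₂ := map_right_tensorSquare (coboundary_join hJ hΦ hΨ) x.1 y.1
    have e₃ := hF ((bicomplex hΦ).δ x) y
    have e₄ := hF ((bicomplex hΦ).ε₂ x) ((bicomplex hΨ).δ y)
    have e := (e₁.trans e₂).trans (congrArg₂ (· + ·) e₃ e₄).symm
    exact e
  · intro x y
    refine Subtype.ext ?_
    have e₁ := congrArg (TensorProduct.map (boundary (joinSet Φ Ψ)) LinearMap.id) (hF x y)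
    have e₂ := map_left_tensorSquare (boundary_join hJ) x.1 y.1
    have e₃ := hF ((bicomplex hΦ).d x) y
    have e₄ := hF ((bicomplex hΦ).ε₁ x) ((bicomplex hΨ).d y)
    have e := (e₁.trans e₂).trans (congrArg₂ (· + ·) e₃ e₄).symm
    exact e
  · intro g h x y
    refine Subtype.ext ?_
    have e₁ := hF ((bicomplex hΦ).π g x) ((bicomplex hΨ).π h y)
    -- Lengths add: (g + 1) + (h + 1) = (g + h + 1) + 1, so the dimension in the join is g + h + 1.
    -- This is the shift by one in each degree.
    have e₂ := congrArg (TensorProduct.map (lengthProj (joinSet Φ Ψ) (g.1 + h.1 + 1 + 1))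
      (lengthProj (joinSet Φ Ψ) (g.2 + h.2 + 1 + 1))) e₁
    have e₃ := map_tensorSquare_map
      (lengthProj_join hJ (g.1 + 1) (h.1 + 1) (g.1 + h.1 + 1 + 1) (by ring))
      (lengthProj_join hJ (g.2 + 1) (h.2 + 1) (g.2 + h.2 + 1 + 1) (by ring)) x.1 y.1
    have e := (e₂.trans e₃).trans e₁.symm
    exact e

/-- The Künneth formula for the reduced cohomeology of a join. -/
theorem join_equiv (K : AbstractSimplicialComplex V) (L : AbstractSimplicialComplex W)
    (h₁ : (∀ p q : ℤ, IsAddTorsionFree (redE K 1 p q)) ∨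
      (∀ p q : ℤ, IsAddTorsionFree (redE L 1 p q)))
    (h₂ : (∀ p q : ℤ, IsAddTorsionFree (redH K p q)) ∨
      (∀ p q : ℤ, IsAddTorsionFree (redH L p q))) (p q : ℤ) :
    Nonempty (redH (join K L) (p + 1) (q + 1) ≃+
      ⨁ x : {x : (ℤ × ℤ) × (ℤ × ℤ) // x.1 + x.2 = (p, q)},
        redH K x.1.1.1 x.1.1.2 ⊗[ℤ] redH L x.1.2.1 x.1.2.2) := by
  have hK := isLowerSet_allSimplices K
  have hL := isLowerSet_allSimplices L
  obtain ⟨F⟩ := exists_part₂_joinSet_addEquiv hK hL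
    (h₁.imp (isTorsionFree_E₁ hK) (isTorsionFree_E₁ hL))
    (h₂.imp (isTorsionFree_E₂ hK) (isTorsionFree_E₂ hL)) p q
  obtain ⟨G⟩ := exists_addEquiv_part₂ (isLowerSet_joinSet hK hL) (p + 1) (q + 1)
  change Nonempty (E (allSimplices (join K L)) 2 (p + 1) (q + 1) ≃+ _)
  rw [allSimplices_join]
  obtain ⟨D⟩ := exists_directSum_tensor_addEquiv
    (ι := {x : (ℤ × ℤ) × (ℤ × ℤ) // x.1 + x.2 = (p, q)})
    (fun x => exists_addEquiv_part₂ hK x.1.1.1 x.1.1.2)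
    (fun x => exists_addEquiv_part₂ hL x.1.2.1 x.1.2.2)
  exact ⟨G.trans (F.trans D.symm)⟩

end Join
end Cohomeology

theorem mainTheorem8 {V W : Type*} [Fintype V] [DecidableEq V] [Fintype W] [DecidableEq W]
    (K : AbstractSimplicialComplex V) (L : AbstractSimplicialComplex W) :
    (∀ p q : ℤ, Nonempty
      (Cohomeology.H (Cohomeology.disjointUnion K L) p q ≃+
        Cohomeology.H K p q × Cohomeology.H L p q)) ∧
    (((∀ p q : ℤ, IsAddTorsionFree (Cohomeology.redE K 1 p q)) ∨
        (∀ p q : ℤ, IsAddTorsionFree (Cohomeology.redE L 1 p q))) →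
      ((∀ p q : ℤ, IsAddTorsionFree (Cohomeology.redH K p q)) ∨
        (∀ p q : ℤ, IsAddTorsionFree (Cohomeology.redH L p q))) →
      ∀ p q : ℤ, Nonempty
        (Cohomeology.redH (Cohomeology.join K L) (p + 1) (q + 1) ≃+
          ⨁ x : {x : (ℤ × ℤ) × (ℤ × ℤ) // x.1 + x.2 = (p, q)},
            Cohomeology.redH K x.1.1.1 x.1.1.2 ⊗[ℤ] Cohomeology.redH L x.1.2.1 x.1.2.2)) := by
  exact ⟨fun p q => Cohomeology.disjointUnion_equiv K L p q,
    fun h₁ h₂ p q => Cohomeology.join_equiv K L h₁ h₂ p q⟩
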